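/- Notation. A lexicographic bitableau of shape $\lambda$ is a filling of the boxes of the Young diagram of the partition $\lambda$ with pairs $(a,b)\in\mathbb{Z}_{>0}\times\mathbb{Z}_{>0}$ that is weakly increasing along rows and strictly increasing down columns for the lexicographic order on pairs. Its $a$-weight $a(T)$ (resp. $b$-weight $b(T)$) records how often each number occurs as the first ("top") (resp. second ("bottom")) coordinate of an entry. The sort-by-top reading word $w(T)$ is obtained by reading the bottom coordinates of the boxes with top coordinate $1$, then of those with top coordinate $2$, and so on, each time reading the rows from the bottom row to the top row and each row from left to right. A word is Yamanouchi if for every $i$ each of its suffixes contains at least as many letters $i$ as letters $i+1$. Let $\Lambda$ be the ring of symmetric functions over $\mathbb{Z}$, $m_\mu$ the monomial symmetric functions, and $s_\lambda$ the Schur functions, which form a $\mathbb{Z}$-basis of $\Lambda$; let $\langle\cdot,\cdot\rangle$ be the Hall inner product, for which the Schur functions are orthonormal. For $g\in\Lambda$ let $g[\mathbf{x}\mathbf{y}]$ be the result of substituting the products $x_iy_j$ for the variables of $g$; for every monomial $\mathbf{x}^\alpha$ its coefficient in $g[\mathbf{x}\mathbf{y}]$ is a symmetric function of $\mathbf{y}$.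 The Kronecker product $f*g=\langle f,g[\mathbf{x}\mathbf{y}]\rangle$ is obtained by taking the Hall inner product with $f$ in the variables $\mathbf{y}$. Theorem. (a) For every partition $\lambda$ and all $n,m\ge 0$, the finite set $\mathcal{B}_\lambda(n,m)$ of lexicographic bitableaux of shape $\lambda$ with entries in $[n]\times[m]$ carries a (seminormal) $\mathfrak{gl}_m$-crystal structure with weight function $b(T)$ whose operators $e_i,f_i$ ($1\le i\le m-1$) change no top coordinate, and so preserve the $a$-weight, and act on $w(T)$ by the parenthesization rule: read every letter $i+1$ as "(" and every letter $i$ as ")"; then $e_i$ turns the leftmost unmatched "(" into ")" and $f_i$ turns the rightmost unmatched ")" into "(", and the result is $0$ exactly if there is no such letter. A bitableau $T$ is of highest weight (that is, $e_i(T)=0$ for all $i$) if and only if $w(T)$ is Yamanouchi. (b) For all partitions $\lambda,\nu$, $$s_\lambda * s_\nu=\sum_{\mu}d(\lambda,\mu,\nu)\,m_\mu,$$ where $\mu$ runs over all partitions, only finitely many terms are nonzero, and $d(\lambda,\mu,\nu)$ is the (finite) number of lexicographic bitableaux $T$ of shape $\lambda$ with $a(T)=\mu$, $b(T)=\nu$,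 and Yamanouchi word $w(T)$. -/

import Mathlib

noncomputable section

namespace Kron

/-! Conventions. A partition is a `YoungDiagram`; its parts are `l.rowLen 0 ≥ l.rowLen 1 ≥ …`.
Variables, letters and tableau entries are numbered from `0` instead of from `1`, so that the
letter `k : ℕ` here is the positive integer `k + 1` of the usual convention, and "weight `l`" means
that the letter `k` occurs `l.rowLen k` times. -/

/-! ### Symmetric functions -/

/-- The symmetric functions over `ℤ` in the variables `x₀, x₁, …`: the power series of bounded
degree that are invariant under permutations of the variables. -/
def symmetricFunctions : Submodule ℤ (MvPowerSeries ℕ ℤ) where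
  carrier := {f | (∃ N : ℕ, ∀ d : ℕ →₀ ℕ, N < d.degree → MvPowerSeries.coeff d f = 0) ∧
    ∀ (p : Equiv.Perm ℕ) (d : ℕ →₀ ℕ),
      MvPowerSeries.coeff (d.mapDomain p) f = MvPowerSeries.coeff d f}
  zero_mem' := ⟨⟨0, fun d _ => by simp⟩, fun p d => by simp⟩
  add_mem' := by
    rintro f g ⟨⟨N, hN⟩, hf⟩ ⟨⟨M, hM⟩, hg⟩
    refine ⟨⟨max N M, fun d hd => ?_⟩, fun p d => ?_⟩
    · rw [map_add, hN d (lt_of_le_of_lt (le_max_left _ _) hd),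
        hM d (lt_of_le_of_lt (le_max_right _ _) hd), add_zero]
    · rw [map_add, map_add, hf, hg]
  smul_mem' := by
    rintro c f ⟨⟨N, hN⟩, hf⟩
    refine ⟨⟨N, fun d hd => ?_⟩, fun p d => ?_⟩
    · rw [map_smul, hN d hd, smul_zero]
    · rw [map_smul, map_smul, hf]

/-- The monomial symmetric function `m_l`: the sum of all monomials whose nonzero exponents are, in
some order, the parts of `l`. -/
def msym (l : YoungDiagram) : MvPowerSeries ℕ ℤ := fun d =>
  if d.support.val.map d = (l.rowLens : Multiset ℕ) then 1 else 0

/-- The Schur function `s_l`: the coefficient of `x^d` is the number of semistandard Young tableaux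
of shape `l` in which every letter `k` occurs `d k` times. -/
def schur (l : YoungDiagram) : MvPowerSeries ℕ ℤ := fun d =>
  (Nat.card {T : SemistandardYoungTableau l //
    ∀ k : ℕ, (l.cells.filter fun c => T c.1 c.2 = k).card = d k} : ℤ)

open scoped Classical in
/-- The coordinates of a symmetric function with respect to the Schur functions (which form a
`ℤ`-basis of the symmetric functions). -/
def schurCoord (f : MvPowerSeries ℕ ℤ) : YoungDiagram →₀ ℤ :=
  if h : ∃ c : YoungDiagram →₀ ℤ, Finsupp.linearCombination ℤ schur c = f then h.choose else 0

/-- The Hall inner product of symmetric functions: the bilinear form for which the Schur functions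
are orthonormal. -/
def hall (f g : MvPowerSeries ℕ ℤ) : ℤ :=
  (schurCoord f).sum fun l c => c * schurCoord g l

/-- The family of products `x_i y_j`, enumerated along the bijection `Nat.unpair : ℕ → ℕ × ℕ`.
The variable `x_i` is `X (Sum.inl i)` and `y_j` is `X (Sum.inr j)`. -/
def xyFamily (k : ℕ) : MvPowerSeries (ℕ ⊕ ℕ) ℤ :=
  MvPowerSeries.X (Sum.inl k.unpair.1) * MvPowerSeries.X (Sum.inr k.unpair.2)

/-- The substitution of the products `x_i y_j` for the variables of a power series makes sense. -/
theorem hasSubst_xyFamily : MvPowerSeries.HasSubst xyFamily where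
  const_coeff s := by simp [xyFamily]
  coeff_zero d := by
    have key : ∀ s : ℕ, MvPowerSeries.coeff d (xyFamily s) ≠ 0 →
        d = Finsupp.single (Sum.inl s.unpair.1) 1 + Finsupp.single (Sum.inr s.unpair.2) 1 := by
      intro s hs
      by_contra hne
      apply hs
      simp only [xyFamily, MvPowerSeries.X, MvPowerSeries.monomial_mul_monomial]
      exact MvPowerSeries.coeff_monomial_ne hne _
    apply Set.Subsingleton.finite
    intro s hs t ht
    have h := (key s hs).symm.trans (key t ht)
    have h1 := DFunLike.congr_fun h (Sum.inl s.unpair.1)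
    have h2 := DFunLike.congr_fun h (Sum.inr s.unpair.2)
    simp [Finsupp.single_apply] at h1 h2
    have e1 : t.unpair.1 = s.unpair.1 := by
      by_contra hc
      simp [hc] at h1
    have e2 : t.unpair.2 = s.unpair.2 := by
      by_contra hc
      simp [hc] at h2
    rw [← Nat.pair_unpair s, ← Nat.pair_unpair t, e1, e2]

/-- The Kronecker comultiplication `f ↦ f[xy]`: the products `x_i y_j` are substituted for the
variables of `f`. -/
def kronCoproduct (f : MvPowerSeries ℕ ℤ) : MvPowerSeries (ℕ ⊕ ℕ) ℤ :=
  MvPowerSeries.subst xyFamily f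

/-- The coefficient of `x^α` in a power series in the variables `x` and `y`, a power series
in `y`. -/
def xCoeff (α : ℕ →₀ ℕ) (F : MvPowerSeries (ℕ ⊕ ℕ) ℤ) : MvPowerSeries ℕ ℤ := fun β =>
  MvPowerSeries.coeff (Finsupp.sumElim α β) F

/-- The Kronecker product `f * g = ⟨f, g[xy]⟩`: the Hall inner product is taken in the variables
`y`, separately in the coefficient of every monomial `x^α`, and the result is a power series
in `x`. -/
def kronProduct (f g : MvPowerSeries ℕ ℤ) : MvPowerSeries ℕ ℤ := fun α =>
  hall f (xCoeff α (kronCoproduct g))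

/-! ### Lexicographic bitableaux -/

/-- A (lexicographic) bitableau of shape `l`: a filling of the cells of `l` with pairs `(a, b)` that
increases weakly along rows and strictly down columns for the lexicographic order. As in
`SemistandardYoungTableau`, the filling is extended by zero to all of `ℕ × ℕ`. -/
@[ext]
structure Bitableau (l : YoungDiagram) where
  /-- the entry in row `i` and column `j` -/
  entry : ℕ → ℕ → ℕ ×ₗ ℕ
  row_weak : ∀ {i j₁ j₂ : ℕ}, j₁ < j₂ → (i, j₂) ∈ l → entry i j₁ ≤ entry i j₂
  col_strict : ∀ {i₁ i₂ j : ℕ}, i₁ < i₂ → (i₂, j) ∈ l → entry i₁ j < entry i₂ j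
  zeros : ∀ {i j : ℕ}, (i, j) ∉ l → entry i j = toLex (0, 0)

namespace Bitableau

variable {l : YoungDiagram}

/-- The first ("top") coordinate of the entry in the cell `c`. -/
def top (T : Bitableau l) (c : ℕ × ℕ) : ℕ := (ofLex (T.entry c.1 c.2)).1

/-- The second ("bottom") coordinate of the entry in the cell `c`. -/
def bot (T : Bitableau l) (c : ℕ × ℕ) : ℕ := (ofLex (T.entry c.1 c.2)).2

/-- The `a`-weight: how often `k` is the top coordinate of an entry. -/
def aWeight (T : Bitableau l) (k : ℕ) : ℕ := (l.cells.filter fun c => T.top c = k).card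

/-- The `b`-weight: how often `k` is the bottom coordinate of an entry. -/
def bWeight (T : Bitableau l) (k : ℕ) : ℕ := (l.cells.filter fun c => T.bot c = k).card

end Bitableau

/-- The cells of `l`, row by row from the bottom row to the top row, and from left to right in each
row. -/
def readingCells (l : YoungDiagram) : List (ℕ × ℕ) :=
  (List.range (l.colLen 0)).reverse.flatMap fun i =>
    (List.range (l.rowLen i)).map fun j => (i, j)

/-- The cells in sort-by-top order: first those with the least top entry, then those with the next
one, and so on, each group in the order of `readingCells`. -/
def Bitableau.sortedCells {l : YoungDiagram} (T : Bitableau l) : List (ℕ × ℕ) :=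
  (List.range (l.cells.sup T.top + 1)).flatMap fun a =>
    (readingCells l).filter fun c => T.top c = a

/-- The sort-by-top reading word `w(T)`. -/
def Bitableau.word {l : YoungDiagram} (T : Bitableau l) : List ℕ := T.sortedCells.map T.bot

/-- A word is Yamanouchi if for every letter `i` each of its suffixes contains at least as many
letters `i` as letters `i + 1`. -/
def IsYamanouchi (w : List ℕ) : Prop :=
  ∀ s : List ℕ, s <:+ w → ∀ i : ℕ, s.count (i + 1) ≤ s.count i

/-- The bitableaux counted by `d(l, μ, ν)`: shape `l`, `a`-weight `μ`, `b`-weight `ν`, and Yamanouchi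
sort-by-top reading word. -/
def yamanouchiBitableaux (l μ ν : YoungDiagram) : Set (Bitableau l) :=
  {T | (∀ k, T.aWeight k = μ.rowLen k) ∧ (∀ k, T.bWeight k = ν.rowLen k) ∧ IsYamanouchi T.word}

/-- The number `d(l, μ, ν)`. -/
def dCoeff (l μ ν : YoungDiagram) : ℕ := (yamanouchiBitableaux l μ ν).ncard

/-! ### The parenthesization rule

For a fixed `i`, the letters `i + 1` of a word are read as "(" and the letters `i` as ")"; all other
letters are ignored. -/

/-- The excess of "(" over ")" among the positions `p, p + 1, …, q` of `w`. -/
def excess (i : ℕ) (w : List ℕ) (p q : ℕ) : ℤ :=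
  (((w.take (q + 1)).drop p).count (i + 1) : ℤ) - ((w.take (q + 1)).drop p).count i

/-- The "(" at position `p` of `w` is matched with the ")" at position `q`: it is the first position
at which the excess, counted from `p`, returns to zero. -/
def Matched (i : ℕ) (w : List ℕ) (p q : ℕ) : Prop :=
  p < q ∧ w[p]? = some (i + 1) ∧ w[q]? = some i ∧ excess i w p q = 0 ∧
    ∀ r, p ≤ r → r < q → 0 < excess i w p r

/-- There is an unmatched "(" at position `p` of `w`. -/
def UnmatchedOpen (i : ℕ) (w : List ℕ) (p : ℕ) : Prop :=
  w[p]? = some (i + 1) ∧ ∀ q, ¬ Matched i w p q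

/-- There is an unmatched ")" at position `q` of `w`. -/
def UnmatchedClose (i : ℕ) (w : List ℕ) (q : ℕ) : Prop :=
  w[q]? = some i ∧ ∀ p, ¬ Matched i w p q

/-- `v` arises from `u` by turning the leftmost unmatched "(", a letter `i + 1`, into a letter `i`. -/
def WordRaise (i : ℕ) (u v : List ℕ) : Prop :=
  ∃ p, IsLeast {p | UnmatchedOpen i u p} p ∧ v = u.set p i

/-- `v` arises from `u` by turning the rightmost unmatched ")", a letter `i`, into a letter `i + 1`. -/
def WordLower (i : ℕ) (u v : List ℕ) : Prop :=
  ∃ p, IsGreatest {p | UnmatchedClose i u p} p ∧ v = u.set p (i + 1)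

/-! ### Crystals -/

/-- The simple root `α_i` of `gl_m`, for `i = 0, …, m - 2`. -/
def simpleRoot {m : ℕ} (i : Fin (m - 1)) : Fin m → ℤ :=
  Pi.single ⟨i, by omega⟩ 1 - Pi.single ⟨i + 1, by omega⟩ 1

/-- A (seminormal) `gl_m`-crystal on the set `B`; the value `none` of an operator is the `0` of
crystal theory. The last five axioms say that `ε i x` and `φ i x` are the numbers of times that
`e i` and `f i` can be applied to `x`, and that their difference is given by the coroot. -/
structure GLCrystal (m : ℕ) (B : Type) where
  wt : B → Fin m → ℤ
  e : Fin (m - 1) → B → Option B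
  f : Fin (m - 1) → B → Option B
  ε : Fin (m - 1) → B → ℕ
  φ : Fin (m - 1) → B → ℕ
  e_iff_f : ∀ i x y, e i x = some y ↔ f i y = some x
  wt_e : ∀ i x y, e i x = some y → wt y = wt x + simpleRoot i
  ε_zero : ∀ i x, ε i x = 0 ↔ e i x = none
  ε_e : ∀ i x y, e i x = some y → ε i x = ε i y + 1
  φ_zero : ∀ i x, φ i x = 0 ↔ f i x = none
  φ_f : ∀ i x y, f i x = some y → φ i x = φ i y + 1
  φ_sub_ε : ∀ i x, (φ i x : ℤ) - ε i x = wt x ⟨i, by omega⟩ - wt x ⟨i + 1, by omega⟩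

/-- The bitableaux of shape `l` whose top entries are among the first `n` letters and whose bottom
entries are among the first `m` letters. -/
def BoundedBitableau (l : YoungDiagram) (n m : ℕ) : Type :=
  {T : Bitableau l // ∀ c ∈ l.cells, T.top c < n ∧ T.bot c < m}

/-- The crystal `C` on bitableaux is the one given by the sort-by-top reading word: its weight is the
`b`-weight, its operators change no top entry (and hence preserve the `a`-weight), and on reading
words they act by the parenthesization rule; in particular they are nonzero exactly when the rule
finds a letter to change. -/
structure IsSortByTopCrystal {l : YoungDiagram} {n m : ℕ}
    (C : GLCrystal m (BoundedBitableau l n m)) : Prop where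
  wt_eq : ∀ T k, C.wt T k = T.1.bWeight k
  e_eq : ∀ i T S, C.e i T = some S ↔ S.1.top = T.1.top ∧ WordRaise i T.1.word S.1.word
  e_none : ∀ i T, C.e i T = none ↔ ∀ p, ¬ UnmatchedOpen i T.1.word p
  f_eq : ∀ i T S, C.f i T = some S ↔ S.1.top = T.1.top ∧ WordLower i T.1.word S.1.word
  f_none : ∀ i T, C.f i T = none ↔ ∀ p, ¬ UnmatchedClose i T.1.word p

end Kron

end

open Kron

/-!
The letters `i + 1` and `i` of a word are steps up and down of a lattice path, and the unmatched
parentheses are read off from its height: an unmatched "(" is an up step after which the path never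
comes back to the level below it, an unmatched ")" is a down step to a new minimum (`wordRaise_iff`
and its neighbours). Since the height of a part of the reading word of a bitableau only depends on
which cells have been read, a changed letter can be compared with the entries next to it, and the
result is again a bitableau (`exists_raise`, `exists_lower`). This gives the crystal, and a word is
Yamanouchi exactly if its height never exceeds `0` on suffixes, that is, if no operator raises it.

The coefficient of `s_ν` in a symmetric function `f` is the alternating sum of the coefficients of
`f` at the monomials `x ^ (w (ν + δ) - δ)`, for the permutations `w` of the rows of `ν`
(`schurExtract`). If `f` is the generating function, by `b`-weight, of a set of bitableaux that is
closed under the operators, then the bitableaux that are not Yamanouchi cancel in this sum: those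
with a given shortest violating suffix form strings for the operators of one index, cut off at the
end where the violation would be repaired, and the weights along such a string are symmetric under
the corresponding reflection `d ↦ s_i (d + δ) - δ`. What remains is the number of Yamanouchi
bitableaux of `b`-weight `ν` (`Bitableau.schurExtract_character_eq`). For bitableaux whose top
entries all vanish this is the orthonormality `schurExtract_schur`, and since a symmetric function
with vanishing `schurExtract` is zero, the Schur functions form a basis, and `schurExtract ν` is the
Hall product with `s_ν`.

By the symmetry of `s_λ`, the variables of `s_λ[xy]` may be ordered lexicographically, so that the
coefficient of `x^α` is the generating function of the bitableaux of shape `λ` and `a`-weight `α`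
(`xCoeff_kronCoproduct_schur`). Hence `⟨s_ν, s_λ[xy]⟩` has the coefficients `d(λ, α, ν)`
(`schurExtract_xCoeff`). It remains to interchange `λ` and `ν` (`schurExtract_xCoeff_comm`). For
this, bitableaux with a single row yield the Cauchy identity: they are matrices of natural numbers,
and the Yamanouchi ones correspond to semistandard tableaux (`ncard_yamanouchi_rowDiagram`,
`card_margins`). Applying this identity to the last two of three sets of variables shows that both
`⟨s_ν, s_λ[xy]⟩` and `⟨s_λ, s_ν[xy]⟩` come from the number of three-dimensional arrays with given
margins, which is symmetric.
-/

noncomputable section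

namespace Kron

/-! ### The parenthesization rule in terms of heights -/

/-- The height of a word after its first `k` letters: each letter `i + 1` is a step up and each
letter `i` a step down. -/
def height (i : ℕ) (w : List ℕ) (k : ℕ) : ℤ :=
  ((w.take k).count (i + 1) : ℤ) - (w.take k).count i

@[simp] lemma height_zero (i : ℕ) (w : List ℕ) : height i w 0 = 0 := by simp [height]

lemma height_succ (i : ℕ) (w : List ℕ) (k : ℕ) :
    height i w (k + 1) = height i w k +
      (if w[k]? = some (i + 1) then 1 else if w[k]? = some i then -1 else 0) := by
  unfold height
  rw [List.take_add_one]
  rcases h : w[k]? with _ | x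
  · simp
  · simp only [Option.toList_some, List.count_append, List.count_singleton, Option.some.injEq,
      beq_iff_eq]
    by_cases h1 : x = i + 1
    · subst h1; simp; ring
    · by_cases h2 : x = i
      · subst h2; simp; ring
      · simp [h1, h2]

lemma height_of_length_le {i : ℕ} {w : List ℕ} {k : ℕ} (h : w.length ≤ k) :
    height i w k = height i w w.length := by
  simp [height, List.take_of_length_le h]

lemma height_length (i : ℕ) (w : List ℕ) :
    height i w w.length = (w.count (i + 1) : ℤ) - w.count i := by
  simp [height]

lemma height_length_sub (i : ℕ) (w : List ℕ) (k : ℕ) :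
    height i w w.length - height i w k = ((w.drop k).count (i + 1) : ℤ) - (w.drop k).count i := by
  have h : ∀ x, w.count x = (w.take k).count x + (w.drop k).count x := fun x => by
    rw [← List.count_append, List.take_append_drop]
  rw [height_length, h i, h (i + 1), height]
  push_cast; ring

lemma height_succ_le (i : ℕ) (w : List ℕ) (k : ℕ) : height i w (k + 1) ≤ height i w k + 1 := by
  rw [height_succ]; split_ifs <;> omega

lemma le_height_succ (i : ℕ) (w : List ℕ) (k : ℕ) : height i w k - 1 ≤ height i w (k + 1) := by
  rw [height_succ]; split_ifs <;> omega

lemma height_succ_eq_add_one {i : ℕ} {w : List ℕ} {k : ℕ} :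
    height i w (k + 1) = height i w k + 1 ↔ w[k]? = some (i + 1) := by
  rw [height_succ]; split_ifs with h1 h2 <;> simp [h1]

lemma height_succ_eq_sub_one {i : ℕ} {w : List ℕ} {k : ℕ} :
    height i w (k + 1) = height i w k - 1 ↔ w[k]? = some i := by
  rw [height_succ]; split_ifs with h1 h2
  · simp [h1]; omega
  · simp [h2]; ring
  · simp only [h2, iff_false]; omega

lemma excess_eq {i : ℕ} {w : List ℕ} {p q : ℕ} (h : p ≤ q + 1) :
    excess i w p q = height i w (q + 1) - height i w p := by
  have key : ∀ x, (w.take (q + 1)).count x =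
      (w.take p).count x + ((w.take (q + 1)).drop p).count x := by
    intro x
    conv_lhs => rw [← List.take_append_drop p (w.take (q + 1))]
    rw [List.count_append, List.take_take, min_eq_left h]
  unfold excess height
  rw [key, key]
  push_cast; ring

lemma matched_iff {i : ℕ} {w : List ℕ} {p q : ℕ} : Matched i w p q ↔
    p < q ∧ w[p]? = some (i + 1) ∧ w[q]? = some i ∧ height i w (q + 1) = height i w p ∧
      ∀ r, p < r → r ≤ q → height i w p < height i w r := by
  unfold Matched
  refine and_congr_right fun h0 => and_congr_right fun _ => and_congr_right fun _ => and_congr ?_ ?_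
  · rw [excess_eq (by omega)]; omega
  · constructor
    · intro h r h1 h2
      obtain ⟨r, rfl⟩ := Nat.exists_eq_succ_of_ne_zero (by omega : r ≠ 0)
      have := h r (by omega) (by omega)
      rw [excess_eq (by omega)] at this
      simp only [Nat.succ_eq_add_one]; omega
    · intro h r h1 h2
      rw [excess_eq (by omega)]
      have := h (r + 1) (by omega) (by omega)
      omega

/-- A "(" is unmatched if and only if the height never comes back to its level before that step. -/
lemma unmatchedOpen_iff {i : ℕ} {w : List ℕ} {p : ℕ} :
    UnmatchedOpen i w p ↔ ∀ k, p < k → height i w p < height i w k := by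
  constructor
  · rintro ⟨hp, hq⟩
    by_contra! hcon
    classical
    have h1 := height_succ_eq_add_one.2 hp
    obtain ⟨hk, hle⟩ := Nat.find_spec hcon
    have hmin : ∀ r, p < r → r < Nat.find hcon → height i w p < height i w r := by
      intro r hr hr'
      have := Nat.find_min hcon hr'
      push Not at this
      exact this hr
    generalize Nat.find hcon = k at *
    have hk1 : k ≠ p + 1 := by rintro rfl; omega
    obtain ⟨q, rfl⟩ := Nat.exists_eq_succ_of_ne_zero (by omega : k ≠ 0)
    simp only [Nat.succ_eq_add_one] at *
    have h2 := hmin q (by omega) (by omega)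
    have h3 := le_height_succ i w q
    refine hq q (matched_iff.2 ⟨by omega, hp, ?_, by omega, fun r hr hr' => hmin r hr (by omega)⟩)
    rw [← height_succ_eq_sub_one]; omega
  · intro h
    refine ⟨?_, fun q hq => ?_⟩
    · rw [← height_succ_eq_add_one]
      have := h (p + 1) (by omega)
      have := height_succ_le i w p
      omega
    · obtain ⟨h1, -, -, h2, -⟩ := matched_iff.1 hq
      have := h (q + 1) (by omega)
      omega

/-- A ")" is unmatched if and only if it leads to a level below all earlier ones. -/
lemma unmatchedClose_iff {i : ℕ} {w : List ℕ} {q : ℕ} :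
    UnmatchedClose i w q ↔ ∀ k, k ≤ q → height i w (q + 1) < height i w k := by
  constructor
  · rintro ⟨hq, hp⟩
    by_contra! hcon
    classical
    have h1 := height_succ_eq_sub_one.2 hq
    obtain ⟨k, hk, hle, hmax⟩ : ∃ k, k ≤ q ∧ height i w k ≤ height i w (q + 1) ∧
        ∀ r, k < r → r ≤ q → height i w (q + 1) < height i w r := by
      obtain ⟨k, hk, hle⟩ := hcon
      let P := fun k => height i w k ≤ height i w (q + 1)
      refine ⟨Nat.findGreatest P q, Nat.findGreatest_le q, Nat.findGreatest_spec (P := P) hk hle,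
        fun r hr hr' => ?_⟩
      exact not_le.1 (Nat.findGreatest_is_greatest (P := P) hr hr')
    have hkq : k ≠ q := by rintro rfl; omega
    have h2 := hmax (k + 1) (by omega) (by omega)
    have h3 := height_succ_le i w k
    refine hp k (matched_iff.2 ⟨by omega, ?_, hq, by omega, fun r hr hr' => ?_⟩)
    · rw [← height_succ_eq_add_one]; omega
    · have := hmax r hr hr'; omega
  · intro h
    refine ⟨?_, fun p hp => ?_⟩
    · rw [← height_succ_eq_sub_one]
      have := h q le_rfl
      have := le_height_succ i w q
      omega
    · obtain ⟨h1, -, -, h2, -⟩ := matched_iff.1 hp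
      have := h p (by omega)
      omega

/-- The minimum of the height is attained at `p` for the last time, and `p` is not the end of the
word. -/
def RaiseAt (i : ℕ) (w : List ℕ) (p : ℕ) : Prop :=
  (∀ k, k ≤ p → height i w p ≤ height i w k) ∧ ∀ k, p < k → height i w p < height i w k

/-- The minimum of the height is attained at `p + 1` for the first time. -/
def LowerAt (i : ℕ) (w : List ℕ) (p : ℕ) : Prop :=
  (∀ k, k ≤ p → height i w (p + 1) < height i w k) ∧
    ∀ k, p < k → height i w (p + 1) ≤ height i w k

lemma RaiseAt.getElem? {i : ℕ} {w : List ℕ} {p : ℕ} (h : RaiseAt i w p) : w[p]? = some (i + 1) :=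
  (unmatchedOpen_iff.2 h.2).1

lemma LowerAt.getElem? {i : ℕ} {w : List ℕ} {p : ℕ} (h : LowerAt i w p) : w[p]? = some i :=
  (unmatchedClose_iff.2 h.1).1

lemma RaiseAt.lt_length {i : ℕ} {w : List ℕ} {p : ℕ} (h : RaiseAt i w p) : p < w.length :=
  (List.getElem?_eq_some_iff.1 h.getElem?).1

lemma RaiseAt.unique {i : ℕ} {w : List ℕ} {p q : ℕ} (hp : RaiseAt i w p) (hq : RaiseAt i w q) :
    p = q := by
  rcases lt_trichotomy p q with h | h | h
  · have := hp.2 q h; have := hq.1 p h.le; omega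
  · exact h
  · have := hq.2 p h; have := hp.1 q h.le; omega

lemma LowerAt.unique {i : ℕ} {w : List ℕ} {p q : ℕ} (hp : LowerAt i w p) (hq : LowerAt i w q) :
    p = q := by
  rcases lt_trichotomy p q with h | h | h
  · have := hp.2 (q + 1) (by omega); have := hq.1 (p + 1) (by omega); omega
  · exact h
  · have := hq.2 (p + 1) (by omega); have := hp.1 (q + 1) (by omega); omega

lemma isLeast_unmatchedOpen_iff {i : ℕ} {w : List ℕ} {p : ℕ} :
    IsLeast {p | UnmatchedOpen i w p} p ↔ RaiseAt i w p := by
  constructor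
  · rintro ⟨hp, hmin⟩
    have hp' := unmatchedOpen_iff.1 hp
    refine ⟨?_, hp'⟩
    by_contra! hcon
    classical
    obtain ⟨k, hk, hlt, hmax⟩ : ∃ k, k ≤ p ∧ height i w k < height i w p ∧
        ∀ r, k < r → r ≤ p → height i w p ≤ height i w r := by
      obtain ⟨k, hk, hlt⟩ := hcon
      let P := fun k => height i w k < height i w p
      refine ⟨Nat.findGreatest P p, Nat.findGreatest_le p, Nat.findGreatest_spec (P := P) hk hlt,
        fun r hr hr' => ?_⟩
      exact not_lt.1 (Nat.findGreatest_is_greatest (P := P) hr hr')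
    have hkp : k ≠ p := by rintro rfl; omega
    have := hmin (show UnmatchedOpen i w k from unmatchedOpen_iff.2 fun r hr => by
      rcases le_or_gt r p with h | h
      · have := hmax r hr h; omega
      · have := hp' r h; omega)
    omega
  · intro h
    refine ⟨unmatchedOpen_iff.2 h.2, fun q hq => ?_⟩
    by_contra! hlt
    have := unmatchedOpen_iff.1 hq p hlt
    have := h.1 q hlt.le
    omega

lemma isGreatest_unmatchedClose_iff {i : ℕ} {w : List ℕ} {p : ℕ} :
    IsGreatest {p | UnmatchedClose i w p} p ↔ LowerAt i w p := by
  constructor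
  · rintro ⟨hp, hmax⟩
    have hp' := unmatchedClose_iff.1 hp
    refine ⟨hp', ?_⟩
    by_contra! hcon
    classical
    obtain ⟨hk, hlt⟩ := Nat.find_spec hcon
    have hmin : ∀ r, p < r → r < Nat.find hcon → height i w (p + 1) ≤ height i w r := by
      intro r hr hr'
      have := Nat.find_min hcon hr'
      push Not at this
      exact this hr
    generalize Nat.find hcon = k at *
    have hk1 : k ≠ p + 1 := by rintro rfl; omega
    obtain ⟨q, rfl⟩ := Nat.exists_eq_succ_of_ne_zero (by omega : k ≠ 0)
    simp only [Nat.succ_eq_add_one] at *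
    have := hmax (show UnmatchedClose i w q from unmatchedClose_iff.2 fun r hr => by
      rcases le_or_gt r p with h | h
      · have := hp' r h; omega
      · have := hmin r h (by omega); omega)
    omega
  · intro h
    refine ⟨unmatchedClose_iff.2 h.1, fun q hq => ?_⟩
    by_contra! hlt
    have := unmatchedClose_iff.1 hq (p + 1) hlt
    have := h.2 (q + 1) (by omega)
    omega

lemma wordRaise_iff {i : ℕ} {u v : List ℕ} :
    WordRaise i u v ↔ ∃ p, RaiseAt i u p ∧ v = u.set p i := by
  simp only [WordRaise, isLeast_unmatchedOpen_iff]

lemma wordLower_iff {i : ℕ} {u v : List ℕ} :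
    WordLower i u v ↔ ∃ p, LowerAt i u p ∧ v = u.set p (i + 1) := by
  simp only [WordLower, isGreatest_unmatchedClose_iff]

lemma height_set_of_le {i : ℕ} {w : List ℕ} {p x k : ℕ} (h : k ≤ p) :
    height i (w.set p x) k = height i w k := by
  simp only [height, List.take_set_of_le h]

lemma height_set_raise {i : ℕ} {w : List ℕ} {p k : ℕ} (hp : w[p]? = some (i + 1)) (h : p < k) :
    height i (w.set p i) k = height i w k - 2 := by
  have hl : p < w.length := (List.getElem?_eq_some_iff.1 hp).1
  induction k, h using Nat.le_induction with
  | base =>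
    rw [height_succ_eq_add_one.2 hp, height_succ_eq_sub_one.2 (by simp [hl]),
      height_set_of_le le_rfl]
    ring
  | succ k hk ih =>
    rw [height_succ, ih, height_succ, List.getElem?_set_ne (by omega)]; ring

lemma height_set_lower {i : ℕ} {w : List ℕ} {p k : ℕ} (hp : w[p]? = some i) (h : p < k) :
    height i (w.set p (i + 1)) k = height i w k + 2 := by
  have hl : p < w.length := (List.getElem?_eq_some_iff.1 hp).1
  induction k, h using Nat.le_induction with
  | base =>
    rw [height_succ_eq_sub_one.2 hp, height_succ_eq_add_one.2 (by simp [hl]),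
      height_set_of_le le_rfl]
    ring
  | succ k hk ih =>
    rw [height_succ, ih, height_succ, List.getElem?_set_ne (by omega)]; ring

lemma RaiseAt.lowerAt_set {i : ℕ} {w : List ℕ} {p : ℕ} (h : RaiseAt i w p) :
    LowerAt i (w.set p i) p := by
  have h0 := h.getElem?
  have h1 := height_succ_eq_add_one.2 h0
  refine ⟨fun k hk => ?_, fun k hk => ?_⟩
  · rw [height_set_raise h0 (by omega), height_set_of_le hk]
    have := h.1 k hk
    omega
  · rw [height_set_raise h0 (by omega), height_set_raise h0 hk]
    have := h.2 k hk
    omega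

lemma LowerAt.raiseAt_set {i : ℕ} {w : List ℕ} {p : ℕ} (h : LowerAt i w p) :
    RaiseAt i (w.set p (i + 1)) p := by
  have h0 := h.getElem?
  have h1 := height_succ_eq_sub_one.2 h0
  refine ⟨fun k hk => ?_, fun k hk => ?_⟩
  · rw [height_set_of_le le_rfl, height_set_of_le hk]
    have := h.1 k hk
    omega
  · rw [height_set_of_le le_rfl, height_set_lower h0 hk]
    have := h.2 k hk
    omega

/-- Raising and lowering are inverse to each other. -/
lemma wordRaise_iff_wordLower {i : ℕ} {u v : List ℕ} : WordRaise i u v ↔ WordLower i v u := by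
  rw [wordRaise_iff, wordLower_iff]
  constructor
  · rintro ⟨p, hp, rfl⟩
    refine ⟨p, hp.lowerAt_set, ?_⟩
    obtain ⟨h1, h2⟩ := List.getElem?_eq_some_iff.1 hp.getElem?
    rw [List.set_set, ← h2, List.set_getElem_self]
  · rintro ⟨p, hp, rfl⟩
    refine ⟨p, hp.raiseAt_set, ?_⟩
    obtain ⟨h1, h2⟩ := List.getElem?_eq_some_iff.1 hp.getElem?
    rw [List.set_set]
    conv_lhs => rw [← List.set_getElem_self (as := v) h1, h2]

lemma WordRaise.unique {i : ℕ} {u v v' : List ℕ} (h : WordRaise i u v) (h' : WordRaise i u v') :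
    v = v' := by
  obtain ⟨p, hp, rfl⟩ := wordRaise_iff.1 h
  obtain ⟨q, hq, rfl⟩ := wordRaise_iff.1 h'
  rw [hp.unique hq]

lemma WordLower.unique {i : ℕ} {u v v' : List ℕ} (h : WordLower i u v) (h' : WordLower i u v') :
    v = v' := by
  obtain ⟨p, hp, rfl⟩ := wordLower_iff.1 h
  obtain ⟨q, hq, rfl⟩ := wordLower_iff.1 h'
  rw [hp.unique hq]

/-- The number of unmatched ")": the depth of the height function. -/
def wordPhi (i : ℕ) (w : List ℕ) : ℕ :=
  (Finset.range (w.length + 1)).sup fun k => (-height i w k).toNat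

/-- The number of unmatched "(". -/
def wordEps (i : ℕ) (w : List ℕ) : ℕ := (wordPhi i w + height i w w.length).toNat

lemma neg_wordPhi_le (i : ℕ) (w : List ℕ) (k : ℕ) : -(wordPhi i w : ℤ) ≤ height i w k := by
  have key : ∀ k ≤ w.length, -(wordPhi i w : ℤ) ≤ height i w k := by
    intro k hk
    have : (-height i w k).toNat ≤ wordPhi i w :=
      Finset.le_sup (f := fun k => (-height i w k).toNat) (Finset.mem_range.2 (by omega))
    omega
  rcases le_total k w.length with h | h
  · exact key k h
  · rw [height_of_length_le h]; exact key _ le_rfl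

lemma exists_height_eq_neg_wordPhi (i : ℕ) (w : List ℕ) :
    ∃ k ≤ w.length, height i w k = -(wordPhi i w : ℤ) := by
  obtain ⟨k, hk, h⟩ := Finset.exists_mem_eq_sup (Finset.range (w.length + 1)) ⟨0, by simp⟩
    fun k => (-height i w k).toNat
  change wordPhi i w = _ at h
  rcases Nat.eq_zero_or_pos (wordPhi i w) with h0 | h0
  · exact ⟨0, by omega, by simp [h0]⟩
  · exact ⟨k, by simpa [Nat.lt_succ_iff] using hk, by omega⟩

lemma wordPhi_eq_of {i : ℕ} {w : List ℕ} {k : ℕ} (h : ∀ r, height i w k ≤ height i w r) :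
    (wordPhi i w : ℤ) = -height i w k := by
  obtain ⟨r, -, hr⟩ := exists_height_eq_neg_wordPhi i w
  have := h r
  have := neg_wordPhi_le i w k
  omega

lemma wordEps_eq (i : ℕ) (w : List ℕ) :
    (wordEps i w : ℤ) = wordPhi i w + ((w.count (i + 1) : ℤ) - w.count i) := by
  have := neg_wordPhi_le i w w.length
  rw [wordEps, ← height_length]; omega

lemma RaiseAt.height_eq {i : ℕ} {w : List ℕ} {p : ℕ} (h : RaiseAt i w p) :
    height i w p = -(wordPhi i w : ℤ) := by
  rw [wordPhi_eq_of (k := p), neg_neg]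
  intro r
  rcases le_or_gt r p with hr | hr
  · exact h.1 r hr
  · exact (h.2 r hr).le

lemma LowerAt.height_eq {i : ℕ} {w : List ℕ} {p : ℕ} (h : LowerAt i w p) :
    height i w (p + 1) = -(wordPhi i w : ℤ) := by
  rw [wordPhi_eq_of (k := p + 1), neg_neg]
  intro r
  rcases le_or_gt r p with hr | hr
  · exact (h.1 r hr).le
  · exact h.2 r hr

lemma exists_raiseAt {i : ℕ} {w : List ℕ} (h : wordEps i w ≠ 0) : ∃ p, RaiseAt i w p := by
  classical
  obtain ⟨k, hk, hmin⟩ := exists_height_eq_neg_wordPhi i w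
  let P := fun k => height i w k = -(wordPhi i w : ℤ)
  have h1 : P (Nat.findGreatest P w.length) := Nat.findGreatest_spec (P := P) hk hmin
  have h2 : ∀ r, Nat.findGreatest P w.length < r → r ≤ w.length → ¬ P r := fun r hr hr' =>
    Nat.findGreatest_is_greatest (P := P) hr hr'
  have h3 : Nat.findGreatest P w.length ≤ w.length := Nat.findGreatest_le _
  generalize Nat.findGreatest P w.length = p at *
  have h4 : height i w w.length ≠ -(wordPhi i w : ℤ) := by
    have := wordEps_eq i w
    rw [← height_length] at this
    omega
  refine ⟨p, fun k _ => ?_, fun k hk => ?_⟩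
  · rw [h1]; exact neg_wordPhi_le i w k
  · rw [h1]
    refine lt_of_le_of_ne (neg_wordPhi_le i w k) (Ne.symm ?_)
    rcases le_total k w.length with hk' | hk'
    · exact h2 k hk hk'
    · rw [height_of_length_le hk']; exact h4

lemma exists_lowerAt {i : ℕ} {w : List ℕ} (h : wordPhi i w ≠ 0) : ∃ p, LowerAt i w p := by
  classical
  have hex : ∃ k, height i w k = -(wordPhi i w : ℤ) := by
    obtain ⟨k, hk, hmin⟩ := exists_height_eq_neg_wordPhi i w
    exact ⟨k, hmin⟩
  have h1 := Nat.find_spec hex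
  have h2 : ∀ r, r < Nat.find hex → height i w r ≠ -(wordPhi i w : ℤ) :=
    fun r hr => Nat.find_min hex hr
  generalize Nat.find hex = q at *
  obtain ⟨p, rfl⟩ := Nat.exists_eq_succ_of_ne_zero (n := q) (by
    rintro rfl
    rw [height_zero] at h1
    omega)
  simp only [Nat.succ_eq_add_one] at *
  refine ⟨p, fun k hk => ?_, fun k _ => ?_⟩
  · rw [h1]
    exact lt_of_le_of_ne (neg_wordPhi_le i w k) (Ne.symm (h2 k (by omega)))
  · rw [h1]; exact neg_wordPhi_le i w k

lemma RaiseAt.wordEps_ne_zero {i : ℕ} {w : List ℕ} {p : ℕ} (h : RaiseAt i w p) :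
    wordEps i w ≠ 0 := by
  have := wordEps_eq i w
  rw [← height_length] at this
  have h1 := h.2 _ h.lt_length
  have := h.height_eq
  omega

lemma wordEps_eq_zero_iff {i : ℕ} {w : List ℕ} :
    wordEps i w = 0 ↔ ∀ p, ¬ UnmatchedOpen i w p := by
  constructor
  · intro h p hp
    classical
    have hex : ∃ p, UnmatchedOpen i w p := ⟨p, hp⟩
    exact (isLeast_unmatchedOpen_iff.1 ⟨Nat.find_spec hex, fun q hq => Nat.find_min' hex hq⟩
      |>.wordEps_ne_zero) h
  · intro h
    by_contra h0
    obtain ⟨p, hp⟩ := exists_raiseAt h0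
    exact h p (isLeast_unmatchedOpen_iff.2 hp).1

lemma wordPhi_eq_zero_iff {i : ℕ} {w : List ℕ} :
    wordPhi i w = 0 ↔ ∀ p, ¬ UnmatchedClose i w p := by
  constructor
  · intro h p hp
    have h1 := unmatchedClose_iff.1 hp 0 (Nat.zero_le _)
    have h2 := neg_wordPhi_le i w (p + 1)
    rw [height_zero] at h1
    omega
  · intro h
    by_contra h0
    obtain ⟨p, hp⟩ := exists_lowerAt h0
    exact h p (isGreatest_unmatchedClose_iff.2 hp).1

lemma count_set_raise {i : ℕ} {w : List ℕ} {p : ℕ} (h : w[p]? = some (i + 1)) (k : ℕ) :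
    ((w.set p i).count k : ℤ) =
      w.count k + (Pi.single i 1 - Pi.single (i + 1) 1 : ℕ → ℤ) k := by
  obtain ⟨h1, h2⟩ := List.getElem?_eq_some_iff.1 h
  rw [List.count_set h1, h2]
  have : 0 < w.count (i + 1) := List.count_pos_iff.2 (h2 ▸ List.getElem_mem h1)
  by_cases e1 : k = i
  · subst e1; simp
  · by_cases e2 : k = i + 1
    · subst e2; simp; omega
    · simp [e1, e2, Ne.symm e1, Ne.symm e2]

lemma WordRaise.count {i : ℕ} {u v : List ℕ} (h : WordRaise i u v) (k : ℕ) :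
    (v.count k : ℤ) = u.count k + (Pi.single i 1 - Pi.single (i + 1) 1 : ℕ → ℤ) k := by
  obtain ⟨p, hp, rfl⟩ := wordRaise_iff.1 h
  exact count_set_raise hp.getElem? k

lemma WordRaise.wordPhi {i : ℕ} {u v : List ℕ} (h : WordRaise i u v) :
    wordPhi i v = wordPhi i u + 1 := by
  obtain ⟨p, hp, rfl⟩ := wordRaise_iff.1 h
  have h1 := hp.lowerAt_set.height_eq
  rw [height_set_raise hp.getElem? (by omega), height_succ_eq_add_one.2 hp.getElem?,
    hp.height_eq] at h1
  omega

lemma WordRaise.wordEps {i : ℕ} {u v : List ℕ} (h : WordRaise i u v) :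
    wordEps i u = wordEps i v + 1 := by
  have h1 := wordEps_eq i u
  have h2 := wordEps_eq i v
  rw [h.wordPhi, h.count, h.count] at h2
  simp at h2
  omega

lemma isYamanouchi_iff_height {w : List ℕ} :
    IsYamanouchi w ↔ ∀ i k, height i w w.length ≤ height i w k := by
  constructor
  · intro h i k
    have := h _ (List.drop_suffix k w) i
    have := height_length_sub i w k
    omega
  · intro h s hs i
    obtain ⟨t, rfl⟩ := hs
    have h1 := h i t.length
    have h2 := height_length_sub i (t ++ s) t.length
    rw [List.drop_left] at h2
    omega

lemma isYamanouchi_iff_wordEps {w : List ℕ} : IsYamanouchi w ↔ ∀ i, wordEps i w = 0 := by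
  rw [isYamanouchi_iff_height]
  refine forall_congr' fun i => ?_
  have h0 := wordEps_eq i w
  rw [← height_length] at h0
  constructor
  · intro h
    have := wordPhi_eq_of h
    omega
  · intro h k
    have := neg_wordPhi_le i w k
    omega

/-! ### The reading order of the cells of a bitableau -/

lemma _root_.List.filter_eq_take_countP {α : Type*} {R : α → α → Prop} {P : α → Bool} {L : List α}
    (hL : L.Pairwise R) (hP : ∀ a ∈ L, ∀ b ∈ L, R a b → P b → P a) :
    L.filter P = L.take (L.countP P) := by
  induction L with
  | nil => simp
  | cons x L ih =>
    rw [List.pairwise_cons] at hL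
    have ih' := ih hL.2 fun a ha b hb => hP a (List.mem_cons_of_mem _ ha) b (List.mem_cons_of_mem _ hb)
    by_cases hx : P x
    · simp [hx, ih']
    · have h0 : ∀ b ∈ L, ¬ P b := fun b hb hb' =>
        hx (hP x List.mem_cons_self b (List.mem_cons_of_mem _ hb) (hL.1 b hb) hb')
      have h1 : L.countP P = 0 := List.countP_eq_zero.2 h0
      have h2 : L.filter P = [] := List.filter_eq_nil_iff.2 h0
      simp [hx, h1, h2]

lemma mem_readingCells {l : YoungDiagram} {c : ℕ × ℕ} : c ∈ readingCells l ↔ c ∈ l := by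
  obtain ⟨i, j⟩ := c
  simp only [readingCells, List.mem_flatMap, List.mem_reverse, List.mem_range, List.mem_map,
    Prod.mk.injEq, YoungDiagram.mem_iff_lt_rowLen]
  constructor
  · rintro ⟨a, ha, b, hb, rfl, rfl⟩; exact hb
  · intro h
    have h0 : (i, 0) ∈ l := YoungDiagram.mem_iff_lt_rowLen.2 (by omega)
    exact ⟨i, YoungDiagram.mem_iff_lt_colLen.1 h0, j, h, rfl, rfl⟩

lemma readingCells_pairwise (l : YoungDiagram) :
    (readingCells l).Pairwise fun c c' => c'.1 < c.1 ∨ (c.1 = c'.1 ∧ c.2 < c'.2) := by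
  rw [readingCells, List.pairwise_flatMap]
  constructor
  · intro i _
    rw [List.pairwise_map]
    exact List.pairwise_lt_range.imp fun h => Or.inr ⟨rfl, h⟩
  · rw [List.pairwise_reverse]
    refine List.pairwise_lt_range.imp fun {i i'} h c hc c' hc' => ?_
    simp only [List.mem_map] at hc hc'
    obtain ⟨j, -, rfl⟩ := hc
    obtain ⟨j', -, rfl⟩ := hc'
    exact Or.inl h

namespace Bitableau

variable {l : YoungDiagram}

/-- The cell `c` is read before the cell `c'` in the sort-by-top order. -/
def ReadBefore (T : Bitableau l) (c c' : ℕ × ℕ) : Prop :=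
  T.top c < T.top c' ∨ (T.top c = T.top c' ∧ (c'.1 < c.1 ∨ (c.1 = c'.1 ∧ c.2 < c'.2)))

lemma ReadBefore.trans {T : Bitableau l} {c c' c'' : ℕ × ℕ} (h : T.ReadBefore c c')
    (h' : T.ReadBefore c' c'') : T.ReadBefore c c'' := by
  unfold ReadBefore at *; omega

lemma not_readBefore_self (T : Bitableau l) (c : ℕ × ℕ) : ¬ T.ReadBefore c c := by
  unfold ReadBefore; omega

lemma mem_sortedCells {T : Bitableau l} {c : ℕ × ℕ} : c ∈ T.sortedCells ↔ c ∈ l := by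
  simp only [sortedCells, List.mem_flatMap, List.mem_range, List.mem_filter, mem_readingCells,
    decide_eq_true_eq]
  constructor
  · rintro ⟨a, -, h, -⟩; exact h
  · intro h
    exact ⟨T.top c, Nat.lt_succ_of_le (Finset.le_sup (f := T.top) h), h, rfl⟩

lemma sortedCells_pairwise (T : Bitableau l) : T.sortedCells.Pairwise T.ReadBefore := by
  rw [sortedCells, List.pairwise_flatMap]
  constructor
  · intro a _
    refine ((readingCells_pairwise l).filter _).imp_of_mem fun hc hc' h => ?_
    simp only [List.mem_filter, decide_eq_true_eq] at hc hc'
    exact Or.inr ⟨by omega, h⟩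
  · refine List.pairwise_lt_range.imp fun h c hc c' hc' => ?_
    simp only [List.mem_filter, decide_eq_true_eq] at hc hc'
    exact Or.inl (by omega)

lemma nodup_sortedCells (T : Bitableau l) : T.sortedCells.Nodup := by
  refine T.sortedCells_pairwise.imp ?_
  rintro c _ h rfl
  exact T.not_readBefore_self c h

lemma toFinset_sortedCells (T : Bitableau l) : T.sortedCells.toFinset = l.cells := by
  ext c; simp [mem_sortedCells]

lemma countP_sortedCells (T : Bitableau l) (P : ℕ × ℕ → Prop) [DecidablePred P] :
    T.sortedCells.countP (fun c => P c) = (l.cells.filter P).card := by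
  rw [List.countP_eq_length_filter, ← List.toFinset_card_of_nodup (T.nodup_sortedCells.filter _),
    List.toFinset_filter, toFinset_sortedCells]
  simp

/-- The letter `k` occurs in the reading word as often as in the bottom row of the entries. -/
lemma count_word (T : Bitableau l) (k : ℕ) : T.word.count k = T.bWeight k := by
  rw [word, List.count, List.countP_map, bWeight, ← countP_sortedCells]
  rfl

/-- A set of cells which contains with a cell all those read before it. -/
def Initial (T : Bitableau l) (P : ℕ × ℕ → Prop) : Prop :=
  ∀ c ∈ l, ∀ c' ∈ l, T.ReadBefore c c' → P c' → P c

lemma initial_readBefore (T : Bitableau l) (c : ℕ × ℕ) : T.Initial (T.ReadBefore · c) :=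
  fun _ _ _ _ h h' => h.trans h'

open Classical in
/-- The height of the part of the reading word that consists of the cells in `P`. -/
def cellHeight (T : Bitableau l) (i : ℕ) (P : ℕ × ℕ → Prop) : ℤ :=
  ((l.cells.filter fun c => P c ∧ T.bot c = i + 1).card : ℤ) -
    (l.cells.filter fun c => P c ∧ T.bot c = i).card

open Classical in
/-- The number of cells in `P`; for an initial set, these are the first cells in reading order. -/
def cut (T : Bitableau l) (P : ℕ × ℕ → Prop) : ℕ := T.sortedCells.countP (fun c => P c)

open Classical in
lemma Initial.filter_eq {T : Bitableau l} {P : ℕ × ℕ → Prop} (hP : T.Initial P) :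
    T.sortedCells.filter (fun c => P c) = T.sortedCells.take (T.cut P) := by
  refine List.filter_eq_take_countP T.sortedCells_pairwise fun a ha b hb h h' => ?_
  rw [mem_sortedCells] at ha hb
  simpa using hP a ha b hb h (by simpa using h')

lemma Initial.height_cut {T : Bitableau l} {P : ℕ × ℕ → Prop} (hP : T.Initial P) (i : ℕ) :
    height i T.word (T.cut P) = T.cellHeight i P := by
  classical
  have key : ∀ x, (T.word.take (T.cut P)).count x =
      (l.cells.filter fun c => P c ∧ T.bot c = x).card := by
    intro x
    rw [word, ← List.map_take, ← hP.filter_eq, List.count, List.countP_map, List.countP_filter,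
      ← T.countP_sortedCells]
    congr 1
    ext c
    simp [Bool.beq_eq_decide_eq, Bool.and_comm]
  rw [height, key, key, cellHeight]

lemma Initial.lt_cut_iff {T : Bitableau l} {P : ℕ × ℕ → Prop} (hP : T.Initial P) {p : ℕ}
    {c : ℕ × ℕ} (hc : T.sortedCells[p]? = some c) : p < T.cut P ↔ P c := by
  classical
  obtain ⟨h1, rfl⟩ := List.getElem?_eq_some_iff.1 hc
  constructor
  · intro h
    have : T.sortedCells[p] ∈ T.sortedCells.take (T.cut P) :=
      List.mem_take_iff_getElem.2 ⟨p, by omega, rfl⟩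
    rw [← hP.filter_eq] at this
    simpa using (List.mem_filter.1 this).2
  · intro h
    have : T.sortedCells[p] ∈ T.sortedCells.take (T.cut P) := by
      rw [← hP.filter_eq]
      exact List.mem_filter.2 ⟨List.getElem_mem h1, by simpa using h⟩
    obtain ⟨q, hq, e⟩ := List.mem_take_iff_getElem.1 this
    have := (T.nodup_sortedCells.getElem_inj_iff).1 e
    omega

lemma cut_readBefore {T : Bitableau l} {p : ℕ} {c : ℕ × ℕ} (hc : T.sortedCells[p]? = some c) :
    T.cut (T.ReadBefore · c) = p := by
  have h1 := (T.initial_readBefore c).lt_cut_iff hc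
  simp only [not_readBefore_self, iff_false, not_lt] at h1
  refine le_antisymm h1 ?_
  by_contra! h
  obtain ⟨h2, rfl⟩ := List.getElem?_eq_some_iff.1 hc
  have h3 := (List.pairwise_iff_getElem.1 T.sortedCells_pairwise) _ _ (by omega) h2 h
  have h4 := ((T.initial_readBefore _).lt_cut_iff (List.getElem?_eq_getElem (by omega))).2 h3
  omega

lemma cut_readBefore_or_eq {T : Bitableau l} {p : ℕ} {c : ℕ × ℕ}
    (hc : T.sortedCells[p]? = some c) : T.cut (fun c' => ¬ T.ReadBefore c c') = p + 1 := by
  have hP : T.Initial (fun c' => ¬ T.ReadBefore c c') := fun a _ b _ h h' h'' => h' (h''.trans h)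
  have h1 := (hP.lt_cut_iff hc).2 (T.not_readBefore_self c)
  refine le_antisymm ?_ h1
  by_contra! h
  obtain ⟨h2, rfl⟩ := List.getElem?_eq_some_iff.1 hc
  have h5 : T.cut (fun c' => ¬ T.ReadBefore T.sortedCells[p] c') ≤ T.sortedCells.length :=
    List.countP_le_length
  have h3 := (List.pairwise_iff_getElem.1 T.sortedCells_pairwise) _ _ h2
    (by omega : p + 1 < T.sortedCells.length) (by omega)
  exact (hP.lt_cut_iff (List.getElem?_eq_getElem (by omega))).1 h h3

lemma cellHeight_eq_add (T : Bitableau l) (i : ℕ) {P Q : ℕ × ℕ → Prop} (h : ∀ c ∈ l, P c → Q c) :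
    T.cellHeight i Q = T.cellHeight i P + T.cellHeight i (fun c => Q c ∧ ¬ P c) := by
  classical
  have key : ∀ x, (l.cells.filter fun c => Q c ∧ T.bot c = x).card =
      (l.cells.filter fun c => P c ∧ T.bot c = x).card +
        (l.cells.filter fun c => (Q c ∧ ¬ P c) ∧ T.bot c = x).card := by
    intro x
    rw [← Finset.card_filter_add_card_filter_not (s := l.cells.filter fun c => Q c ∧ T.bot c = x) P,
      Finset.filter_filter, Finset.filter_filter]
    congr 2 <;> refine Finset.filter_congr fun c hc => ?_
    · have := h c hc; tauto
    · tauto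
  simp only [cellHeight, key]
  push_cast; ring

lemma cellHeight_true (T : Bitableau l) (i : ℕ) :
    T.cellHeight i (fun _ => True) = height i T.word T.word.length := by
  rw [height_length, count_word, count_word]
  simp [cellHeight, bWeight]

/-- The Yamanouchi condition, in terms of the sets of cells whose complements are initial. -/
lemma isYamanouchi_word_iff (T : Bitableau l) :
    IsYamanouchi T.word ↔ ∀ P, T.Initial P → ∀ i, T.cellHeight i (fun c => ¬ P c) ≤ 0 := by
  have key : ∀ P, T.Initial P → ∀ i, (height i T.word T.word.length ≤ height i T.word (T.cut P) ↔
      T.cellHeight i (fun c => ¬ P c) ≤ 0) := by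
    intro P hP i
    rw [hP.height_cut, ← cellHeight_true,
      T.cellHeight_eq_add i (P := P) (Q := fun _ => True) (fun _ _ _ => trivial)]
    simp
  rw [isYamanouchi_iff_height]
  constructor
  · exact fun h P hP i => (key P hP i).1 (h i _)
  · intro h i k
    rcases le_or_gt T.word.length k with hk | hk
    · rw [height_of_length_le hk]
    · rw [word, List.length_map] at hk
      have hc := List.getElem?_eq_getElem hk
      rw [← cut_readBefore hc]
      exact (key _ (T.initial_readBefore _) i).2 (h _ (T.initial_readBefore _) i)

/-! ### The crystal operators on bitableaux -/

lemma entry_eq (T : Bitableau l) (i j : ℕ) : T.entry i j = toLex (T.top (i, j), T.bot (i, j)) := rfl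

lemma row_le (T : Bitableau l) {i j₁ j₂ : ℕ} (h : j₁ ≤ j₂) (hm : (i, j₂) ∈ l) :
    T.top (i, j₁) < T.top (i, j₂) ∨
      (T.top (i, j₁) = T.top (i, j₂) ∧ T.bot (i, j₁) ≤ T.bot (i, j₂)) := by
  rcases h.eq_or_lt with rfl | h
  · simp
  · have := T.row_weak h hm
    rwa [entry_eq, entry_eq, Prod.Lex.toLex_le_toLex] at this

lemma col_lt (T : Bitableau l) {i₁ i₂ j : ℕ} (h : i₁ < i₂) (hm : (i₂, j) ∈ l) :
    T.top (i₁, j) < T.top (i₂, j) ∨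
      (T.top (i₁, j) = T.top (i₂, j) ∧ T.bot (i₁, j) < T.bot (i₂, j)) := by
  have := T.col_strict h hm
  rwa [entry_eq, entry_eq, Prod.Lex.toLex_lt_toLex] at this

lemma ext_top_bot {T S : Bitableau l} (h : ∀ c ∈ l, T.top c = S.top c ∧ T.bot c = S.bot c) :
    T = S := by
  refine Bitableau.ext (funext fun i => funext fun j => ?_)
  by_cases hm : (i, j) ∈ l
  · rw [entry_eq, entry_eq, (h _ hm).1, (h _ hm).2]
  · rw [T.zeros hm, S.zeros hm]

/-- A bitableau given by its top and bottom entries. -/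
def ofTopBot (l : YoungDiagram) (t b : ℕ × ℕ → ℕ)
    (hr : ∀ i j₁ j₂, j₁ < j₂ → (i, j₂) ∈ l →
      t (i, j₁) < t (i, j₂) ∨ (t (i, j₁) = t (i, j₂) ∧ b (i, j₁) ≤ b (i, j₂)))
    (hc : ∀ i₁ i₂ j, i₁ < i₂ → (i₂, j) ∈ l →
      t (i₁, j) < t (i₂, j) ∨ (t (i₁, j) = t (i₂, j) ∧ b (i₁, j) < b (i₂, j))) :
    Bitableau l where
  entry i j := if (i, j) ∈ l then toLex (t (i, j), b (i, j)) else toLex (0, 0)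
  row_weak {i j₁ j₂} h hm := by
    rw [if_pos hm, if_pos (l.up_left_mem le_rfl h.le hm), Prod.Lex.toLex_le_toLex]
    exact hr i j₁ j₂ h hm
  col_strict {i₁ i₂ j} h hm := by
    rw [if_pos hm, if_pos (l.up_left_mem h.le le_rfl hm), Prod.Lex.toLex_lt_toLex]
    exact hc i₁ i₂ j h hm
  zeros h := if_neg h

lemma top_ofTopBot {t b : ℕ × ℕ → ℕ} (hr hc) {c : ℕ × ℕ} (h : c ∈ l) :
    (ofTopBot l t b hr hc).top c = t c := by
  simp [ofTopBot, top, h]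

lemma bot_ofTopBot {t b : ℕ × ℕ → ℕ} (hr hc) {c : ℕ × ℕ} (h : c ∈ l) :
    (ofTopBot l t b hr hc).bot c = b c := by
  simp [ofTopBot, bot, h]

lemma top_eq_zero (T : Bitableau l) {c : ℕ × ℕ} (h : c ∉ l) : T.top c = 0 := by
  rw [top, T.zeros (i := c.1) (j := c.2) h]; rfl

lemma top_ext {T S : Bitableau l} (h : ∀ c ∈ l, T.top c = S.top c) : T.top = S.top := by
  funext c
  by_cases hc : c ∈ l
  · exact h c hc
  · rw [top_eq_zero _ hc, top_eq_zero _ hc]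

lemma sortedCells_congr {T S : Bitableau l} (h : S.top = T.top) :
    S.sortedCells = T.sortedCells := by
  rw [sortedCells, sortedCells, h]

/-- A bitableau is determined by its top entries and its reading word. -/
lemma eq_of_top_of_word {T S : Bitableau l} (h : S.top = T.top) (hw : S.word = T.word) :
    S = T := by
  refine ext_top_bot fun c hc => ⟨by rw [h], ?_⟩
  rw [word, word, sortedCells_congr h] at hw
  exact List.map_inj_left.1 hw c (mem_sortedCells.2 hc)

lemma word_eq_set {T S : Bitableau l} {p x : ℕ} {c : ℕ × ℕ} (h : S.top = T.top)
    (hc : T.sortedCells[p]? = some c) (hx : S.bot c = x)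
    (hb : ∀ c' ∈ l, c' ≠ c → S.bot c' = T.bot c') : S.word = T.word.set p x := by
  obtain ⟨h1, rfl⟩ := List.getElem?_eq_some_iff.1 hc
  rw [word, word, sortedCells_congr h]
  refine List.ext_getElem (by simp) fun q hq hq' => ?_
  simp only [List.length_map] at hq
  rw [List.getElem_map, List.getElem_set, List.getElem_map]
  split_ifs with e
  · subst e; exact hx
  · exact hb _ (mem_sortedCells.1 (List.getElem_mem _)) fun h' =>
      e ((T.nodup_sortedCells.getElem_inj_iff).1 h').symm

/-- The bottom entry of the cell `c` can be lowered if this does not interfere with the entries to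
the left of it and above it. -/
lemma exists_of_lower_entry (T : Bitableau l) {p i : ℕ} {r j : ℕ}
    (hc : T.sortedCells[p]? = some (r, j)) (hb : T.bot (r, j) = i + 1)
    (hrow : ∀ j₁ < j, T.top (r, j₁) = T.top (r, j) → T.bot (r, j₁) ≠ i + 1)
    (hcol : ∀ r₁ < r, T.top (r₁, j) = T.top (r, j) → T.bot (r₁, j) ≠ i) :
    ∃ S : Bitableau l, S.top = T.top ∧ S.word = T.word.set p i := by
  have hm : (r, j) ∈ l := mem_sortedCells.1 (List.mem_of_getElem? hc)
  let b : ℕ × ℕ → ℕ := fun c => if c = (r, j) then i else T.bot c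
  have hb1 : b (r, j) = i := if_pos rfl
  have hb2 : ∀ c, c ≠ (r, j) → b c = T.bot c := fun c h => if_neg h
  have h1 : ∀ r' j₁ j₂, j₁ < j₂ → (r', j₂) ∈ l → T.top (r', j₁) < T.top (r', j₂) ∨
      (T.top (r', j₁) = T.top (r', j₂) ∧ b (r', j₁) ≤ b (r', j₂)) := by
    intro r' j₁ j₂ h hm'
    have h0 := T.row_le h.le hm'
    by_cases e2 : (r', j₂) = (r, j)
    · rw [e2, hb1, hb2 _ (by intro e; simp_all)]
      simp only [Prod.mk.injEq] at e2
      obtain ⟨rfl, rfl⟩ := e2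
      have := hrow j₁ h
      omega
    · rw [hb2 _ e2]
      by_cases e1 : (r', j₁) = (r, j)
      · rw [e1] at h0 ⊢
        omega
      · rw [hb2 _ e1]; exact h0
  have h2 : ∀ i₁ i₂ j', i₁ < i₂ → (i₂, j') ∈ l → T.top (i₁, j') < T.top (i₂, j') ∨
      (T.top (i₁, j') = T.top (i₂, j') ∧ b (i₁, j') < b (i₂, j')) := by
    intro i₁ i₂ j' h hm'
    have h0 := T.col_lt h hm'
    by_cases e2 : (i₂, j') = (r, j)
    · rw [e2, hb1, hb2 _ (by intro e; simp_all)]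
      simp only [Prod.mk.injEq] at e2
      obtain ⟨rfl, rfl⟩ := e2
      have := hcol i₁ h
      omega
    · rw [hb2 _ e2]
      by_cases e1 : (i₁, j') = (r, j)
      · rw [e1] at h0 ⊢
        omega
      · rw [hb2 _ e1]; exact h0
  refine ⟨ofTopBot l T.top b h1 h2, ?_, ?_⟩
  · exact top_ext fun c hc => top_ofTopBot h1 h2 hc
  · refine word_eq_set (top_ext fun c hc => top_ofTopBot h1 h2 hc) hc ?_ ?_
    · rw [bot_ofTopBot h1 h2 hm, hb1]
    · intro c' h h'
      rw [bot_ofTopBot h1 h2 h, hb2 _ h']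

/-- The bottom entry of the cell `c` can be increased if this does not interfere with the entries
to the right of it and below it. -/
lemma exists_of_increase_entry (T : Bitableau l) {p i : ℕ} {r j : ℕ}
    (hc : T.sortedCells[p]? = some (r, j)) (hb : T.bot (r, j) = i)
    (hrow : ∀ j₁ > j, (r, j₁) ∈ l → T.top (r, j₁) = T.top (r, j) → T.bot (r, j₁) ≠ i)
    (hcol : ∀ r₁ > r, (r₁, j) ∈ l → T.top (r₁, j) = T.top (r, j) → T.bot (r₁, j) ≠ i + 1) :
    ∃ S : Bitableau l, S.top = T.top ∧ S.word = T.word.set p (i + 1) := by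
  have hm : (r, j) ∈ l := mem_sortedCells.1 (List.mem_of_getElem? hc)
  let b : ℕ × ℕ → ℕ := fun c => if c = (r, j) then i + 1 else T.bot c
  have hb1 : b (r, j) = i + 1 := if_pos rfl
  have hb2 : ∀ c, c ≠ (r, j) → b c = T.bot c := fun c h => if_neg h
  have h1 : ∀ r' j₁ j₂, j₁ < j₂ → (r', j₂) ∈ l → T.top (r', j₁) < T.top (r', j₂) ∨
      (T.top (r', j₁) = T.top (r', j₂) ∧ b (r', j₁) ≤ b (r', j₂)) := by
    intro r' j₁ j₂ h hm'
    have h0 := T.row_le h.le hm'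
    by_cases e1 : (r', j₁) = (r, j)
    · rw [e1, hb1, hb2 _ (by intro e; simp_all)]
      simp only [Prod.mk.injEq] at e1
      obtain ⟨rfl, rfl⟩ := e1
      have := hrow j₂ h hm'
      omega
    · rw [hb2 _ e1]
      by_cases e2 : (r', j₂) = (r, j)
      · rw [e2] at h0 ⊢
        omega
      · rw [hb2 _ e2]; exact h0
  have h2 : ∀ i₁ i₂ j', i₁ < i₂ → (i₂, j') ∈ l → T.top (i₁, j') < T.top (i₂, j') ∨
      (T.top (i₁, j') = T.top (i₂, j') ∧ b (i₁, j') < b (i₂, j')) := by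
    intro i₁ i₂ j' h hm'
    have h0 := T.col_lt h hm'
    by_cases e1 : (i₁, j') = (r, j)
    · rw [e1, hb1, hb2 _ (by intro e; simp_all)]
      simp only [Prod.mk.injEq] at e1
      obtain ⟨rfl, rfl⟩ := e1
      have := hcol i₂ h hm'
      omega
    · rw [hb2 _ e1]
      by_cases e2 : (i₂, j') = (r, j)
      · rw [e2] at h0 ⊢
        omega
      · rw [hb2 _ e2]; exact h0
  refine ⟨ofTopBot l T.top b h1 h2, ?_, ?_⟩
  · exact top_ext fun c hc => top_ofTopBot h1 h2 hc
  · refine word_eq_set (top_ext fun c hc => top_ofTopBot h1 h2 hc) hc ?_ ?_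
    · rw [bot_ofTopBot h1 h2 hm, hb1]
    · intro c' h h'
      rw [bot_ofTopBot h1 h2 h, hb2 _ h']

lemma exists_cell_of_word {T : Bitableau l} {p x : ℕ} (h : T.word[p]? = some x) :
    ∃ r j, T.sortedCells[p]? = some (r, j) ∧ (r, j) ∈ l ∧ T.bot (r, j) = x := by
  rw [word, List.getElem?_map, Option.map_eq_some_iff] at h
  obtain ⟨⟨r, j⟩, hc, rfl⟩ := h
  exact ⟨r, j, hc, mem_sortedCells.1 (List.mem_of_getElem? hc), rfl⟩

/-- The crystal operator `e i` exists on bitableaux. -/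
lemma exists_raise {T : Bitableau l} {i p : ℕ} (h : RaiseAt i T.word p) :
    ∃ S : Bitableau l, S.top = T.top ∧ S.word = T.word.set p i := by
  classical
  obtain ⟨r, j, hc, hm, hb⟩ := exists_cell_of_word h.getElem?
  have hcut := cut_readBefore hc
  have hini := T.initial_readBefore (r, j)
  refine T.exists_of_lower_entry hc hb (fun j₁ hj ht hb' => ?_) (fun r₁ hr ht hb' => ?_)
  · -- all cells from `(r, j₁)` to the left neighbour of `(r, j)` carry a "("
    have hini' := T.initial_readBefore (r, j₁)
    have hm1 : (r, j₁) ∈ l := l.up_left_mem le_rfl hj.le hm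
    have h1 : T.cut (T.ReadBefore · (r, j₁)) ≤ p := by
      by_contra! h'
      have := (hini'.lt_cut_iff hc).1 h'
      simp only [ReadBefore, true_and] at this
      omega
    have h2 := h.1 _ h1
    have h3 : T.cellHeight i (T.ReadBefore · (r, j)) ≤ T.cellHeight i (T.ReadBefore · (r, j₁)) := by
      rwa [← hini.height_cut, ← hini'.height_cut, hcut]
    rw [T.cellHeight_eq_add i (P := (T.ReadBefore · (r, j₁))) (Q := (T.ReadBefore · (r, j)))] at h3
    swap
    · intro c _ hc'
      refine hc'.trans ?_
      simp only [ReadBefore, true_and]; omega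
    have h4 : ∀ c ∈ l, T.ReadBefore c (r, j) ∧ ¬ T.ReadBefore c (r, j₁) → T.bot c = i + 1 := by
      rintro ⟨r', j'⟩ hm' ⟨h5, h6⟩
      simp only [ReadBefore] at h5 h6
      obtain rfl : r' = r := by omega
      have h7 := T.row_le (by omega : j₁ ≤ j') hm'
      have h8 := T.row_le (by omega : j' ≤ j) hm
      omega
    have h5 : (l.cells.filter fun c => (T.ReadBefore c (r, j) ∧ ¬ T.ReadBefore c (r, j₁)) ∧
        T.bot c = i).card = 0 := by
      rw [Finset.card_eq_zero, Finset.filter_eq_empty_iff]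
      rintro c hc' ⟨h6, h7⟩
      have := h4 c hc' h6
      omega
    have h6 : 0 < (l.cells.filter fun c => (T.ReadBefore c (r, j) ∧ ¬ T.ReadBefore c (r, j₁)) ∧
        T.bot c = i + 1).card := by
      rw [Finset.card_pos]
      refine ⟨(r, j₁), Finset.mem_filter.2 ⟨hm1, ⟨?_, T.not_readBefore_self _⟩, hb'⟩⟩
      simp only [ReadBefore, true_and]; omega
    simp only [cellHeight] at h3
    omega
  · -- each "(" from `(r, j)` to the end of its row has a ")" above it
    have hup := T.col_lt (show r - 1 < r by omega) hm
    have hup' : T.top (r - 1, j) = T.top (r, j) ∧ T.bot (r - 1, j) = i := by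
      rcases (show r₁ ≤ r - 1 by omega).eq_or_lt with e | e
      · exact e ▸ ⟨ht, hb'⟩
      · have := T.col_lt e (l.up_left_mem (by omega : r - 1 ≤ r) le_rfl hm)
        omega
    let P : ℕ × ℕ → Prop := fun c => T.top c < T.top (r, j) ∨ (T.top c = T.top (r, j) ∧
      (r - 1 < c.1 ∨ (c.1 = r - 1 ∧ T.bot c ≤ i)))
    have hP : T.Initial P := by
      rintro ⟨r', j'⟩ hm' ⟨r'', j''⟩ hm'' h1 h2
      simp only [P, ReadBefore] at h1 h2 ⊢
      by_cases e : r' = r''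
      · subst e
        rcases le_total j' j'' with e' | e'
        · have := T.row_le e' hm''
          omega
        · omega
      · omega
    have h1 : p < T.cut P := (hP.lt_cut_iff hc).2 (by simp only [P, true_and]; omega)
    have h2 := h.2 _ h1
    have h3 : T.cellHeight i (T.ReadBefore · (r, j)) < T.cellHeight i P := by
      rwa [← hini.height_cut, ← hP.height_cut, hcut]
    rw [T.cellHeight_eq_add i (P := (T.ReadBefore · (r, j))) (Q := P)] at h3
    swap
    · intro c hc' h'
      refine hP c hc' (r, j) hm h' ?_
      simp only [P, true_and]; omega
    have h4 : (l.cells.filter fun c => (P c ∧ ¬ T.ReadBefore c (r, j)) ∧ T.bot c = i + 1).card ≤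
        (l.cells.filter fun c => (P c ∧ ¬ T.ReadBefore c (r, j)) ∧ T.bot c = i).card := by
      refine Finset.card_le_card_of_injOn (fun c => (c.1 - 1, c.2)) ?_ ?_
      · rintro ⟨r', j'⟩ hc'
        obtain ⟨hm', ⟨h5, h6⟩, h7⟩ := Finset.mem_filter.1 hc'
        simp only [P, ReadBefore] at h5 h6
        obtain rfl : r' = r := by omega
        have h8 := T.col_lt (show r' - 1 < r' by omega) hm'
        have hmu := l.up_left_mem (by omega : r' - 1 ≤ r') le_rfl hm'
        have h9 := T.row_le (show j ≤ j' by omega) hmu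
        refine Finset.mem_filter.2 ⟨hmu, ?_⟩
        simp only [P, ReadBefore, true_and]
        omega
      · rintro ⟨r', j'⟩ hc' ⟨r'', j''⟩ hc'' e
        have h5 := (Finset.mem_filter.1 hc').2
        have h6 := (Finset.mem_filter.1 hc'').2
        simp only [P, ReadBefore, Prod.mk.injEq] at h5 h6 e ⊢
        omega
    simp only [cellHeight] at h3
    omega

/-- The crystal operator `f i` exists on bitableaux. -/
lemma exists_lower {T : Bitableau l} {i p : ℕ} (h : LowerAt i T.word p) :
    ∃ S : Bitableau l, S.top = T.top ∧ S.word = T.word.set p (i + 1) := by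
  classical
  obtain ⟨r, j, hc, hm, hb⟩ := exists_cell_of_word h.getElem?
  have hcut := cut_readBefore_or_eq hc
  have hnot : ∀ r j, T.Initial (fun c' => ¬ T.ReadBefore (r, j) c') :=
    fun r j a _ b _ h h' h'' => h' (h''.trans h)
  have hini := hnot r j
  refine T.exists_of_increase_entry hc hb (fun j₁ hj hm1 ht hb' => ?_) (fun r₁ hr hm1 ht hb' => ?_)
  · -- all cells from the right neighbour of `(r, j)` to `(r, j₁)` carry a ")"
    have hini' := hnot r j₁
    have h1 : p < T.cut (fun c' => ¬ T.ReadBefore (r, j₁) c') := by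
      refine (hini'.lt_cut_iff hc).2 ?_
      simp only [ReadBefore, true_and]
      omega
    have h2 := h.2 _ h1
    rw [← hcut, hini.height_cut, hini'.height_cut] at h2
    rw [T.cellHeight_eq_add i (P := (fun c => ¬ T.ReadBefore (r, j) c))
      (Q := (fun c => ¬ T.ReadBefore (r, j₁) c))] at h2
    swap
    · intro c _ hc' hc''
      refine hc' (ReadBefore.trans ?_ hc'')
      simp only [ReadBefore, true_and]; omega
    have h4 : ∀ c ∈ l, ¬ T.ReadBefore (r, j₁) c ∧ ¬ ¬ T.ReadBefore (r, j) c → T.bot c = i := by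
      rintro ⟨r', j'⟩ hm' ⟨h5, h6⟩
      simp only [ReadBefore] at h5 h6
      obtain rfl : r' = r := by omega
      have h7 := T.row_le (by omega : j ≤ j') hm'
      have h8 := T.row_le (by omega : j' ≤ j₁) hm1
      omega
    have h5 : (l.cells.filter fun c => (¬ T.ReadBefore (r, j₁) c ∧ ¬ ¬ T.ReadBefore (r, j) c) ∧
        T.bot c = i + 1).card = 0 := by
      rw [Finset.card_eq_zero, Finset.filter_eq_empty_iff]
      rintro c hc' ⟨h6, h7⟩
      have := h4 c hc' h6
      omega
    have h6 : 0 < (l.cells.filter fun c => (¬ T.ReadBefore (r, j₁) c ∧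
        ¬ ¬ T.ReadBefore (r, j) c) ∧ T.bot c = i).card := by
      rw [Finset.card_pos]
      refine ⟨(r, j₁), Finset.mem_filter.2 ⟨hm1, ⟨T.not_readBefore_self _, ?_⟩, hb'⟩⟩
      simp only [ReadBefore, true_and]; omega
    simp only [cellHeight] at h2
    omega
  · -- each ")" from the start of the row of `(r, j)` to `(r, j)` has a "(" below it
    have hm2 : (r + 1, j) ∈ l := l.up_left_mem (by omega : r + 1 ≤ r₁) le_rfl hm1
    have hdown := T.col_lt (show r < r + 1 by omega) hm2
    have hdown' : T.top (r + 1, j) = T.top (r, j) ∧ T.bot (r + 1, j) = i + 1 := by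
      rcases (show r + 1 ≤ r₁ by omega).eq_or_lt with e | e
      · exact e ▸ ⟨ht, hb'⟩
      · have := T.col_lt e hm1
        omega
    let P : ℕ × ℕ → Prop := fun c => T.top c < T.top (r, j) ∨ (T.top c = T.top (r, j) ∧
      (r + 1 < c.1 ∨ (c.1 = r + 1 ∧ T.bot c ≤ i)))
    have hP : T.Initial P := by
      rintro ⟨r', j'⟩ hm' ⟨r'', j''⟩ hm'' h1 h2
      simp only [P, ReadBefore] at h1 h2 ⊢
      by_cases e : r' = r''
      · subst e
        rcases le_total j' j'' with e' | e'
        · have := T.row_le e' hm''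
          omega
        · omega
      · omega
    have h1 : T.cut P ≤ p := by
      by_contra! h'
      have := (hP.lt_cut_iff hc).1 h'
      simp only [P, true_and] at this
      omega
    have h2 := h.1 _ h1
    rw [← hcut, hini.height_cut, hP.height_cut] at h2
    rw [T.cellHeight_eq_add i (P := P) (Q := (fun c => ¬ T.ReadBefore (r, j) c))] at h2
    swap
    · intro c hc' h' h''
      have := hP _ hm c hc' h'' h'
      simp only [P, true_and] at this
      omega
    have h4 : (l.cells.filter fun c => (¬ T.ReadBefore (r, j) c ∧ ¬ P c) ∧ T.bot c = i).card ≤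
        (l.cells.filter fun c => (¬ T.ReadBefore (r, j) c ∧ ¬ P c) ∧ T.bot c = i + 1).card := by
      refine Finset.card_le_card_of_injOn (fun c => (c.1 + 1, c.2)) ?_ ?_
      · rintro ⟨r', j'⟩ hc'
        obtain ⟨hm', ⟨h5, h6⟩, h7⟩ := Finset.mem_filter.1 hc'
        simp only [P, ReadBefore] at h5 h6
        obtain rfl : r' = r := by omega
        have hj : j' ≤ j := by omega
        have hmd := l.up_left_mem le_rfl hj hm2
        have h8 := T.col_lt (show r' < r' + 1 by omega) hmd
        have h9 := T.row_le hj hm2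
        refine Finset.mem_filter.2 ⟨hmd, ?_⟩
        simp only [P, ReadBefore, true_and]
        omega
      · rintro ⟨r', j'⟩ hc' ⟨r'', j''⟩ hc'' e
        simp only [Prod.mk.injEq] at e ⊢
        omega
    simp only [cellHeight] at h2
    omega

/-- The crystal operator `e i` sends `T` to `S`. -/
def RaisesTo (i : ℕ) (T S : Bitableau l) : Prop := S.top = T.top ∧ WordRaise i T.word S.word

/-- The crystal operator `f i` sends `T` to `S`. -/
def LowersTo (i : ℕ) (T S : Bitableau l) : Prop := S.top = T.top ∧ WordLower i T.word S.word

/-- How often the crystal operator `e i` can be applied. -/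
def eps (i : ℕ) (T : Bitableau l) : ℕ := wordEps i T.word

/-- How often the crystal operator `f i` can be applied. -/
def phi (i : ℕ) (T : Bitableau l) : ℕ := wordPhi i T.word

lemma raisesTo_iff_lowersTo {i : ℕ} {T S : Bitableau l} : RaisesTo i T S ↔ LowersTo i S T := by
  rw [RaisesTo, LowersTo, wordRaise_iff_wordLower, eq_comm]

lemma RaisesTo.unique {i : ℕ} {T S S' : Bitableau l} (h : RaisesTo i T S) (h' : RaisesTo i T S') :
    S = S' :=
  eq_of_top_of_word (h.1.trans h'.1.symm) (h.2.unique h'.2)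

lemma LowersTo.unique {i : ℕ} {T S S' : Bitableau l} (h : LowersTo i T S) (h' : LowersTo i T S') :
    S = S' :=
  eq_of_top_of_word (h.1.trans h'.1.symm) (h.2.unique h'.2)

lemma RaisesTo.injective {i : ℕ} {T T' S : Bitableau l} (h : RaisesTo i T S)
    (h' : RaisesTo i T' S) : T = T' :=
  (raisesTo_iff_lowersTo.1 h).unique (raisesTo_iff_lowersTo.1 h')

lemma LowersTo.injective {i : ℕ} {T T' S : Bitableau l} (h : LowersTo i T S)
    (h' : LowersTo i T' S) : T = T' :=
  (raisesTo_iff_lowersTo.2 h).unique (raisesTo_iff_lowersTo.2 h')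

lemma exists_raisesTo {i : ℕ} {T : Bitableau l} (h : T.eps i ≠ 0) : ∃ S, RaisesTo i T S := by
  obtain ⟨p, hp⟩ := exists_raiseAt h
  obtain ⟨S, h1, h2⟩ := T.exists_raise hp
  exact ⟨S, h1, wordRaise_iff.2 ⟨p, hp, h2⟩⟩

lemma exists_lowersTo {i : ℕ} {T : Bitableau l} (h : T.phi i ≠ 0) : ∃ S, LowersTo i T S := by
  obtain ⟨p, hp⟩ := exists_lowerAt h
  obtain ⟨S, h1, h2⟩ := T.exists_lower hp
  exact ⟨S, h1, wordLower_iff.2 ⟨p, hp, h2⟩⟩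

lemma RaisesTo.eps {i : ℕ} {T S : Bitableau l} (h : RaisesTo i T S) : T.eps i = S.eps i + 1 :=
  h.2.wordEps

lemma RaisesTo.phi {i : ℕ} {T S : Bitableau l} (h : RaisesTo i T S) : S.phi i = T.phi i + 1 :=
  h.2.wordPhi

lemma LowersTo.phi {i : ℕ} {T S : Bitableau l} (h : LowersTo i T S) : T.phi i = S.phi i + 1 :=
  (raisesTo_iff_lowersTo.2 h).phi

lemma eps_eq (i : ℕ) (T : Bitableau l) :
    (T.eps i : ℤ) = T.phi i + ((T.bWeight (i + 1) : ℤ) - T.bWeight i) := by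
  rw [eps, phi, wordEps_eq, count_word, count_word]

lemma RaisesTo.bWeight {i : ℕ} {T S : Bitableau l} (h : RaisesTo i T S) (k : ℕ) :
    (S.bWeight k : ℤ) = T.bWeight k + (Pi.single i 1 - Pi.single (i + 1) 1 : ℕ → ℤ) k := by
  rw [← count_word, ← count_word, h.2.count]

lemma aWeight_congr {T S : Bitableau l} (h : S.top = T.top) : S.aWeight = T.aWeight := by
  funext k; rw [aWeight, aWeight, h]

lemma isYamanouchi_word_iff_eps {T : Bitableau l} : IsYamanouchi T.word ↔ ∀ i, T.eps i = 0 :=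
  isYamanouchi_iff_wordEps

/-! ### Finiteness -/

lemma finite_bounded (l : YoungDiagram) (n m : ℕ) :
    {T : Bitableau l | ∀ c ∈ l.cells, T.top c < n ∧ T.bot c < m}.Finite := by
  let F : {T : Bitableau l | ∀ c ∈ l.cells, T.top c < n ∧ T.bot c < m} →
      (l.cells → Fin n × Fin m) :=
    fun T c => (⟨T.1.top c, (T.2 c c.2).1⟩, ⟨T.1.bot c, (T.2 c c.2).2⟩)
  have hF : Function.Injective F := by
    rintro ⟨T, hT⟩ ⟨S, hS⟩ h
    refine Subtype.ext (ext_top_bot fun c hc => ?_)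
    have := congrFun h ⟨c, hc⟩
    simpa [F] using this
  have := Finite.of_injective F hF
  exact Set.toFinite _

lemma bWeight_eq_zero_iff {T : Bitableau l} {k : ℕ} :
    T.bWeight k = 0 ↔ ∀ c ∈ l.cells, T.bot c ≠ k := by
  rw [bWeight, Finset.card_eq_zero, Finset.filter_eq_empty_iff]

lemma aWeight_eq_zero_iff {T : Bitableau l} {k : ℕ} :
    T.aWeight k = 0 ↔ ∀ c ∈ l.cells, T.top c ≠ k := by
  rw [aWeight, Finset.card_eq_zero, Finset.filter_eq_empty_iff]

lemma forall_bot_lt_iff {T : Bitableau l} {m : ℕ} :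
    (∀ c ∈ l.cells, T.bot c < m) ↔ ∀ k, m ≤ k → T.bWeight k = 0 := by
  simp only [bWeight_eq_zero_iff]
  exact ⟨fun h k hk c hc e => by have := h c hc; omega,
    fun h c hc => not_le.1 fun h' => h _ h' c hc rfl⟩

lemma forall_top_lt_iff {T : Bitableau l} {n : ℕ} :
    (∀ c ∈ l.cells, T.top c < n) ↔ ∀ k, n ≤ k → T.aWeight k = 0 := by
  simp only [aWeight_eq_zero_iff]
  exact ⟨fun h k hk c hc e => by have := h c hc; omega,
    fun h c hc => not_le.1 fun h' => h _ h' c hc rfl⟩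

lemma finite_weights (l : YoungDiagram) (n m : ℕ) :
    {T : Bitableau l | (∀ k, n ≤ k → T.aWeight k = 0) ∧ ∀ k, m ≤ k → T.bWeight k = 0}.Finite := by
  refine (finite_bounded l n m).subset fun T hT c hc => ⟨?_, ?_⟩
  · exact forall_top_lt_iff.2 hT.1 c hc
  · exact forall_bot_lt_iff.2 hT.2 c hc

end Bitableau

/-! ### The crystal -/

section Crystal

open Bitableau

variable {l : YoungDiagram} {n m : ℕ}

lemma BoundedBitableau.exists_raisesTo (i : Fin (m - 1)) (T : BoundedBitableau l n m)
    (h : T.1.eps i ≠ 0) : ∃ S : BoundedBitableau l n m, RaisesTo i T.1 S.1 := by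
  obtain ⟨S, hS⟩ := Bitableau.exists_raisesTo h
  have hT : ∀ c ∈ l.cells, S.bot c < m := by
    have hT := forall_bot_lt_iff.1 fun c hc => (T.2 c hc).2
    refine forall_bot_lt_iff.2 fun k hk => ?_
    have h1 := hS.bWeight k
    have := i.2
    rw [hT k hk, Pi.sub_apply, Pi.single_eq_of_ne (by omega), Pi.single_eq_of_ne (by omega)] at h1
    simpa using h1
  exact ⟨⟨S, fun c hc => ⟨by rw [hS.1]; exact (T.2 c hc).1, hT c hc⟩⟩, hS⟩

lemma BoundedBitableau.exists_lowersTo (i : Fin (m - 1)) (T : BoundedBitableau l n m)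
    (h : T.1.phi i ≠ 0) : ∃ S : BoundedBitableau l n m, LowersTo i T.1 S.1 := by
  obtain ⟨S, hS⟩ := Bitableau.exists_lowersTo h
  have hT : ∀ c ∈ l.cells, S.bot c < m := by
    have hT := forall_bot_lt_iff.1 fun c hc => (T.2 c hc).2
    refine forall_bot_lt_iff.2 fun k hk => ?_
    have h1 := (raisesTo_iff_lowersTo.2 hS).bWeight k
    have := i.2
    rw [hT k hk, Pi.sub_apply, Pi.single_eq_of_ne (by omega), Pi.single_eq_of_ne (by omega)] at h1
    have h2 := h1.symm
    simp only [sub_self, add_zero] at h2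
    exact_mod_cast h2
  exact ⟨⟨S, fun c hc => ⟨by rw [hS.1]; exact (T.2 c hc).1, hT c hc⟩⟩, hS⟩

open Classical in
/-- The raising operator of the crystal of bounded bitableaux. -/
def crystalE (i : Fin (m - 1)) (T : BoundedBitableau l n m) : Option (BoundedBitableau l n m) :=
  if h : ∃ S : BoundedBitableau l n m, RaisesTo i T.1 S.1 then some h.choose else none

open Classical in
/-- The lowering operator of the crystal of bounded bitableaux. -/
def crystalF (i : Fin (m - 1)) (T : BoundedBitableau l n m) : Option (BoundedBitableau l n m) :=
  if h : ∃ S : BoundedBitableau l n m, LowersTo i T.1 S.1 then some h.choose else none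

lemma crystalE_eq_some {i : Fin (m - 1)} {T S : BoundedBitableau l n m} :
    crystalE i T = some S ↔ RaisesTo i T.1 S.1 := by
  unfold crystalE
  split_ifs with h
  · rw [Option.some.injEq]
    exact ⟨fun e => e ▸ h.choose_spec, fun h' => Subtype.ext (h.choose_spec.unique h')⟩
  · simp only [false_iff]
    exact fun h' => h ⟨S, h'⟩

lemma crystalF_eq_some {i : Fin (m - 1)} {T S : BoundedBitableau l n m} :
    crystalF i T = some S ↔ LowersTo i T.1 S.1 := by
  unfold crystalF
  split_ifs with h
  · rw [Option.some.injEq]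
    exact ⟨fun e => e ▸ h.choose_spec, fun h' => Subtype.ext (h.choose_spec.unique h')⟩
  · simp only [false_iff]
    exact fun h' => h ⟨S, h'⟩

lemma crystalE_eq_none {i : Fin (m - 1)} {T : BoundedBitableau l n m} :
    crystalE i T = none ↔ T.1.eps i = 0 := by
  rw [Option.eq_none_iff_forall_ne_some]
  simp only [ne_eq, crystalE_eq_some]
  constructor
  · intro h
    by_contra h0
    obtain ⟨S, hS⟩ := BoundedBitableau.exists_raisesTo i T h0
    exact h S hS
  · intro h S hS
    have := hS.eps
    omega

lemma crystalF_eq_none {i : Fin (m - 1)} {T : BoundedBitableau l n m} :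
    crystalF i T = none ↔ T.1.phi i = 0 := by
  rw [Option.eq_none_iff_forall_ne_some]
  simp only [ne_eq, crystalF_eq_some]
  constructor
  · intro h
    by_contra h0
    obtain ⟨S, hS⟩ := BoundedBitableau.exists_lowersTo i T h0
    exact h S hS
  · intro h S hS
    have := hS.phi
    omega

/-- The crystal of bitableaux with bounded entries. -/
def bitableauCrystal (l : YoungDiagram) (n m : ℕ) : GLCrystal m (BoundedBitableau l n m) where
  wt T k := T.1.bWeight k
  e := crystalE
  f := crystalF
  ε i T := T.1.eps i
  φ i T := T.1.phi i
  e_iff_f i x y := by rw [crystalE_eq_some, crystalF_eq_some, raisesTo_iff_lowersTo]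
  wt_e i x y h := by
    funext k
    rw [(crystalE_eq_some.1 h).bWeight]
    simp only [simpleRoot, Pi.add_apply, Pi.sub_apply, Pi.single_apply, Fin.ext_iff]
  ε_zero i x := crystalE_eq_none.symm
  ε_e i x y h := (crystalE_eq_some.1 h).eps
  φ_zero i x := crystalF_eq_none.symm
  φ_f i x y h := (crystalF_eq_some.1 h).phi
  φ_sub_ε i x := by rw [eps_eq]; ring

lemma isSortByTopCrystal_bitableauCrystal (l : YoungDiagram) (n m : ℕ) :
    IsSortByTopCrystal (bitableauCrystal l n m) where
  wt_eq _ _ := rfl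
  e_eq _ _ _ := crystalE_eq_some
  e_none _ _ := crystalE_eq_none.trans wordEps_eq_zero_iff
  f_eq _ _ _ := crystalF_eq_some
  f_none _ _ := crystalF_eq_none.trans wordPhi_eq_zero_iff

lemma forall_crystalE_eq_none_iff (T : BoundedBitableau l n m) :
    (∀ i : Fin (m - 1), crystalE i T = none) ↔ IsYamanouchi T.1.word := by
  simp only [crystalE_eq_none, isYamanouchi_word_iff_eps]
  refine ⟨fun h i => ?_, fun h i => h i⟩
  by_cases hi : i < m - 1
  · exact h ⟨i, hi⟩
  · -- there is no letter `i + 1`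
    have h0 := forall_bot_lt_iff.1 (fun c hc => (T.2 c hc).2) (i + 1) (by omega)
    by_contra h1
    obtain ⟨S, hS⟩ := Bitableau.exists_raisesTo h1
    have := hS.bWeight (i + 1)
    simp [h0] at this

end Crystal

/-! ### Minimal violations of the Yamanouchi condition -/

/-- The suffix `(i + 1) :: v` of a word is a minimal violation of the Yamanouchi condition if `v`
satisfies the condition and contains as many letters `i` as letters `i + 1`. -/
def IsViolation (i : ℕ) (v : List ℕ) : Prop :=
  IsYamanouchi v ∧ v.count (i + 1) = v.count i

lemma exists_violation {w : List ℕ} (h : ¬ IsYamanouchi w) :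
    ∃ κ : ℕ × List ℕ, (κ.1 + 1) :: κ.2 <:+ w ∧ IsViolation κ.1 κ.2 := by
  induction w with
  | nil =>
    refine absurd (fun s hs i => ?_) h
    rw [List.suffix_nil.1 hs]
    simp
  | cons x w ih =>
    by_cases hw : IsYamanouchi w
    · simp only [IsYamanouchi, not_forall, not_le] at h
      obtain ⟨s, hs, i, hi⟩ := h
      rcases List.suffix_cons_iff.1 hs with rfl | hs'
      · have h1 := hw w List.suffix_rfl i
        rw [List.count_cons, List.count_cons] at hi
        by_cases e : x = i + 1
        · subst e
          refine ⟨(i, w), List.suffix_rfl, hw, ?_⟩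
          simp at hi
          dsimp only
          omega
        · simp [e] at hi
          omega
      · exact absurd (hw s hs' i) (by omega)
    · obtain ⟨κ, h1, h2⟩ := ih hw
      exact ⟨κ, h1.trans (List.suffix_cons _ _), h2⟩

lemma IsViolation.not_isYamanouchi {i : ℕ} {v w : List ℕ} (h : IsViolation i v)
    (hs : (i + 1) :: v <:+ w) : ¬ IsYamanouchi w := by
  intro hw
  have h1 := hw _ hs i
  have h2 := h.2
  simp at h1
  omega

lemma IsViolation.unique {κ κ' : ℕ × List ℕ} {w : List ℕ} (h : IsViolation κ.1 κ.2)
    (hs : (κ.1 + 1) :: κ.2 <:+ w) (h' : IsViolation κ'.1 κ'.2)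
    (hs' : (κ'.1 + 1) :: κ'.2 <:+ w) : κ = κ' := by
  have key : ∀ κ κ' : ℕ × List ℕ, IsViolation κ.1 κ.2 → IsViolation κ'.1 κ'.2 →
      (κ.1 + 1) :: κ.2 <:+ (κ'.1 + 1) :: κ'.2 → κ = κ' := by
    rintro ⟨i, v⟩ ⟨i', v'⟩ h h' hs
    rcases List.suffix_cons_iff.1 hs with e | hs
    · simpa using e
    · exact absurd h'.1 (h.not_isYamanouchi hs)
  rcases List.suffix_or_suffix_of_suffix hs hs' with h0 | h0
  · exact key _ _ h h' h0
  · exact (key _ _ h' h h0).symm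

lemma suffix_set_of_lt {a s : List ℕ} {p x : ℕ} (h : p < a.length) :
    s <:+ (a ++ s).set p x := by
  rw [List.set_append_left _ _ h]
  exact List.suffix_append _ _

lemma IsViolation.height_length_sub {i : ℕ} {v a : List ℕ} (h : IsViolation i v) :
    height i (a ++ (i + 1) :: v) (a ++ (i + 1) :: v).length =
      height i (a ++ (i + 1) :: v) a.length + 1 := by
  have h1 := Kron.height_length_sub i (a ++ (i + 1) :: v) a.length
  have h2 := h.2
  rw [List.drop_left] at h1
  simp only [List.count_cons_self, ne_eq, Nat.add_eq_left, one_ne_zero, not_false_eq_true,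
    List.count_cons_of_ne, h2] at h1
  push_cast at h1
  omega

lemma IsViolation.height_length_le {i : ℕ} {v a : List ℕ} (h : IsViolation i v) {p : ℕ}
    (hp : a.length < p) :
    height i (a ++ (i + 1) :: v) (a ++ (i + 1) :: v).length ≤ height i (a ++ (i + 1) :: v) p := by
  have h1 := Kron.height_length_sub i (a ++ (i + 1) :: v) p
  have h2 : (a ++ (i + 1) :: v).drop p <:+ v := by
    obtain ⟨q, rfl⟩ := Nat.exists_eq_add_of_lt hp
    rw [add_assoc, List.drop_append, List.drop_of_length_le (by omega), Nat.add_sub_cancel_left,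
      List.drop_succ_cons, List.nil_append]
    exact List.drop_suffix _ _
  have h3 := h.1 _ h2 i
  omega

lemma IsViolation.one_le_wordEps {i : ℕ} {v w : List ℕ} (h : IsViolation i v)
    (hs : (i + 1) :: v <:+ w) : 1 ≤ wordEps i w := by
  obtain ⟨a, rfl⟩ := hs
  have h1 := h.height_length_sub (a := a)
  have h2 := neg_wordPhi_le i (a ++ (i + 1) :: v) a.length
  rw [wordEps]
  omega

/-- Lowering preserves the minimal violation. -/
lemma IsViolation.suffix_of_lower {i : ℕ} {v w w' : List ℕ} (h : IsViolation i v)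
    (hs : (i + 1) :: v <:+ w) (hw : WordLower i w w') : (i + 1) :: v <:+ w' := by
  obtain ⟨p, hp, rfl⟩ := wordLower_iff.1 hw
  obtain ⟨a, rfl⟩ := hs
  refine suffix_set_of_lt ?_
  by_contra! hlt
  have h1 := h.height_length_sub (a := a)
  have h2 := h.height_length_le (a := a) (p := p + 1) (by omega)
  have h3 := hp.1 a.length hlt
  omega

/-- Raising preserves the minimal violation, unless it involves the last unmatched "(". -/
lemma IsViolation.suffix_of_raise {i : ℕ} {v w w' : List ℕ} (h : IsViolation i v)
    (hs : (i + 1) :: v <:+ w) (he : 1 < wordEps i w) (hw : WordRaise i w w') :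
    (i + 1) :: v <:+ w' := by
  obtain ⟨p, hp, rfl⟩ := wordRaise_iff.1 hw
  obtain ⟨a, rfl⟩ := hs
  refine suffix_set_of_lt ?_
  by_contra! hlt
  have h1 := h.height_length_sub (a := a)
  have h3 := hp.height_eq
  rw [wordEps] at he
  rcases hlt.eq_or_lt with e | e
  · rw [← e] at h3
    omega
  · have h2 := h.height_length_le e
    omega

/-! ### Counting in strings -/

lemma _root_.Set.ncard_le_ncard_of_rel {α β : Type*} {s : Set α} {t : Set β} (r : α → β → Prop)
    (ht : t.Finite) (h : ∀ a ∈ s, ∃ b ∈ t, r a b) (hr : ∀ a a' b, r a b → r a' b → a = a') :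
    s.ncard ≤ t.ncard := by
  classical
  rcases t.eq_empty_or_nonempty with rfl | ⟨b₀, hb₀⟩
  · have : s = ∅ := Set.eq_empty_of_forall_notMem fun a ha => by simpa using h a ha
    simp [this]
  · have : Nonempty β := ⟨b₀⟩
    choose! f hf hf' using h
    exact Set.ncard_le_ncard_of_injOn f hf
      (fun a ha a' ha' e => hr a a' (f a) (hf' a ha) (e ▸ hf' a' ha')) ht

namespace Bitableau

variable {l : YoungDiagram}

/-- The `b`-weight of a bitableau, as an integral weight. -/
def wt (T : Bitableau l) : ℕ → ℤ := fun k => T.bWeight k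

/-- The simple root `α_i`. -/
def root (i : ℕ) : ℕ → ℤ := Pi.single i 1 - Pi.single (i + 1) 1

lemma RaisesTo.wt {i : ℕ} {T S : Bitableau l} (h : RaisesTo i T S) : S.wt = T.wt + root i :=
  funext fun k => h.bWeight k

lemma LowersTo.wt {i : ℕ} {T S : Bitableau l} (h : LowersTo i T S) : S.wt = T.wt - root i := by
  rw [(raisesTo_iff_lowersTo.2 h).wt]; simp

/-- A set of bitableaux which is closed under the crystal operators `f i` and `e i`, except that
each string may be cut off before the last `c` elements at the end where `ε i` is small. -/
structure StringClosed (X : Set (Bitableau l)) (i c : ℕ) : Prop where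
  finite : ∀ d : ℕ → ℤ, {T | T ∈ X ∧ T.wt = d}.Finite
  lower : ∀ T ∈ X, ∀ S, LowersTo i T S → S ∈ X
  raise : ∀ T ∈ X, ∀ S, c < T.eps i → RaisesTo i T S → S ∈ X
  le_eps : ∀ T ∈ X, c ≤ T.eps i

variable {X : Set (Bitableau l)} {i c : ℕ}

lemma StringClosed.ncard_le_raise (h : StringClosed X i c) (k : ℕ) : ∀ d : ℕ → ℤ,
    {T | T ∈ X ∧ T.wt = d ∧ c + k ≤ T.eps i}.ncard ≤
      {T | T ∈ X ∧ T.wt = d + (k : ℤ) • root i}.ncard := by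
  induction k with
  | zero =>
    intro d
    refine Set.ncard_le_ncard ?_ (h.finite _)
    rintro T ⟨h1, h2, -⟩
    exact ⟨h1, by simp [h2]⟩
  | succ k ih =>
    intro d
    have h1 := ih (d + root i)
    rw [show d + ((k + 1 : ℕ) : ℤ) • root i = d + root i + (k : ℤ) • root i by
      push_cast; module]
    refine le_trans (Set.ncard_le_ncard_of_rel (RaisesTo i)
      ((h.finite (d + root i)).subset fun T hT => ⟨hT.1, hT.2.1⟩) ?_
      (fun _ _ _ => RaisesTo.injective)) h1
    rintro T ⟨hT, hd, he⟩
    obtain ⟨S, hS⟩ := exists_raisesTo (show T.eps i ≠ 0 by omega)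
    have := hS.eps
    exact ⟨S, ⟨h.raise T hT S (by omega) hS, by rw [hS.wt, hd], by omega⟩, hS⟩

lemma StringClosed.ncard_le_lower (h : StringClosed X i c) (k : ℕ) : ∀ d : ℕ → ℤ,
    {T | T ∈ X ∧ T.wt = d ∧ k ≤ T.phi i}.ncard ≤
      {T | T ∈ X ∧ T.wt = d - (k : ℤ) • root i}.ncard := by
  induction k with
  | zero =>
    intro d
    refine Set.ncard_le_ncard ?_ (h.finite _)
    rintro T ⟨h1, h2, -⟩
    exact ⟨h1, by simp [h2]⟩
  | succ k ih =>
    intro d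
    have h1 := ih (d - root i)
    rw [show d - ((k + 1 : ℕ) : ℤ) • root i = d - root i - (k : ℤ) • root i by
      push_cast; module]
    refine le_trans (Set.ncard_le_ncard_of_rel (LowersTo i)
      ((h.finite (d - root i)).subset fun T hT => ⟨hT.1, hT.2.1⟩) ?_
      (fun _ _ _ => LowersTo.injective)) h1
    rintro T ⟨hT, hd, he⟩
    obtain ⟨S, hS⟩ := exists_lowersTo (show T.phi i ≠ 0 by omega)
    have := hS.phi
    exact ⟨S, ⟨h.lower T hT S hS, by rw [hS.wt, hd], by omega⟩, hS⟩

/-- The reflection `s_i` of weights, shifted by `c`. -/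
def reflect (i c : ℕ) (d : ℕ → ℤ) : ℕ → ℤ :=
  fun k => d (Equiv.swap i (i + 1) k) + c * ((k : ℤ) - Equiv.swap i (i + 1) k)

lemma reflect_eq (i c : ℕ) (d : ℕ → ℤ) :
    reflect i c d = d + (d (i + 1) - d i - c) • root i := by
  funext k
  simp only [reflect, root, Pi.add_apply, Pi.smul_apply, Pi.sub_apply, smul_eq_mul]
  by_cases h1 : k = i
  · subst h1; simp; ring
  · by_cases h2 : k = i + 1
    · subst h2; simp; ring
    · rw [Equiv.swap_apply_of_ne_of_ne h1 h2]
      simp [h1, h2]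

lemma reflect_reflect (i c : ℕ) (d : ℕ → ℤ) : reflect i c (reflect i c d) = d := by
  funext k
  simp only [reflect, Equiv.swap_apply_self]
  ring

/-- The reversal of the strings. -/
lemma StringClosed.ncard_reflect (h : StringClosed X i c) (d : ℕ → ℤ) :
    {T | T ∈ X ∧ T.wt = reflect i c d}.ncard = {T | T ∈ X ∧ T.wt = d}.ncard := by
  have key : ∀ d, {T | T ∈ X ∧ T.wt = d}.ncard ≤ {T | T ∈ X ∧ T.wt = reflect i c d}.ncard := by
    intro d
    rw [reflect_eq]
    have h0 : ∀ T : Bitableau l, T.wt = d → (T.eps i : ℤ) = T.phi i + (d (i + 1) - d i) := by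
      rintro T rfl
      exact T.eps_eq i
    rcases le_total 0 (d (i + 1) - d i - c) with hk | hk
    · obtain ⟨k, hk⟩ := Int.eq_ofNat_of_zero_le hk
      rw [hk]
      refine le_trans (Set.ncard_le_ncard ?_ ?_) (h.ncard_le_raise k d)
      · rintro T ⟨h1, h2⟩
        have := h0 T h2
        exact ⟨h1, h2, by omega⟩
      · exact (h.finite d).subset fun T hT => ⟨hT.1, hT.2.1⟩
    · obtain ⟨k, hk⟩ := Int.eq_ofNat_of_zero_le (neg_nonneg.2 hk)
      rw [show d + (d (i + 1) - d i - c) • root i = d - (k : ℤ) • root i by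
        rw [← hk]; module]
      refine le_trans (Set.ncard_le_ncard ?_ ?_) (h.ncard_le_lower k d)
      · rintro T ⟨h1, h2⟩
        have := h0 T h2
        have := h.le_eps T h1
        exact ⟨h1, h2, by omega⟩
      · exact (h.finite d).subset fun T hT => ⟨hT.1, hT.2.1⟩
  refine le_antisymm ?_ (key d)
  have := key (reflect i c d)
  rwa [reflect_reflect] at this

end Bitableau

/-! ### Extraction of Schur coefficients -/

/-- The exponent `w(ν + δ) - δ`. Since only differences of the entries of `δ` matter, `δ k = -k` is
used instead of `δ k = m - 1 - k`. -/
def dotWeight (ν : YoungDiagram) (w : Equiv.Perm ℕ) : ℕ → ℤ :=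
  fun k => ν.rowLen (w k) - (w k : ℤ) + k

lemma rowLen_eq_zero {ν : YoungDiagram} {k : ℕ} (h : ν.colLen 0 ≤ k) : ν.rowLen k = 0 := by
  by_contra h0
  have h1 : (k, 0) ∈ ν := YoungDiagram.mem_iff_lt_rowLen.2 (by omega)
  have := YoungDiagram.mem_iff_lt_colLen.1 h1
  omega

/-- The permutations of the rows of a Young diagram. -/
abbrev RowPerm (ν : YoungDiagram) : Type := Equiv.Perm (Finset.range (ν.colLen 0))

/-- A permutation of the rows, extended by the identity. -/
def RowPerm.ext {ν : YoungDiagram} : RowPerm ν →* Equiv.Perm ℕ :=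
  Equiv.Perm.ofSubtype (p := (· ∈ Finset.range (ν.colLen 0)))

lemma RowPerm.ext_apply_of_le {ν : YoungDiagram} (w : RowPerm ν) {k : ℕ} (h : ν.colLen 0 ≤ k) :
    RowPerm.ext w k = k :=
  Equiv.Perm.ofSubtype_apply_of_not_mem w (by simpa using h)

lemma dotWeight_of_le {ν : YoungDiagram} (w : RowPerm ν) {k : ℕ} (h : ν.colLen 0 ≤ k) :
    dotWeight ν (RowPerm.ext w) k = 0 := by
  rw [dotWeight, w.ext_apply_of_le h, rowLen_eq_zero h]; simp

/-- The exponent `w(ν + δ) - δ` as a monomial, provided that it has no negative entries. -/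
def dotExp (ν : YoungDiagram) (w : RowPerm ν) : ℕ →₀ ℕ :=
  Finsupp.onFinset (Finset.range (ν.colLen 0)) (fun k => (dotWeight ν (RowPerm.ext w) k).toNat)
    fun k hk => by
      by_contra h
      rw [Finset.mem_range, not_lt] at h
      rw [dotWeight_of_le w h] at hk
      exact hk rfl

lemma dotExp_apply (ν : YoungDiagram) (w : RowPerm ν) (k : ℕ) :
    dotExp ν w k = (dotWeight ν (RowPerm.ext w) k).toNat := rfl

open Classical in
/-- The coefficient of `s_ν` in a symmetric function: the alternating sum of the coefficients of
the monomials `x^(w(ν + δ) - δ)`. -/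
def schurExtract (ν : YoungDiagram) : MvPowerSeries ℕ ℤ →ₗ[ℤ] ℤ :=
  ∑ w : RowPerm ν, if ∀ k, 0 ≤ dotWeight ν (RowPerm.ext w) k then
    (Equiv.Perm.sign w : ℤ) • MvPowerSeries.coeff (dotExp ν w) else 0

open Classical in
lemma schurExtract_apply (ν : YoungDiagram) (f : MvPowerSeries ℕ ℤ) :
    schurExtract ν f = ∑ w : RowPerm ν, if ∀ k, 0 ≤ dotWeight ν (RowPerm.ext w) k then
      (Equiv.Perm.sign w : ℤ) * f (dotExp ν w) else 0 := by
  rw [schurExtract, LinearMap.sum_apply]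
  refine Finset.sum_congr rfl fun w _ => ?_
  split_ifs
  · rfl
  · rfl

lemma rowLen_sub_strictAnti (ν : YoungDiagram) : StrictAnti fun k : ℕ => (ν.rowLen k : ℤ) - k := by
  intro a b h
  have := ν.rowLen_anti a b h.le
  dsimp only
  omega

lemma _root_.Equiv.Perm.eq_one_of_strictMono {w : Equiv.Perm ℕ} (h : StrictMono w) : w = 1 := by
  ext k
  refine le_antisymm ?_ (h.le_apply (x := k))
  have h' : StrictMono w.symm := fun a b hab => by
    rw [← h.lt_iff_lt]; simpa using hab
  have := h'.le_apply (x := w k)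
  simpa using this

lemma RowPerm.eq_one_of_strictAnti {ν : YoungDiagram} (w : RowPerm ν)
    (h : StrictAnti fun k : ℕ => dotWeight ν (RowPerm.ext w) k - k) : w = 1 := by
  apply Equiv.Perm.ofSubtype_injective (p := (· ∈ Finset.range (ν.colLen 0)))
  rw [map_one]
  refine Equiv.Perm.eq_one_of_strictMono (w := RowPerm.ext w) fun a b hab => ?_
  rw [← (rowLen_sub_strictAnti ν).lt_iff_gt]
  have := h hab
  simpa [dotWeight] using this

lemma reflect_dotWeight (ν : YoungDiagram) (w : Equiv.Perm ℕ) (i : ℕ) :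
    Bitableau.reflect i 1 (dotWeight ν w) = dotWeight ν (w * Equiv.swap i (i + 1)) := by
  funext k
  simp only [Bitableau.reflect, dotWeight, Equiv.Perm.mul_apply]
  push_cast; ring

namespace Bitableau

variable {l : YoungDiagram}

/-- The character of a set of bitableaux with respect to the `b`-weight. -/
def character (X : Set (Bitableau l)) : MvPowerSeries ℕ ℤ :=
  fun d => ({T | T ∈ X ∧ ∀ k, T.bWeight k = d k}.ncard : ℤ)

lemma finite_wt_of_finite {X : Set (Bitableau l)}
    (hfin : ∀ d : ℕ →₀ ℕ, {T | T ∈ X ∧ ∀ k, T.bWeight k = d k}.Finite) (d : ℕ → ℤ) :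
    {T | T ∈ X ∧ T.wt = d}.Finite := by
  rcases Set.eq_empty_or_nonempty {T | T ∈ X ∧ T.wt = d} with h | ⟨T₀, h0, rfl⟩
  · rw [h]; exact Set.finite_empty
  · let e : ℕ →₀ ℕ := Finsupp.onFinset (l.cells.image T₀.bot) T₀.bWeight fun k hk => by
      rw [ne_eq, bWeight_eq_zero_iff] at hk
      push Not at hk
      obtain ⟨c, hc, rfl⟩ := hk
      exact Finset.mem_image_of_mem _ hc
    refine (hfin e).subset fun T hT => ⟨hT.1, fun k => ?_⟩
    have := congrFun hT.2 k
    simp only [wt] at this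
    exact_mod_cast this

/-- The alternating sum of the numbers of bitableaux of weight `w(ν + δ) - δ` in a set. -/
def alternatingCount (ν : YoungDiagram) (X : Set (Bitableau l)) : ℤ :=
  ∑ w : RowPerm ν, (Equiv.Perm.sign w : ℤ) *
    ({T | T ∈ X ∧ T.wt = dotWeight ν (RowPerm.ext w)}.ncard : ℤ)

lemma schurExtract_character (ν : YoungDiagram) (X : Set (Bitableau l)) :
    schurExtract ν (character X) = alternatingCount ν X := by
  classical
  rw [schurExtract_apply, alternatingCount]
  refine Finset.sum_congr rfl fun w _ => ?_
  split_ifs with h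
  · have : {T | T ∈ X ∧ ∀ k, T.bWeight k = dotExp ν w k} =
        {T | T ∈ X ∧ T.wt = dotWeight ν (RowPerm.ext w)} := by
      ext T
      simp only [Set.mem_ofPred_eq, funext_iff, wt, dotExp_apply]
      refine and_congr_right fun _ => forall_congr' fun k => ?_
      have := h k
      omega
    rw [character, this]
  · have : {T | T ∈ X ∧ T.wt = dotWeight ν (RowPerm.ext w)} = ∅ := by
      refine Set.eq_empty_of_forall_notMem ?_
      rintro T ⟨-, hT⟩
      refine h fun k => ?_
      rw [← hT]
      exact Int.natCast_nonneg _
    rw [this]; simp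

/-- The bitableaux with a given minimal violation of the Yamanouchi condition cancel. -/
lemma alternatingCount_violation (ν : YoungDiagram) {X : Set (Bitableau l)}
    (hX : ∀ T S : Bitableau l, S.top = T.top → T ∈ X → S ∈ X)
    (hfin : ∀ d : ℕ →₀ ℕ, {T | T ∈ X ∧ ∀ k, T.bWeight k = d k}.Finite) {i : ℕ} {v : List ℕ}
    (hv : IsViolation i v) :
    alternatingCount ν {T | T ∈ X ∧ (i + 1) :: v <:+ T.word} = 0 := by
  set Y : Set (Bitableau l) := {T | T ∈ X ∧ (i + 1) :: v <:+ T.word} with hY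
  have hs : StringClosed Y i 1 :=
    { finite := fun d => (finite_wt_of_finite hfin d).subset fun T hT => ⟨hT.1.1, hT.2⟩
      lower := fun T hT S hS => ⟨hX T S hS.1 hT.1, hv.suffix_of_lower hT.2 hS.2⟩
      raise := fun T hT S he hS => ⟨hX T S hS.1 hT.1, hv.suffix_of_raise hT.2 he hS.2⟩
      le_eps := fun T hT => hv.one_le_wordEps hT.2 }
  by_cases hi : i + 1 < ν.colLen 0
  · let τ : RowPerm ν := Equiv.swap ⟨i, Finset.mem_range.2 (by omega)⟩ ⟨i + 1, Finset.mem_range.2 hi⟩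
    have hτ : RowPerm.ext τ = Equiv.swap i (i + 1) := Equiv.Perm.ofSubtype_swap_eq _ _
    have hsign : Equiv.Perm.sign τ = -1 := Equiv.Perm.sign_swap (by simp)
    have h1 : alternatingCount ν Y = -alternatingCount ν Y := by
      conv_lhs => rw [alternatingCount, ← Equiv.sum_comp (Equiv.mulRight τ)]
      rw [alternatingCount, ← Finset.sum_neg_distrib]
      refine Finset.sum_congr rfl fun w _ => ?_
      rw [Equiv.coe_mulRight, map_mul, map_mul, hτ, hsign, ← reflect_dotWeight, hs.ncard_reflect]
      simp
    omega
  · refine Finset.sum_eq_zero fun w _ => ?_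
    have : {T | T ∈ Y ∧ T.wt = dotWeight ν (RowPerm.ext w)} = ∅ := by
      refine Set.eq_empty_of_forall_notMem ?_
      rintro T ⟨hT, hw⟩
      have h1 := congrFun hw (i + 1)
      rw [dotWeight_of_le w (by omega), wt, ← count_word] at h1
      have h2 : i + 1 ∈ T.word := hT.2.subset List.mem_cons_self
      have := List.count_pos_iff.2 h2
      omega
    rw [this]; simp

lemma alternatingCount_yamanouchi (ν : YoungDiagram) (X : Set (Bitableau l)) :
    alternatingCount ν {T | T ∈ X ∧ IsYamanouchi T.word} =
      ({T | T ∈ X ∧ IsYamanouchi T.word ∧ ∀ k, T.bWeight k = ν.rowLen k}.ncard : ℤ) := by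
  rw [alternatingCount, Finset.sum_eq_single 1]
  · have : {T | T ∈ {T | T ∈ X ∧ IsYamanouchi T.word} ∧ T.wt = dotWeight ν (RowPerm.ext (1 : RowPerm ν))} =
        {T | T ∈ X ∧ IsYamanouchi T.word ∧ ∀ k, T.bWeight k = ν.rowLen k} := by
      ext T
      simp [wt, funext_iff, dotWeight, and_assoc]
    rw [this]; simp
  · intro w _ hw
    have : {T | T ∈ {T | T ∈ X ∧ IsYamanouchi T.word} ∧ T.wt = dotWeight ν (RowPerm.ext w)} = ∅ := by
      refine Set.eq_empty_of_forall_notMem ?_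
      rintro T ⟨⟨-, hT⟩, hd⟩
      refine hw (w.eq_one_of_strictAnti ?_)
      rw [← hd]
      refine strictAnti_nat_of_succ_lt fun k => ?_
      have := hT _ List.suffix_rfl k
      rw [count_word, count_word] at this
      simp only [wt]
      push_cast
      omega
    rw [this]; simp
  · simp

/-- The coefficient of `s_ν` in the character of a set of bitableaux described by a property of the
top entries: all bitableaux that are not of highest weight cancel. -/
theorem schurExtract_character_eq (ν : YoungDiagram) {X : Set (Bitableau l)}
    (hX : ∀ T S : Bitableau l, S.top = T.top → T ∈ X → S ∈ X)
    (hfin : ∀ d : ℕ →₀ ℕ, {T | T ∈ X ∧ ∀ k, T.bWeight k = d k}.Finite) :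
    schurExtract ν (character X) =
      ({T | T ∈ X ∧ IsYamanouchi T.word ∧ ∀ k, T.bWeight k = ν.rowLen k}.ncard : ℤ) := by
  classical
  rw [schurExtract_character, ← alternatingCount_yamanouchi]
  have hfin' := finite_wt_of_finite hfin
  let F : Finset (Bitableau l) :=
    Finset.univ.biUnion fun w : RowPerm ν => (hfin' (dotWeight ν (RowPerm.ext w))).toFinset
  have hF : ∀ T w, T ∈ X → T.wt = dotWeight ν (RowPerm.ext w) → T ∈ F := fun T w h1 h2 =>
    Finset.mem_biUnion.2 ⟨w, Finset.mem_univ _, by simpa using ⟨h1, h2⟩⟩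
  have hFX : ∀ T ∈ F, T ∈ X := fun T hT => by
    obtain ⟨w, -, h⟩ := Finset.mem_biUnion.1 hT
    have h' : T ∈ X ∧ T.wt = dotWeight ν (RowPerm.ext w) := by simpa using h
    exact h'.1
  let g : Bitableau l → ℤ := fun T => ∑ w : RowPerm ν,
    if T.wt = dotWeight ν (RowPerm.ext w) then (Equiv.Perm.sign w : ℤ) else 0
  have hg : ∀ (P : Bitableau l → Prop) [DecidablePred P],
      ∑ T ∈ F.filter P, g T = alternatingCount ν {T | T ∈ X ∧ P T} := by
    intro P _
    rw [Finset.sum_comm, alternatingCount]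
    refine Finset.sum_congr rfl fun w _ => ?_
    have h1 : {T | T ∈ {T | T ∈ X ∧ P T} ∧ T.wt = dotWeight ν (RowPerm.ext w)} =
        (((F.filter P).filter fun T => T.wt = dotWeight ν (RowPerm.ext w) : Finset (Bitableau l)) :
          Set (Bitableau l)) := by
      ext T
      simp only [Set.mem_ofPred_eq, Finset.coe_filter, Finset.mem_filter]
      exact ⟨fun h => ⟨⟨hF T w h.1.1 h.2, h.1.2⟩, h.2⟩,
        fun h => ⟨⟨hFX T h.1.1, h.1.2⟩, h.2⟩⟩
    rw [h1, Set.ncard_coe_finset, ← Finset.sum_filter, Finset.sum_const, nsmul_eq_mul, mul_comm]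
  have h1 : ∑ T ∈ F, g T = alternatingCount ν X := by simpa using hg fun _ => True
  rw [← h1, ← hg,
    ← Finset.sum_filter_add_sum_filter_not F fun T => IsYamanouchi T.word]
  rw [add_eq_left]
  -- the remaining bitableaux are grouped according to their minimal violations
  have hex : ∀ T : Bitableau l, ∃ κ : ℕ × List ℕ, ¬ IsYamanouchi T.word →
      (κ.1 + 1) :: κ.2 <:+ T.word ∧ IsViolation κ.1 κ.2 := by
    intro T
    by_cases hT : IsYamanouchi T.word
    · exact ⟨(0, []), fun h => absurd hT h⟩
    · obtain ⟨κ, hκ⟩ := exists_violation hT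
      exact ⟨κ, fun _ => hκ⟩
  choose key hkey using hex
  rw [← Finset.sum_fiberwise_of_maps_to (t := (F.filter fun T => ¬ IsYamanouchi T.word).image key)
    (g := key) fun T hT => Finset.mem_image_of_mem _ hT]
  refine Finset.sum_eq_zero fun κ hκ => ?_
  obtain ⟨T₀, hT₀, rfl⟩ := Finset.mem_image.1 hκ
  obtain ⟨-, hv⟩ := hkey T₀ (Finset.mem_filter.1 hT₀).2
  rw [← alternatingCount_violation ν hX hfin hv, ← hg, Finset.filter_filter]
  congr 1
  refine Finset.filter_congr fun T _ => ?_
  constructor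
  · rintro ⟨h2, h3⟩
    rw [← h3]
    exact (hkey T h2).1
  · intro h2
    have h3 := hv.not_isYamanouchi h2
    exact ⟨h3, (hkey T h3).2.unique (hkey T h3).1 hv h2⟩

end Bitableau

/-! ### Contents -/

section Content

variable {κ κ' : Type*}

/-- The content of a filling of the cells of a Young diagram: how often each value occurs. -/
def content (l : YoungDiagram) (g : ℕ × ℕ → κ) : κ →₀ ℕ := ∑ c ∈ l.cells, Finsupp.single (g c) 1

lemma content_apply [DecidableEq κ] (l : YoungDiagram) (g : ℕ × ℕ → κ) (k : κ) :
    content l g k = (l.cells.filter fun c => g c = k).card := by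
  classical
  rw [content, Finsupp.finsetSum_apply, Finset.card_filter]
  refine Finset.sum_congr rfl fun c _ => ?_
  rw [Finsupp.single_apply]

lemma mapDomain_content (l : YoungDiagram) (g : ℕ × ℕ → κ) (h : κ → κ') :
    (content l g).mapDomain h = content l fun c => h (g c) := by
  simp [content, Finsupp.mapDomain_finsetSum, Finsupp.mapDomain_single]

lemma content_congr {l : YoungDiagram} {g g' : ℕ × ℕ → κ} (h : ∀ c ∈ l, g c = g' c) :
    content l g = content l g' :=
  Finset.sum_congr rfl fun c hc => by rw [h c hc]

lemma mem_support_content {l : YoungDiagram} (g : ℕ × ℕ → κ) {c : ℕ × ℕ} (hc : c ∈ l) :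
    g c ∈ (content l g).support := by
  classical
  rw [Finsupp.mem_support_iff, content_apply, Finset.card_ne_zero]
  exact ⟨c, Finset.mem_filter.2 ⟨hc, rfl⟩⟩

lemma degree_content (l : YoungDiagram) (g : ℕ × ℕ → κ) : (content l g).degree = l.card := by
  simp [content, map_sum, YoungDiagram.card]

lemma degree_mapDomain (h : κ → κ') (d : κ →₀ ℕ) : (d.mapDomain h).degree = d.degree := by
  induction d using Finsupp.induction_linear with
  | zero => simp
  | add f g hf hg => simp [Finsupp.mapDomain_add, hf, hg]
  | single a b => simp [Finsupp.mapDomain_single]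

end Content

lemma schur_apply (l : YoungDiagram) (d : ℕ →₀ ℕ) :
    schur l d = ({T : SemistandardYoungTableau l | content l (fun c => T c.1 c.2) = d}.ncard : ℤ) := by
  rw [schur, ← Nat.card_coe_set_eq]
  have : ∀ T : SemistandardYoungTableau l, (∀ k : ℕ, (l.cells.filter fun c => T c.1 c.2 = k).card = d k)
      ↔ content l (fun c => T c.1 c.2) = d := by
    intro T
    simp only [DFunLike.ext_iff, content_apply]
  simp only [this]
  rfl

namespace Bitableau

variable {l : YoungDiagram}

/-- The content of a bitableau. -/
abbrev entryContent (T : Bitableau l) : ℕ ×ₗ ℕ →₀ ℕ := content l fun c => T.entry c.1 c.2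

lemma mapDomain_top (T : Bitableau l) :
    T.entryContent.mapDomain (fun x => (ofLex x).1) = content l T.top := mapDomain_content _ _ _

lemma mapDomain_bot (T : Bitableau l) :
    T.entryContent.mapDomain (fun x => (ofLex x).2) = content l T.bot := mapDomain_content _ _ _

lemma forall_aWeight_iff {T : Bitableau l} {α : ℕ →₀ ℕ} :
    (∀ k, T.aWeight k = α k) ↔ content l T.top = α := by
  simp only [DFunLike.ext_iff, content_apply, aWeight]

lemma forall_bWeight_iff {T : Bitableau l} {β : ℕ →₀ ℕ} :
    (∀ k, T.bWeight k = β k) ↔ content l T.bot = β := by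
  simp only [DFunLike.ext_iff, content_apply, bWeight]

/-- The entries of a bitableau of given content may be replaced by natural numbers in the same
order, which turns it into a semistandard tableau. -/
lemma ncard_entryContent_eq (l : YoungDiagram) (D : ℕ ×ₗ ℕ →₀ ℕ) {g : ℕ ×ₗ ℕ → ℕ}
    (hg : StrictMonoOn g D.support) :
    ({T : Bitableau l | T.entryContent = D}.ncard : ℤ) = schur l (D.mapDomain g) := by
  classical
  rw [schur_apply, Nat.cast_inj]
  have hmem : ∀ T : Bitableau l, T.entryContent = D → ∀ {i j}, (i, j) ∈ l →
      T.entry i j ∈ (D.support : Set (ℕ ×ₗ ℕ)) := by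
    rintro T rfl i j hm
    exact mem_support_content (fun c => T.entry c.1 c.2) hm
  let F : ∀ T ∈ {T : Bitableau l | T.entryContent = D}, SemistandardYoungTableau l := fun T hT =>
    { entry := fun i j => if (i, j) ∈ l then g (T.entry i j) else 0
      row_weak' := fun {i j₁ j₂} h hm => by
        have hm1 := l.up_left_mem le_rfl h.le hm
        rw [if_pos hm, if_pos hm1]
        exact (hg.le_iff_le (hmem T hT hm1) (hmem T hT hm)).2 (T.row_weak h hm)
      col_strict' := fun {i₁ i₂ j} h hm => by
        have hm1 := l.up_left_mem h.le le_rfl hm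
        rw [if_pos hm, if_pos hm1]
        exact (hg.lt_iff_lt (hmem T hT hm1) (hmem T hT hm)).2 (T.col_strict h hm)
      zeros' := fun h => if_neg h }
  have hF : ∀ T hT i j, F T hT i j = if (i, j) ∈ l then g (T.entry i j) else 0 :=
    fun T hT i j => rfl
  refine Set.ncard_congr F ?_ ?_ ?_
  · intro T hT
    change content l _ = _
    have hT' : T.entryContent = D := hT
    rw [← hT', mapDomain_content]
    exact content_congr fun c hc => (hF T hT c.1 c.2).trans (if_pos hc)
  · intro T S hT hS h
    refine Bitableau.ext (funext fun i => funext fun j => ?_)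
    by_cases hm : (i, j) ∈ l
    · have h1 := DFunLike.congr_fun h i
      have h2 := congrFun h1 j
      rw [hF T hT, hF S hS, if_pos hm, if_pos hm] at h2
      exact hg.injOn (hmem T hT hm) (hmem S hS hm) h2
    · rw [T.zeros hm, S.zeros hm]
  · intro S hS
    have hS' : content l (fun c => S c.1 c.2) = D.mapDomain g := hS
    let h := Function.invFunOn g (D.support : Set (ℕ ×ₗ ℕ))
    have hex : ∀ {i j}, (i, j) ∈ l → ∃ x ∈ (D.support : Set (ℕ ×ₗ ℕ)), g x = S i j := by
      intro i j hm
      have h1 := mem_support_content (fun c => S c.1 c.2) hm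
      rw [hS'] at h1
      have h2 := Finsupp.mapDomain_support h1
      simpa using h2
    have h1 : ∀ {i j}, (i, j) ∈ l → h (S i j) ∈ (D.support : Set (ℕ ×ₗ ℕ)) :=
      fun hm => Function.invFunOn_mem (hex hm)
    have h2 : ∀ {i j}, (i, j) ∈ l → g (h (S i j)) = S i j := fun hm => Function.invFunOn_eq (hex hm)
    let T : Bitableau l :=
      { entry := fun i j => if (i, j) ∈ l then h (S i j) else toLex (0, 0)
        row_weak := fun {i j₁ j₂} hj hm => by
          have hm1 := l.up_left_mem le_rfl hj.le hm
          rw [if_pos hm, if_pos hm1, ← hg.le_iff_le (h1 hm1) (h1 hm), h2 hm, h2 hm1]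
          exact S.row_weak hj hm
        col_strict := fun {i₁ i₂ j} hi hm => by
          have hm1 := l.up_left_mem hi.le le_rfl hm
          rw [if_pos hm, if_pos hm1, ← hg.lt_iff_lt (h1 hm1) (h1 hm), h2 hm, h2 hm1]
          exact S.col_strict hi hm
        zeros := fun hm => if_neg hm }
    have hT : ∀ i j, T.entry i j = if (i, j) ∈ l then h (S i j) else toLex (0, 0) :=
      fun i j => rfl
    have hTD : T.entryContent = D := by
      have e1 : T.entryContent = content l fun c => h (S c.1 c.2) :=
        content_congr fun c hc => (hT c.1 c.2).trans (if_pos hc)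
      rw [e1, ← mapDomain_content l (fun c => S c.1 c.2) h, hS', ← Finsupp.mapDomain_comp]
      conv_rhs => rw [← Finsupp.mapDomain_id (v := D)]
      exact Finsupp.mapDomain_congr fun x hx => hg.injOn.leftInvOn_invFunOn hx
    refine ⟨T, hTD, ?_⟩
    ext i j
    rw [hF T hTD, hT]
    by_cases hm : (i, j) ∈ l
    · rw [if_pos hm, if_pos hm, h2 hm]
    · rw [if_neg hm, S.zeros hm]

lemma _root_.Finsupp.exists_forall_le_eq_zero (d : ℕ →₀ ℕ) : ∃ m, ∀ k, m ≤ k → d k = 0 := by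
  refine ⟨d.support.sup id + 1, fun k hk => ?_⟩
  by_contra h
  have := Finset.le_sup (f := id) (Finsupp.mem_support_iff.2 h)
  simp only [id] at this
  omega

lemma finite_aWeight_bWeight (l : YoungDiagram) (α β : ℕ →₀ ℕ) :
    {T : Bitableau l | (∀ k, T.aWeight k = α k) ∧ ∀ k, T.bWeight k = β k}.Finite := by
  obtain ⟨n, hn⟩ := α.exists_forall_le_eq_zero
  obtain ⟨m, hm⟩ := β.exists_forall_le_eq_zero
  refine (finite_weights l n m).subset fun T hT => ⟨fun k hk => ?_, fun k hk => ?_⟩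
  · rw [hT.1, hn k hk]
  · rw [hT.2, hm k hk]

lemma finite_top_zero (l : YoungDiagram) (β : ℕ →₀ ℕ) :
    {T : Bitableau l | T ∈ {T : Bitableau l | T.top = 0} ∧ ∀ k, T.bWeight k = β k}.Finite := by
  obtain ⟨m, hm⟩ := β.exists_forall_le_eq_zero
  refine (finite_weights l 1 m).subset fun T hT => ⟨fun k hk => ?_, fun k hk => ?_⟩
  · rw [aWeight_eq_zero_iff]
    intro c _ h
    have h0 : T.top = 0 := hT.1
    rw [h0, Pi.zero_apply] at h
    omega
  · rw [hT.2, hm k hk]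

end Bitableau

open Bitableau

/-- Semistandard tableaux are the bitableaux all of whose top entries are zero. -/
lemma schur_eq_character (l : YoungDiagram) :
    schur l = character {T : Bitableau l | T.top = 0} := by
  classical
  funext d
  let z : ℕ → ℕ ×ₗ ℕ := fun b => toLex (0, b)
  have hz : ((d.mapDomain z).mapDomain fun x => (ofLex x).2) = d := by
    rw [← Finsupp.mapDomain_comp]
    exact Finsupp.mapDomain_id
  have hsupp : ∀ x ∈ (d.mapDomain z).support, (ofLex x).1 = 0 := by
    intro x hx
    have := Finsupp.mapDomain_support hx
    obtain ⟨b, -, rfl⟩ := Finset.mem_image.1 this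
    rfl
  have hg : StrictMonoOn (fun x : ℕ ×ₗ ℕ => (ofLex x).2) (d.mapDomain z).support := by
    intro x hx y hy h
    have h1 := hsupp x hx
    have h2 := hsupp y hy
    rw [Prod.Lex.lt_iff] at h
    dsimp only
    omega
  have h1 := ncard_entryContent_eq l (d.mapDomain z) hg
  rw [hz] at h1
  rw [← h1, character]
  congr 2
  ext T
  simp only [Set.mem_ofPred_eq, forall_bWeight_iff]
  constructor
  · intro h
    constructor
    · funext c
      by_cases hc : c ∈ l
      · exact hsupp _ (h ▸ mem_support_content (fun c => T.entry c.1 c.2) hc)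
      · exact T.top_eq_zero hc
    · rw [← mapDomain_bot, h, hz]
  · rintro ⟨h, h'⟩
    rw [← h', mapDomain_content]
    refine content_congr fun c _ => ?_
    have h2 : T.top c = 0 := congrFun h c
    rw [T.entry_eq]
    change toLex (T.top c, T.bot c) = toLex (0, T.bot c)
    rw [h2]

/-! ### Symmetry -/

/-- The crystal symmetry: the character of a set of bitableaux described by a property of the top
entries is invariant under adjacent transpositions of the variables. -/
lemma character_mapDomain_swap {l : YoungDiagram} {X : Set (Bitableau l)}
    (hX : ∀ T S : Bitableau l, S.top = T.top → T ∈ X → S ∈ X)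
    (hfin : ∀ d : ℕ →₀ ℕ, {T | T ∈ X ∧ ∀ k, T.bWeight k = d k}.Finite) (i : ℕ) (d : ℕ →₀ ℕ) :
    character X (d.mapDomain (Equiv.swap i (i + 1))) = character X d := by
  have hs : StringClosed X i 0 :=
    { finite := finite_wt_of_finite hfin
      lower := fun T hT S hS => hX T S hS.1 hT
      raise := fun T hT S _ hS => hX T S hS.1 hT
      le_eps := fun _ _ => Nat.zero_le _ }
  have key : ∀ d : ℕ →₀ ℕ, {T | T ∈ X ∧ ∀ k, T.bWeight k = d k} =
      {T | T ∈ X ∧ T.wt = fun k => (d k : ℤ)} := by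
    intro d
    ext T
    simp [wt, funext_iff]
  rw [character, character, key, key, ← hs.ncard_reflect fun k => (d k : ℤ)]
  congr 4
  ext T
  have : (fun k => (((d.mapDomain (Equiv.swap i (i + 1))) k : ℕ) : ℤ)) =
      reflect i 0 fun k => (d k : ℤ) := by
    funext k
    simp [reflect, Finsupp.mapDomain_equiv_apply]
  rw [this]

lemma eq_mapDomain_swap {f : MvPowerSeries ℕ ℤ}
    (hf : ∀ i d, f (d.mapDomain (Equiv.swap i (i + 1))) = f d) (x y : ℕ) (d : ℕ →₀ ℕ) :
    f (d.mapDomain (Equiv.swap x y)) = f d := by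
  have key : ∀ n x d, f (d.mapDomain (Equiv.swap x (x + n + 1))) = f d := by
    intro n
    induction n with
    | zero => exact hf
    | succ n ih =>
      intro x d
      have h1 : Equiv.swap x (x + (n + 1) + 1) = Equiv.swap (x + n + 1) (x + n + 1 + 1) *
          Equiv.swap x (x + n + 1) * Equiv.swap (x + n + 1) (x + n + 1 + 1) := by
        rw [Equiv.swap_mul_swap_mul_swap (by omega) (by omega), Equiv.swap_comm]
        rfl
      rw [h1, Equiv.Perm.coe_mul, Finsupp.mapDomain_comp, Equiv.Perm.coe_mul,
        Finsupp.mapDomain_comp, hf, ih, hf]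
  rcases lt_trichotomy x y with h | rfl | h
  · obtain ⟨n, rfl⟩ := Nat.exists_eq_add_of_lt h
    exact key n x d
  · rw [Equiv.swap_self, Equiv.coe_refl, Finsupp.mapDomain_id]
  · obtain ⟨n, rfl⟩ := Nat.exists_eq_add_of_lt h
    rw [Equiv.swap_comm]
    exact key n y d

/-- The coefficients of a symmetric function do not depend on the names of the variables. -/
lemma eq_mapDomain_of_injOn {κ : Type*} {f : MvPowerSeries ℕ ℤ}
    (hf : ∀ i d, f (d.mapDomain (Equiv.swap i (i + 1))) = f d) (D : κ →₀ ℕ) {g g' : κ → ℕ}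
    (hg : Set.InjOn g D.support) (hg' : Set.InjOn g' D.support) :
    f (D.mapDomain g) = f (D.mapDomain g') := by
  classical
  have key : ∀ S : Finset κ, S ⊆ D.support →
      ∃ q : Equiv.Perm ℕ, (∀ s ∈ S, q (g s) = g' s) ∧ ∀ d, f (d.mapDomain q) = f d := by
    intro S
    induction S using Finset.induction_on with
    | empty => exact fun _ => ⟨1, by simp, fun d => by simp [Finsupp.mapDomain_id]⟩
    | insert x S hx ih =>
      intro hS
      obtain ⟨q, h1, h2⟩ := ih fun s hs => hS (Finset.mem_insert_of_mem hs)
      refine ⟨Equiv.swap (q (g x)) (g' x) * q, fun s hs => ?_, fun d => ?_⟩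
      · rcases Finset.mem_insert.1 hs with rfl | hs'
        · simp
        · have hne : s ≠ x := fun e => hx (e ▸ hs')
          rw [Equiv.Perm.mul_apply, h1 s hs', Equiv.swap_apply_of_ne_of_ne]
          · rw [← h1 s hs']
            exact fun e => hne (hg (hS hs) (hS (Finset.mem_insert_self _ _)) (q.injective e))
          · exact fun e => hne (hg' (hS hs) (hS (Finset.mem_insert_self _ _)) e)
      · rw [Equiv.Perm.coe_mul, Finsupp.mapDomain_comp, eq_mapDomain_swap hf, h2]
  obtain ⟨q, h1, h2⟩ := key D.support subset_rfl
  rw [← h2, ← Finsupp.mapDomain_comp]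
  congr 1
  exact Finsupp.mapDomain_congr fun x hx => h1 x hx

lemma mem_symmetricFunctions_of_swap {f : MvPowerSeries ℕ ℤ}
    (hf : ∀ i d, f (d.mapDomain (Equiv.swap i (i + 1))) = f d)
    {N : ℕ} (hN : ∀ d : ℕ →₀ ℕ, N < d.degree → f d = 0) : f ∈ symmetricFunctions := by
  refine ⟨⟨N, hN⟩, fun p d => ?_⟩
  have := eq_mapDomain_of_injOn hf d p.injective.injOn Function.injective_id.injOn
  rwa [Finsupp.mapDomain_id] at this

lemma swap_of_mem_symmetricFunctions {f : MvPowerSeries ℕ ℤ} (hf : f ∈ symmetricFunctions)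
    (i : ℕ) (d : ℕ →₀ ℕ) : f (d.mapDomain (Equiv.swap i (i + 1))) = f d :=
  hf.2 _ d

lemma schur_eq_zero {l : YoungDiagram} {d : ℕ →₀ ℕ} (h : d.degree ≠ l.card) : schur l d = 0 := by
  rw [schur_apply]
  have : {T : SemistandardYoungTableau l | content l (fun c => T c.1 c.2) = d} = ∅ := by
    refine Set.eq_empty_of_forall_notMem ?_
    rintro T rfl
    exact h (degree_content _ _)
  rw [this]; simp

lemma top_zero_closed {l : YoungDiagram} : ∀ T S : Bitableau l, S.top = T.top →
    T ∈ {T : Bitableau l | T.top = 0} → S ∈ {T : Bitableau l | T.top = 0} :=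
  fun _ _ h h' => h.trans h'

lemma schur_mem_symmetricFunctions (l : YoungDiagram) : schur l ∈ symmetricFunctions := by
  refine mem_symmetricFunctions_of_swap (N := l.card) ?_ fun d hd => schur_eq_zero (by omega)
  rw [schur_eq_character]
  exact character_mapDomain_swap top_zero_closed (finite_top_zero l)

/-! ### Orthonormality of the Schur functions -/

lemma _root_.YoungDiagram.ext_rowLen {μ ν : YoungDiagram} (h : ∀ k, μ.rowLen k = ν.rowLen k) :
    μ = ν := by
  ext ⟨i, j⟩
  rw [YoungDiagram.mem_cells, YoungDiagram.mem_cells, YoungDiagram.mem_iff_lt_rowLen,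
    YoungDiagram.mem_iff_lt_rowLen, h]

lemma Bitableau.cellHeight_nonpos {l : YoungDiagram} {T : Bitableau l} {i : ℕ} {P : ℕ × ℕ → Prop}
    {f : ℕ × ℕ → ℕ × ℕ}
    (hf : ∀ c ∈ l, P c → T.bot c = i + 1 → f c ∈ l ∧ P (f c) ∧ T.bot (f c) = i)
    (hinj : ∀ c c', c ∈ l → c' ∈ l → P c → P c' → T.bot c = i + 1 → T.bot c' = i + 1 →
      f c = f c' → c = c') : T.cellHeight i P ≤ 0 := by
  classical
  rw [cellHeight, sub_nonpos, Nat.cast_le]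
  refine Finset.card_le_card_of_injOn f (fun c hc => ?_) fun c hc c' hc' e => ?_
  · obtain ⟨h1, h2, h3⟩ := Finset.mem_filter.1 hc
    exact Finset.mem_filter.2 (hf c h1 h2 h3)
  · obtain ⟨h1, h2, h3⟩ := Finset.mem_filter.1 hc
    obtain ⟨h1', h2', h3'⟩ := Finset.mem_filter.1 hc'
    exact hinj c c' h1 h1' h2 h2' h3 h3' e

/-- In a Yamanouchi semistandard tableau, all entries of row `r` are equal to `r`. -/
lemma Bitableau.bot_eq_of_isYamanouchi {l : YoungDiagram} {T : Bitableau l} (ht : T.top = 0)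
    (hT : IsYamanouchi T.word) : ∀ r j, (r, j) ∈ l → T.bot (r, j) = r := by
  classical
  have ht' : ∀ c, T.top c = 0 := fun c => congrFun ht c
  intro r
  induction r using Nat.strong_induction_on with
  | _ r ih =>
  intro j hj
  have hge : r ≤ T.bot (r, j) := by
    rcases Nat.eq_zero_or_pos r with h | h
    · omega
    · have h1 := T.col_lt (show r - 1 < r by omega) hj
      have h2 := ih (r - 1) (by omega) j (l.up_left_mem (by omega) le_rfl hj)
      simp only [ht'] at h1
      omega
  refine le_antisymm ?_ hge
  -- the last cell of row `r` comes before the rows above only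
  have hlast : (r, l.rowLen r - 1) ∈ l := by
    rw [YoungDiagram.mem_iff_lt_rowLen] at hj ⊢
    omega
  have hle : T.bot (r, j) ≤ T.bot (r, l.rowLen r - 1) := by
    rw [YoungDiagram.mem_iff_lt_rowLen] at hj
    have := T.row_le (show j ≤ l.rowLen r - 1 by omega) hlast
    simp only [ht'] at this
    omega
  by_contra! hlt
  set x := T.bot (r, l.rowLen r - 1) with hx
  have h1 := T.isYamanouchi_word_iff.1 hT _ (T.initial_readBefore (r, l.rowLen r - 1)) (x - 1)
  have hrow : ∀ c ∈ l, ¬ T.ReadBefore c (r, l.rowLen r - 1) → c.1 < r ∨ c = (r, l.rowLen r - 1) := by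
    rintro ⟨r', j'⟩ hc h
    rw [YoungDiagram.mem_iff_lt_rowLen] at hc
    simp only [ReadBefore, ht', true_and, lt_self_iff_false, false_or] at h
    by_cases e : r' = r
    · subst e
      right
      rw [Prod.mk.injEq]
      omega
    · left
      simp only
      omega
  have h2 : (l.cells.filter fun c => ¬ T.ReadBefore c (r, l.rowLen r - 1) ∧
      T.bot c = x - 1).card = 0 := by
    rw [Finset.card_eq_zero, Finset.filter_eq_empty_iff]
    rintro c hc ⟨h3, h4⟩
    rcases hrow c hc h3 with h5 | h5
    · have := ih c.1 h5 c.2 hc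
      rw [Prod.mk.eta] at this
      omega
    · rw [h5] at h4
      omega
  have h3 : 0 < (l.cells.filter fun c => ¬ T.ReadBefore c (r, l.rowLen r - 1) ∧
      T.bot c = x - 1 + 1).card := by
    rw [Finset.card_pos]
    exact ⟨(r, l.rowLen r - 1), Finset.mem_filter.2 ⟨hlast, T.not_readBefore_self _, by omega⟩⟩
  simp only [cellHeight] at h1
  omega

/-- The bitableau with entries `(0, r)` in row `r`. -/
def highestWeightBitableau (l : YoungDiagram) : Bitableau l :=
  ofTopBot l 0 Prod.fst (by simp) (fun i₁ i₂ j h _ => Or.inr ⟨rfl, h⟩)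

lemma top_highestWeightBitableau (l : YoungDiagram) : (highestWeightBitableau l).top = 0 := by
  funext c
  by_cases hc : c ∈ l
  · exact top_ofTopBot _ _ hc
  · exact top_eq_zero _ hc

lemma isYamanouchi_highestWeightBitableau (l : YoungDiagram) :
    IsYamanouchi (highestWeightBitableau l).word := by
  have hb : ∀ c ∈ l, (highestWeightBitableau l).bot c = c.1 := fun c hc => bot_ofTopBot _ _ hc
  rw [isYamanouchi_word_iff]
  intro P hP i
  refine cellHeight_nonpos (f := fun c => (c.1 - 1, c.2)) ?_ ?_
  · rintro ⟨r, j⟩ h1 h2 h3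
    rw [hb _ h1] at h3
    dsimp only at h3
    subst h3
    have hm := l.up_left_mem (by omega : i ≤ i + 1) le_rfl h1
    refine ⟨hm, fun h => h2 (hP _ h1 _ hm ?_ h), hb _ hm⟩
    simp [ReadBefore, top_highestWeightBitableau]
  · rintro ⟨r, j⟩ ⟨r', j'⟩ h1 h1' - - h3 h3' e
    rw [hb _ h1] at h3
    rw [hb _ h1'] at h3'
    simp only [Prod.mk.injEq] at *
    omega

lemma bWeight_eq_rowLen {l : YoungDiagram} {T : Bitableau l} (h : ∀ c ∈ l, T.bot c = c.1) (k : ℕ) :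
    T.bWeight k = l.rowLen k := by
  rw [bWeight, YoungDiagram.rowLen_eq_card, YoungDiagram.row]
  congr 1
  exact Finset.filter_congr fun c hc => by rw [h c hc]

open Classical in
theorem schurExtract_schur (ν l : YoungDiagram) :
    schurExtract ν (schur l) = if l = ν then 1 else 0 := by
  rw [schur_eq_character, schurExtract_character_eq ν top_zero_closed (finite_top_zero l)]
  have hmem : ∀ T ∈ {T : Bitableau l | T ∈ {T : Bitableau l | T.top = 0} ∧ IsYamanouchi T.word ∧
      ∀ k, T.bWeight k = ν.rowLen k}, l = ν ∧ T = highestWeightBitableau l := by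
    rintro T ⟨h1, h2, h3⟩
    have hb := bot_eq_of_isYamanouchi h1 h2
    refine ⟨YoungDiagram.ext_rowLen fun k => ?_, ext_top_bot fun c hc => ⟨?_, ?_⟩⟩
    · rw [← h3 k, bWeight_eq_rowLen fun c hc => hb c.1 c.2 hc]
    · rw [show T.top = 0 from h1, top_highestWeightBitableau]
    · exact (hb c.1 c.2 hc).trans (bot_ofTopBot _ _ hc).symm
  split_ifs with h
  · subst h
    rw [Nat.cast_eq_one, Set.ncard_eq_one]
    refine ⟨highestWeightBitableau l, Set.Subset.antisymm (fun T hT => (hmem T hT).2) ?_⟩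
    rintro T rfl
    exact ⟨top_highestWeightBitableau l, isYamanouchi_highestWeightBitableau l,
      bWeight_eq_rowLen fun c hc => bot_ofTopBot _ _ hc⟩
  · rw [Set.eq_empty_of_forall_notMem fun T hT => h (hmem T hT).1]
    simp

/-! ### Monomials and partitions -/

/-- A partition as the exponent of a monomial. -/
def rowExp (ν : YoungDiagram) : ℕ →₀ ℕ :=
  Finsupp.onFinset (Finset.range (ν.colLen 0)) ν.rowLen fun k hk => by
    by_contra h
    exact hk (rowLen_eq_zero (by simpa using h))

@[simp] lemma rowExp_apply (ν : YoungDiagram) (k : ℕ) : rowExp ν k = ν.rowLen k := rfl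

lemma rowLen_pos_iff {ν : YoungDiagram} {k : ℕ} : 0 < ν.rowLen k ↔ k < ν.colLen 0 := by
  rw [← YoungDiagram.mem_iff_lt_rowLen, YoungDiagram.mem_iff_lt_colLen]

lemma support_rowExp (ν : YoungDiagram) : (rowExp ν).support = Finset.range (ν.colLen 0) := by
  ext k
  rw [Finsupp.mem_support_iff, rowExp_apply, Finset.mem_range, ← rowLen_pos_iff, Nat.pos_iff_ne_zero]

lemma map_rowExp (ν : YoungDiagram) :
    (rowExp ν).support.val.map (rowExp ν) = (ν.rowLens : Multiset ℕ) := by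
  rw [support_rowExp]
  rfl

lemma degree_rowExp (ν : YoungDiagram) : (rowExp ν).degree = ν.card := by
  have : rowExp ν = content ν Prod.fst := by
    ext k
    rw [content_apply, rowExp_apply, YoungDiagram.rowLen_eq_card]
    rfl
  rw [this, degree_content]

lemma exists_rowLens_eq (d : ℕ →₀ ℕ) :
    ∃ ν : YoungDiagram, d.support.val.map d = (ν.rowLens : Multiset ℕ) := by
  let L := (d.support.val.map d).sort (· ≥ ·)
  have hL : L.SortedGE := (Multiset.pairwise_sort _ _).sortedGE
  refine ⟨YoungDiagram.ofRowLens L hL, ?_⟩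
  rw [YoungDiagram.rowLens_ofRowLens_eq_self]
  · exact (Multiset.sort_eq _ _).symm
  · intro x hx
    rw [Multiset.mem_sort, Multiset.mem_map] at hx
    obtain ⟨k, hk, rfl⟩ := hx
    exact Nat.pos_of_ne_zero (Finsupp.mem_support_iff.1 hk)

lemma _root_.Multiset.exists_list_of_map_eq {α β : Type*} {f : α → β} {L : List β} :
    ∀ {m : Multiset α}, m.map f = (L : Multiset β) → ∃ s : List α, (s : Multiset α) = m ∧ s.map f = L := by
  classical
  induction L with
  | nil => exact fun {m} h => ⟨[], by simpa [eq_comm] using h, rfl⟩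
  | cons b L ih =>
    intro m h
    rw [← Multiset.cons_coe, ← Multiset.map_eq_cons] at h
    obtain ⟨a, ha, rfl, h⟩ := h
    obtain ⟨s, hs, rfl⟩ := ih h
    exact ⟨a :: s, by rw [← Multiset.cons_coe, hs, Multiset.cons_erase ha], rfl⟩

/-- Two monomials with the same exponents in some order are relabelings of the same monomial. -/
lemma exists_eq_mapDomain_of_map_eq {d : ℕ →₀ ℕ} {L : List ℕ}
    (h : d.support.val.map d = (L : Multiset ℕ)) : ∃ g : Fin L.length → ℕ, Function.Injective g ∧
      d = (Finsupp.equivFunOnFinite.symm L.get).mapDomain g := by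
  obtain ⟨s, hs, rfl⟩ := Multiset.exists_list_of_map_eq h
  have hnd : s.Nodup := by
    rw [← Multiset.coe_nodup, hs]
    exact d.support.nodup
  have hmem : ∀ k, k ∈ s ↔ d k ≠ 0 := fun k => by
    rw [← Multiset.mem_coe, hs, Finset.mem_val, Finsupp.mem_support_iff]
  have hg : Function.Injective fun i : Fin (s.map d).length => s.get (i.cast (by simp)) :=
    (List.nodup_iff_injective_get.1 hnd).comp (Fin.cast_injective _)
  refine ⟨_, hg, ?_⟩
  ext k
  by_cases hk : k ∈ s
  · obtain ⟨i, hi⟩ := List.get_of_mem hk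
    have : k = s.get ((i.cast (by simp) : Fin (s.map d).length).cast (by simp)) := by
      rw [← hi]; rfl
    rw [this, Finsupp.mapDomain_apply hg]
    simp
  · rw [Finsupp.mapDomain_of_notMem_range]
    · by_contra h0
      exact hk ((hmem k).2 h0)
    · rintro ⟨i, rfl⟩
      exact hk (List.get_mem _ _)

lemma eq_of_map_eq {f : MvPowerSeries ℕ ℤ}
    (hf : ∀ i d, f (d.mapDomain (Equiv.swap i (i + 1))) = f d) {d d' : ℕ →₀ ℕ}
    (h : d.support.val.map d = d'.support.val.map d') : f d = f d' := by
  obtain ⟨L, hL⟩ := Quot.exists_rep (d'.support.val.map d')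
  replace hL : (L : Multiset ℕ) = d'.support.val.map d' := hL
  obtain ⟨g, hg, hd⟩ := exists_eq_mapDomain_of_map_eq (h.trans hL.symm)
  obtain ⟨g', hg', hd'⟩ := exists_eq_mapDomain_of_map_eq hL.symm
  rw [hd, hd']
  exact eq_mapDomain_of_injOn hf _ hg.injOn hg'.injOn

/-! ### The Schur functions form a basis -/

/-- The sum of the squares of the exponents of a monomial. -/
def sumSq (d : ℕ →₀ ℕ) : ℕ := ∑ k ∈ d.support, d k ^ 2

lemma sumSq_congr {d d' : ℕ →₀ ℕ} (h : d.support.val.map d = d'.support.val.map d') :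
    sumSq d = sumSq d' := by
  have key : ∀ d : ℕ →₀ ℕ, sumSq d = ((d.support.val.map d).map (· ^ 2)).sum := fun d => by
    rw [Multiset.map_map]; rfl
  rw [key, key, h]

lemma sumSq_le (d : ℕ →₀ ℕ) : sumSq d ≤ d.degree ^ 2 := by
  rw [sumSq, Finsupp.degree_apply, sq, Finset.sum_mul]
  refine Finset.sum_le_sum fun k hk => ?_
  rw [sq]
  exact Nat.mul_le_mul_left _ (Finset.single_le_sum (f := d) (fun _ _ => Nat.zero_le _) hk)

lemma sumSq_eq_of_subset {d : ℕ →₀ ℕ} {s : Finset ℕ} (h : d.support ⊆ s) :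
    sumSq d = ∑ k ∈ s, d k ^ 2 :=
  Finset.sum_subset h fun k _ hk => by rw [Finsupp.notMem_support_iff.1 hk]; rfl

lemma support_dotExp_subset (ν : YoungDiagram) (w : RowPerm ν) :
    (dotExp ν w).support ⊆ Finset.range (ν.colLen 0) := Finsupp.support_onFinset_subset

lemma RowPerm.ext_lt {ν : YoungDiagram} (w : RowPerm ν) {k : ℕ} (h : k < ν.colLen 0) :
    RowPerm.ext w k < ν.colLen 0 := by
  have := (Equiv.Perm.ofSubtype_apply_coe w ⟨k, Finset.mem_range.2 h⟩)
  rw [RowPerm.ext, this]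
  exact Finset.mem_range.1 (w _).2

/-- The rearrangement inequality: `w(ν + δ) - δ` is longer than `ν`. -/
lemma sumSq_rowExp_lt {ν : YoungDiagram} {w : RowPerm ν} (hw : w ≠ 1)
    (h : ∀ k, 0 ≤ dotWeight ν (RowPerm.ext w) k) : sumSq (rowExp ν) < sumSq (dotExp ν w) := by
  let U : Finset.range (ν.colLen 0) → ℤ := fun k => (ν.rowLen k : ℤ) - (k : ℕ)
  let V : Finset.range (ν.colLen 0) → ℤ := fun k => (k : ℕ)
  have hV : ∀ a b, V a < V b ↔ a < b := fun a b => by simp [V]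
  have hUs : StrictAnti U := fun a b hab => rowLen_sub_strictAnti ν hab
  have hU : Antivary U V := fun a b hab => (hUs ((hV a b).1 hab)).le
  have hlt : ∑ k, U k * V k < ∑ k, U (w k) * V k := by
    rw [hU.sum_mul_lt_sum_comp_perm_mul_iff]
    intro hA
    refine hw (w.eq_one_of_strictAnti fun a b hab => ?_)
    simp only [dotWeight, add_sub_cancel_right]
    refine rowLen_sub_strictAnti ν ?_
    rcases lt_or_ge b (ν.colLen 0) with hb | hb
    · have ha : a < ν.colLen 0 := hab.trans hb
      let a' : Finset.range (ν.colLen 0) := ⟨a, Finset.mem_range.2 ha⟩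
      let b' : Finset.range (ν.colLen 0) := ⟨b, Finset.mem_range.2 hb⟩
      have h1 : a' < b' := hab
      have h2 : U (w b') ≤ U (w a') := hA ((hV _ _).2 h1)
      have h3 : w a' < w b' := lt_of_le_of_ne (hUs.le_iff_ge.1 h2) fun e => h1.ne (w.injective e)
      have e1 : RowPerm.ext w a = w a' := Equiv.Perm.ofSubtype_apply_coe w a'
      have e2 : RowPerm.ext w b = w b' := Equiv.Perm.ofSubtype_apply_coe w b'
      rw [e1, e2]
      exact h3
    · rw [w.ext_apply_of_le hb]
      rcases lt_or_ge a (ν.colLen 0) with ha | ha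
      · exact (w.ext_lt ha).trans_le hb
      · rwa [w.ext_apply_of_le ha]
  have e1 : (sumSq (rowExp ν) : ℤ) = ∑ k, (U k + V k) ^ 2 := by
    rw [sumSq_eq_of_subset (support_rowExp ν).subset, ← Finset.sum_coe_sort]
    push_cast
    refine Finset.sum_congr rfl fun k _ => ?_
    simp [U, V]
  have e2 : (sumSq (dotExp ν w) : ℤ) = ∑ k, (U (w k) + V k) ^ 2 := by
    rw [sumSq_eq_of_subset (support_dotExp_subset ν w), ← Finset.sum_coe_sort]
    push_cast
    refine Finset.sum_congr rfl fun k _ => ?_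
    have h1 : RowPerm.ext w k = w k := Equiv.Perm.ofSubtype_apply_coe w k
    rw [dotExp_apply, Int.toNat_of_nonneg (h _), dotWeight, h1]
  have e3 : ∑ k, U (w k) ^ 2 = ∑ k, U k ^ 2 := Equiv.sum_comp w fun k => U k ^ 2
  have e4 : (sumSq (rowExp ν) : ℤ) < sumSq (dotExp ν w) := by
    rw [e1, e2]
    simp only [add_sq, Finset.sum_add_distrib, mul_assoc, ← Finset.mul_sum]
    rw [e3]
    linarith
  exact_mod_cast e4

/-- A nonzero symmetric function has a nonzero Schur coefficient: it belongs to a monomial whose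
exponents are as unequal as possible. -/
lemma eq_zero_of_schurExtract {f : MvPowerSeries ℕ ℤ} (hf : f ∈ symmetricFunctions)
    (h : ∀ ν, schurExtract ν f = 0) : f = 0 := by
  classical
  by_contra h0
  have hswap := swap_of_mem_symmetricFunctions hf
  obtain ⟨⟨N, hN⟩, -⟩ := hf
  obtain ⟨d₁, hd₁⟩ : ∃ d, f d ≠ 0 := by
    by_contra! h1
    exact h0 (funext h1)
  let P : ℕ → Prop := fun n => ∃ d, f d ≠ 0 ∧ sumSq d = n
  have hle : ∀ d, f d ≠ 0 → sumSq d ≤ N ^ 2 := by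
    intro d hd
    refine (sumSq_le d).trans (Nat.pow_le_pow_left ?_ 2)
    by_contra! h1
    exact hd (hN d h1)
  obtain ⟨d, hd, hmax⟩ : P (Nat.findGreatest P (N ^ 2)) :=
    Nat.findGreatest_spec (P := P) (hle d₁ hd₁) ⟨d₁, hd₁, rfl⟩
  obtain ⟨ν, hν⟩ := exists_rowLens_eq d
  have hd' : d.support.val.map d = (rowExp ν).support.val.map (rowExp ν) := by
    rw [hν, map_rowExp]
  have h1 := h ν
  rw [schurExtract_apply, Finset.sum_eq_single 1] at h1
  · have h2 : dotExp ν 1 = rowExp ν := by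
      ext k
      simp [dotExp_apply, dotWeight]
    rw [if_pos (fun k => by simp [dotWeight]), h2, ← eq_of_map_eq hswap hd'] at h1
    simp at h1
    exact hd h1
  · intro w _ hw
    split_ifs with h2
    · by_contra h3
      have h4 : f (dotExp ν w) ≠ 0 := fun e => h3 (by rw [e, mul_zero])
      have h5 := Nat.le_findGreatest (P := P) (hle _ h4) ⟨_, h4, rfl⟩
      have h6 := sumSq_rowExp_lt hw h2
      rw [← sumSq_congr hd', hmax] at h6
      omega
    · rfl
  · simp

lemma degree_dotExp {ν : YoungDiagram} {w : RowPerm ν}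
    (h : ∀ k, 0 ≤ dotWeight ν (RowPerm.ext w) k) : (dotExp ν w).degree = ν.card := by
  have key : ∀ d : ℕ →₀ ℕ, d.support ⊆ Finset.range (ν.colLen 0) →
      d.degree = ∑ k : Finset.range (ν.colLen 0), d k := by
    intro d hd
    rw [Finsupp.degree_apply, Finset.sum_coe_sort (Finset.range (ν.colLen 0)) fun k => d k]
    exact Finset.sum_subset hd fun k _ hk => Finsupp.notMem_support_iff.1 hk
  rw [← degree_rowExp, key _ (support_dotExp_subset ν w), key _ (support_rowExp ν).subset]
  have e : ∀ k : Finset.range (ν.colLen 0), ((dotExp ν w k : ℕ) : ℤ) =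
      (ν.rowLen (w k) : ℤ) - ((w k : ℕ) : ℤ) + ((k : ℕ) : ℤ) := by
    intro k
    have h1 : RowPerm.ext w k = w k := Equiv.Perm.ofSubtype_apply_coe w k
    rw [dotExp_apply, Int.toNat_of_nonneg (h _), dotWeight, h1]
  have e2 : ∑ k : Finset.range (ν.colLen 0), ((dotExp ν w k : ℕ) : ℤ) =
      ∑ k : Finset.range (ν.colLen 0), (ν.rowLen k : ℤ) := by
    simp only [e, Finset.sum_add_distrib, Finset.sum_sub_distrib]
    rw [Equiv.sum_comp w fun k => (ν.rowLen k : ℤ),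
      Equiv.sum_comp w fun k : Finset.range (ν.colLen 0) => ((k : ℕ) : ℤ)]
    ring
  exact_mod_cast e2

/-- A Schur coefficient of a symmetric function involves monomials of the right degree only. -/
lemma schurExtract_congr {ν : YoungDiagram} {f g : MvPowerSeries ℕ ℤ}
    (h : ∀ d : ℕ →₀ ℕ, d.degree = ν.card → f d = g d) : schurExtract ν f = schurExtract ν g := by
  rw [schurExtract_apply, schurExtract_apply]
  refine Finset.sum_congr rfl fun w _ => ?_
  split_ifs with h1
  · rw [h _ (degree_dotExp h1)]
  · rfl

lemma finite_card_le (N : ℕ) : {ν : YoungDiagram | ν.card ≤ N}.Finite := by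
  have hinj : Function.Injective YoungDiagram.cells := fun μ ν h => YoungDiagram.ext h
  refine Set.Finite.of_finite_image (f := YoungDiagram.cells) ?_ hinj.injOn
  refine (Finset.finite_toSet (Finset.range N ×ˢ Finset.range N).powerset).subset ?_
  rintro _ ⟨ν, hν, rfl⟩
  rw [Finset.mem_coe, Finset.mem_powerset]
  rintro ⟨i, j⟩ hc
  rw [YoungDiagram.mem_cells] at hc
  have hν' : ν.cells.card ≤ N := hν
  have h1 : i < ν.colLen 0 := YoungDiagram.mem_iff_lt_colLen.1 (ν.up_left_mem le_rfl (Nat.zero_le j) hc)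
  have h2 : j < ν.rowLen 0 := YoungDiagram.mem_iff_lt_rowLen.1 (ν.up_left_mem (Nat.zero_le i) le_rfl hc)
  have h3 : ν.colLen 0 ≤ ν.cells.card := by
    rw [YoungDiagram.colLen_eq_card]; exact Finset.card_filter_le _ _
  have h4 : ν.rowLen 0 ≤ ν.cells.card := by
    rw [YoungDiagram.rowLen_eq_card]; exact Finset.card_filter_le _ _
  rw [Finset.mem_product, Finset.mem_range, Finset.mem_range]
  dsimp only
  omega

/-- The partitions of size at most `N`. -/
def partitionsLE (N : ℕ) : Finset YoungDiagram := (finite_card_le N).toFinset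

lemma mem_partitionsLE {N : ℕ} {ν : YoungDiagram} : ν ∈ partitionsLE N ↔ ν.card ≤ N := by
  simp [partitionsLE]

/-- The Schur expansion of a symmetric function. -/
lemma eq_sum_schurExtract {f : MvPowerSeries ℕ ℤ} (hf : f ∈ symmetricFunctions) {N : ℕ}
    (hN : ∀ d : ℕ →₀ ℕ, N < d.degree → f d = 0) :
    f = ∑ ν ∈ partitionsLE N, schurExtract ν f • schur ν := by
  classical
  rw [← sub_eq_zero]
  refine eq_zero_of_schurExtract (Submodule.sub_mem _ hf
    (Submodule.sum_mem _ fun ν _ => Submodule.smul_mem _ _ (schur_mem_symmetricFunctions ν))) ?_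
  intro μ
  rw [map_sub, map_sum, sub_eq_zero]
  simp only [map_smul, schurExtract_schur, smul_eq_mul, mul_ite, mul_one, mul_zero,
    Finset.sum_ite_eq']
  split_ifs with h
  · rfl
  · have h' : N < μ.card := by rwa [mem_partitionsLE, not_le] at h
    rw [schurExtract_congr (g := 0) fun d hd => hN d (by omega), map_zero]

lemma schurExtract_linearCombination (ν : YoungDiagram) (c : YoungDiagram →₀ ℤ) :
    schurExtract ν (Finsupp.linearCombination ℤ schur c) = c ν := by
  classical
  rw [Finsupp.linearCombination_apply, Finsupp.sum, map_sum]
  simp only [map_smul, schurExtract_schur, smul_eq_mul, mul_ite, mul_one, mul_zero,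
    Finset.sum_ite_eq']
  split_ifs with h
  · rfl
  · exact (Finsupp.notMem_support_iff.1 h).symm

theorem linearIndependent_schur : LinearIndependent ℤ schur := by
  rw [linearIndependent_iff]
  intro c hc
  ext ν
  rw [← schurExtract_linearCombination, hc, map_zero, Finsupp.zero_apply]

theorem span_schur : Submodule.span ℤ (Set.range schur) = symmetricFunctions := by
  refine le_antisymm (Submodule.span_le.2 ?_) fun f hf => ?_
  · rintro _ ⟨ν, rfl⟩
    exact schur_mem_symmetricFunctions ν
  · have hf' := hf
    obtain ⟨⟨N, hN⟩, -⟩ := hf'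
    rw [eq_sum_schurExtract hf hN]
    exact Submodule.sum_mem _ fun ν _ => Submodule.smul_mem _ _
      (Submodule.subset_span ⟨ν, rfl⟩)

lemma schurCoord_apply {f : MvPowerSeries ℕ ℤ} (hf : f ∈ symmetricFunctions) (ν : YoungDiagram) :
    schurCoord f ν = schurExtract ν f := by
  have h : ∃ c : YoungDiagram →₀ ℤ, Finsupp.linearCombination ℤ schur c = f := by
    rwa [← span_schur, ← Finsupp.range_linearCombination] at hf
  rw [schurCoord, dif_pos h, ← schurExtract_linearCombination, h.choose_spec]

/-- The Hall inner product with a Schur function is the extraction of a Schur coefficient. -/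
lemma hall_schur {f : MvPowerSeries ℕ ℤ} (hf : f ∈ symmetricFunctions) (ν : YoungDiagram) :
    hall (schur ν) f = schurExtract ν f := by
  classical
  have h : schurCoord (schur ν) = Finsupp.single ν 1 := by
    ext μ
    rw [schurCoord_apply (schur_mem_symmetricFunctions ν), schurExtract_schur,
      Finsupp.single_apply]
  rw [hall, h, Finsupp.sum_single_index (by simp), one_mul, schurCoord_apply hf]

/-! ### The coefficients of `f[xy]` -/

lemma mem_support_mapDomain {κ κ' : Type*} (h : κ → κ') {d : κ →₀ ℕ} {k : κ} (hk : k ∈ d.support) :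
    h k ∈ (d.mapDomain h).support := by
  classical
  rw [Finsupp.mem_support_iff] at hk ⊢
  rw [← Finsupp.single_add_erase k d, Finsupp.mapDomain_add, Finsupp.mapDomain_single,
    Finsupp.add_apply, Finsupp.single_eq_same]
  omega

lemma finite_of_mapDomain {κ κ₁ κ₂ : Type*} {p : κ → κ₁} {q : κ → κ₂}
    (hpq : Function.Injective fun k => (p k, q k)) (α : κ₁ →₀ ℕ) (β : κ₂ →₀ ℕ) :
    {d : κ →₀ ℕ | d.mapDomain p = α ∧ d.mapDomain q = β}.Finite := by
  classical
  let s : Finset κ := (α.support ×ˢ β.support).preimage (fun k => (p k, q k)) hpq.injOn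
  refine (Finset.finite_toSet (s.finsuppAntidiag α.degree)).subset ?_
  rintro d ⟨rfl, rfl⟩
  rw [Finset.mem_coe, Finset.mem_finsuppAntidiag]
  have hs : d.support ⊆ s := fun k hk => by
    rw [Finset.mem_preimage, Finset.mem_product]
    exact ⟨mem_support_mapDomain p hk, mem_support_mapDomain q hk⟩
  refine ⟨?_, hs⟩
  rw [degree_mapDomain, Finsupp.degree_apply]
  exact (Finset.sum_subset hs fun k _ hk => Finsupp.notMem_support_iff.1 hk).symm

/-- The row sums of the matrix that is encoded in a monomial along `Nat.unpair`. -/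
def rowSums (d : ℕ →₀ ℕ) : ℕ →₀ ℕ := d.mapDomain fun k => k.unpair.1

/-- The column sums of the matrix that is encoded in a monomial along `Nat.unpair`. -/
def colSums (d : ℕ →₀ ℕ) : ℕ →₀ ℕ := d.mapDomain fun k => k.unpair.2

/-- The matrices with given row sums and column sums. -/
def margins (α β : ℕ →₀ ℕ) : Finset (ℕ →₀ ℕ) :=
  (finite_of_mapDomain (p := fun k : ℕ => k.unpair.1) (q := fun k : ℕ => k.unpair.2)
    (fun _ _ h => Nat.pairEquiv.symm.injective h) α β).toFinset

lemma mem_margins {α β d : ℕ →₀ ℕ} : d ∈ margins α β ↔ rowSums d = α ∧ colSums d = β := by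
  simp [margins, rowSums, colSums]

lemma degree_of_mem_margins {α β d : ℕ →₀ ℕ} (h : d ∈ margins α β) :
    d.degree = α.degree ∧ d.degree = β.degree := by
  obtain ⟨rfl, rfl⟩ := mem_margins.1 h
  exact ⟨(degree_mapDomain _ d).symm, (degree_mapDomain _ d).symm⟩

lemma prod_xyFamily (d : ℕ →₀ ℕ) : (d.prod fun s e => xyFamily s ^ e) =
    MvPowerSeries.monomial (Finsupp.sumElim (rowSums d) (colSums d)) 1 := by
  induction d using Finsupp.induction_linear with
  | zero =>
    have : Finsupp.sumElim (0 : ℕ →₀ ℕ) (0 : ℕ →₀ ℕ) = 0 := by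
      ext (i | i) <;> rfl
    simp [rowSums, colSums, this]
  | add d d' h h' =>
    rw [Finsupp.prod_add_index' (by simp) (fun _ _ _ => pow_add _ _ _), h, h',
      MvPowerSeries.monomial_mul_monomial, one_mul]
    congr 1
    ext (i | i)
    all_goals simp [rowSums, colSums, Finsupp.mapDomain_add]
  | single k n =>
    rw [Finsupp.prod_single_index (h := fun s e => xyFamily s ^ e) (pow_zero _), xyFamily,
      mul_pow, MvPowerSeries.X_pow_eq, MvPowerSeries.X_pow_eq, MvPowerSeries.monomial_mul_monomial, one_mul]
    congr 1
    ext (i | i)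
    all_goals simp [rowSums, colSums, Finsupp.mapDomain_single]

lemma sumElim_eq_iff {α β α' β' : ℕ →₀ ℕ} :
    Finsupp.sumElim α β = Finsupp.sumElim α' β' ↔ α' = α ∧ β' = β := by
  constructor
  · intro h
    constructor
    · ext k; simpa using (DFunLike.congr_fun h (Sum.inl k)).symm
    · ext k; simpa using (DFunLike.congr_fun h (Sum.inr k)).symm
  · rintro ⟨rfl, rfl⟩; rfl

lemma xCoeff_kronCoproduct (f : MvPowerSeries ℕ ℤ) (α β : ℕ →₀ ℕ) :
    xCoeff α (kronCoproduct f) β = ∑ d ∈ margins α β, f d := by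
  classical
  rw [xCoeff, kronCoproduct, MvPowerSeries.coeff_subst hasSubst_xyFamily]
  have key : ∀ d : ℕ →₀ ℕ, MvPowerSeries.coeff d f • MvPowerSeries.coeff (Finsupp.sumElim α β)
      (d.prod fun s e => xyFamily s ^ e) = if d ∈ margins α β then f d else 0 := by
    intro d
    rw [prod_xyFamily, MvPowerSeries.coeff_monomial, smul_eq_mul]
    have : Finsupp.sumElim α β = Finsupp.sumElim (rowSums d) (colSums d) ↔ d ∈ margins α β := by
      rw [sumElim_eq_iff, mem_margins]
    by_cases hd : d ∈ margins α β
    · rw [if_pos (this.2 hd), if_pos hd, mul_one]; rfl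
    · rw [if_neg (fun h => hd (this.1 h)), if_neg hd, mul_zero]
  simp only [key]
  rw [finsum_eq_sum_of_support_subset (s := margins α β)]
  · exact Finset.sum_congr rfl fun d hd => if_pos hd
  · intro d hd
    by_contra h
    exact hd (if_neg h)

/-- The permutation of `ℕ` that corresponds to a permutation of the rows and a permutation of the
columns of a matrix. -/
def pairPerm (σ τ : Equiv.Perm ℕ) : Equiv.Perm ℕ :=
  (Nat.pairEquiv.symm.trans (Equiv.prodCongr σ τ)).trans Nat.pairEquiv

lemma pairPerm_apply (σ τ : Equiv.Perm ℕ) (k : ℕ) :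
    pairPerm σ τ k = Nat.pair (σ k.unpair.1) (τ k.unpair.2) := rfl

lemma rowSums_pairPerm (σ τ : Equiv.Perm ℕ) (d : ℕ →₀ ℕ) :
    rowSums (d.mapDomain (pairPerm σ τ)) = (rowSums d).mapDomain σ := by
  rw [rowSums, rowSums, ← Finsupp.mapDomain_comp, ← Finsupp.mapDomain_comp]
  congr 1
  funext k
  simp [pairPerm_apply]

lemma colSums_pairPerm (σ τ : Equiv.Perm ℕ) (d : ℕ →₀ ℕ) :
    colSums (d.mapDomain (pairPerm σ τ)) = (colSums d).mapDomain τ := by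
  rw [colSums, colSums, ← Finsupp.mapDomain_comp, ← Finsupp.mapDomain_comp]
  congr 1
  funext k
  simp [pairPerm_apply]

lemma mapDomain_equiv_injective {κ : Type*} (σ : Equiv.Perm κ) :
    Function.Injective (Finsupp.mapDomain (M := ℕ) σ) :=
  Finsupp.mapDomain_injective σ.injective

/-- The coefficients of `f[xy]` are symmetric in the variables `x` and in the variables `y`. -/
lemma xCoeff_kronCoproduct_perm {f : MvPowerSeries ℕ ℤ} (hf : f ∈ symmetricFunctions)
    (σ τ : Equiv.Perm ℕ) (α β : ℕ →₀ ℕ) :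
    xCoeff (α.mapDomain σ) (kronCoproduct f) (β.mapDomain τ) = xCoeff α (kronCoproduct f) β := by
  rw [xCoeff_kronCoproduct, xCoeff_kronCoproduct]
  symm
  refine Finset.sum_nbij (fun d => d.mapDomain (pairPerm σ τ)) ?_ ?_ ?_ ?_
  · intro d hd
    rw [mem_margins] at hd ⊢
    rw [rowSums_pairPerm, colSums_pairPerm, hd.1, hd.2]
    exact ⟨rfl, rfl⟩
  · exact (mapDomain_equiv_injective _).injOn
  · intro d hd
    have hinv : (d.mapDomain (pairPerm σ τ).symm).mapDomain (pairPerm σ τ) = d := by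
      rw [← Finsupp.mapDomain_comp, Equiv.self_comp_symm, Finsupp.mapDomain_id]
    refine ⟨d.mapDomain (pairPerm σ τ).symm, ?_, hinv⟩
    rw [Finset.mem_coe, mem_margins] at hd ⊢
    rw [← hinv, rowSums_pairPerm, colSums_pairPerm] at hd
    exact ⟨mapDomain_equiv_injective _ hd.1, mapDomain_equiv_injective _ hd.2⟩
  · intro d _
    exact (hf.2 _ d).symm

theorem xCoeff_kronCoproduct_mem {f : MvPowerSeries ℕ ℤ} (hf : f ∈ symmetricFunctions)
    (α : ℕ →₀ ℕ) : xCoeff α (kronCoproduct f) ∈ symmetricFunctions := by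
  refine ⟨⟨α.degree, fun β hβ => ?_⟩, fun τ β => ?_⟩
  · change xCoeff α (kronCoproduct f) β = 0
    rw [xCoeff_kronCoproduct]
    refine Finset.sum_eq_zero fun d hd => ?_
    have := degree_of_mem_margins hd
    omega
  · have := xCoeff_kronCoproduct_perm hf 1 τ α β
    rwa [Equiv.Perm.coe_one, Finsupp.mapDomain_id] at this

/-! ### Bitableaux and `s_λ[xy]` -/

/-- The encoding of pairs along which the products `x_i y_j` are enumerated. -/
def pairCode (x : ℕ ×ₗ ℕ) : ℕ := Nat.pair (ofLex x).1 (ofLex x).2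

/-- The inverse of `pairCode`. -/
def pairDecode (k : ℕ) : ℕ ×ₗ ℕ := toLex k.unpair

lemma pairCode_pairDecode (k : ℕ) : pairCode (pairDecode k) = k := Nat.pair_unpair k

lemma pairDecode_pairCode (x : ℕ ×ₗ ℕ) : pairDecode (pairCode x) = x := by
  simp [pairCode, pairDecode]

lemma pairCode_injective : Function.Injective pairCode :=
  Function.LeftInverse.injective pairDecode_pairCode

/-- By the symmetry of the Schur functions, the order that is used on the products `x_i y_j` does
not matter. -/
lemma ncard_mapDomain_pairCode (l : YoungDiagram) (d : ℕ →₀ ℕ) :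
    ({T : Bitableau l | T.entryContent.mapDomain pairCode = d}.ncard : ℤ) = schur l d := by
  classical
  set D := d.mapDomain pairDecode with hD
  have hd : D.mapDomain pairCode = d := by
    rw [hD, ← Finsupp.mapDomain_comp, show pairCode ∘ pairDecode = id from
      funext pairCode_pairDecode, Finsupp.mapDomain_id]
  have h1 : {T : Bitableau l | T.entryContent.mapDomain pairCode = d} =
      {T : Bitableau l | T.entryContent = D} := by
    ext T
    simp only [Set.mem_ofPred_eq]
    rw [← hd]
    exact (Finsupp.mapDomain_injective pairCode_injective).eq_iff
  -- the rank function of the support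
  let g : ℕ ×ₗ ℕ → ℕ := fun x => (D.support.filter (· < x)).card
  have hg : StrictMonoOn g D.support := by
    intro x hx y hy hxy
    refine Finset.card_lt_card (Finset.ssubset_iff_subset_ne.2 ⟨?_, ?_⟩)
    · intro z hz
      rw [Finset.mem_filter] at hz ⊢
      exact ⟨hz.1, hz.2.trans hxy⟩
    · intro h
      have : x ∈ D.support.filter (· < y) := Finset.mem_filter.2 ⟨hx, hxy⟩
      rw [← h, Finset.mem_filter] at this
      exact lt_irrefl _ this.2
  rw [h1, Bitableau.ncard_entryContent_eq l D hg]
  conv_rhs => rw [← hd]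
  exact eq_mapDomain_of_injOn (swap_of_mem_symmetricFunctions (schur_mem_symmetricFunctions l)) D
    hg.injOn pairCode_injective.injOn

open Bitableau

lemma rowSums_mapDomain_pairCode {l : YoungDiagram} (T : Bitableau l) :
    rowSums (T.entryContent.mapDomain pairCode) = content l T.top := by
  rw [rowSums, ← Finsupp.mapDomain_comp, ← mapDomain_top]
  congr 1
  funext x
  simp [pairCode]

lemma colSums_mapDomain_pairCode {l : YoungDiagram} (T : Bitableau l) :
    colSums (T.entryContent.mapDomain pairCode) = content l T.bot := by
  rw [colSums, ← Finsupp.mapDomain_comp, ← mapDomain_bot]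
  congr 1
  funext x
  simp [pairCode]

/-- The bitableaux with given `a`-weight. -/
def withAWeight (l : YoungDiagram) (α : ℕ →₀ ℕ) : Set (Bitableau l) := {T | ∀ k, T.aWeight k = α k}

lemma withAWeight_closed {l : YoungDiagram} {α : ℕ →₀ ℕ} (T S : Bitableau l) (h : S.top = T.top)
    (hT : T ∈ withAWeight l α) : S ∈ withAWeight l α := fun k => by
  rw [aWeight_congr h]; exact hT k

/-- The series `s_λ[xy]` is the generating function of the bitableaux of shape `λ`. -/
lemma xCoeff_kronCoproduct_schur (l : YoungDiagram) (α : ℕ →₀ ℕ) :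
    xCoeff α (kronCoproduct (schur l)) = character (withAWeight l α) := by
  classical
  funext β
  rw [xCoeff_kronCoproduct, character]
  have hfin := finite_aWeight_bWeight l α β
  have h0 : {T : Bitableau l | T ∈ withAWeight l α ∧ ∀ k, T.bWeight k = β k} =
      (hfin.toFinset : Set (Bitableau l)) := by
    rw [Set.Finite.coe_toFinset]
    rfl
  rw [h0, Set.ncard_coe_finset, Finset.card_eq_sum_card_fiberwise
    (f := fun T => T.entryContent.mapDomain pairCode) (t := margins α β)]
  · rw [Nat.cast_sum]
    refine Finset.sum_congr rfl fun d hd => ?_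
    rw [← ncard_mapDomain_pairCode, ← Set.ncard_coe_finset]
    congr 2
    ext T
    simp only [Set.mem_ofPred_eq, Finset.coe_filter, Set.Finite.mem_toFinset, forall_aWeight_iff,
      forall_bWeight_iff, iff_and_self]
    rintro rfl
    rw [mem_margins, rowSums_mapDomain_pairCode, colSums_mapDomain_pairCode] at hd
    exact hd
  · intro T hT
    rw [Finset.mem_coe, Set.Finite.mem_toFinset] at hT
    rw [Finset.mem_coe, mem_margins, rowSums_mapDomain_pairCode, colSums_mapDomain_pairCode,
      ← forall_aWeight_iff, ← forall_bWeight_iff]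
    exact hT

/-- The numbers `d(λ, α, ν)` are the Schur coefficients of `s_λ[xy]`. -/
lemma schurExtract_xCoeff (l ν : YoungDiagram) (α : ℕ →₀ ℕ) :
    schurExtract ν (xCoeff α (kronCoproduct (schur l))) =
      ({T | T ∈ withAWeight l α ∧ IsYamanouchi T.word ∧ ∀ k, T.bWeight k = ν.rowLen k}.ncard : ℤ) := by
  rw [xCoeff_kronCoproduct_schur, schurExtract_character_eq ν withAWeight_closed]
  exact fun d => finite_aWeight_bWeight l α d

/-! ### Matrices and semistandard tableaux -/

section Mass

variable {κ κ' : Type*}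

open Classical in
/-- The total multiplicity of the elements with a given property. -/
def mass (P : κ → Prop) (d : κ →₀ ℕ) : ℕ := ∑ k ∈ d.support, if P k then d k else 0

lemma mass_congr {P Q : κ → Prop} {d : κ →₀ ℕ} (h : ∀ k ∈ d.support, (P k ↔ Q k)) :
    mass P d = mass Q d :=
  Finset.sum_congr rfl fun k hk => by
    have := h k hk
    split_ifs <;> first | rfl | tauto

lemma mass_mono {P Q : κ → Prop} {d : κ →₀ ℕ} (h : ∀ k ∈ d.support, P k → Q k) :
    mass P d ≤ mass Q d := by
  refine Finset.sum_le_sum fun k hk => ?_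
  split_ifs with h1 h2
  · exact le_rfl
  · exact absurd (h k hk h1) h2
  · exact Nat.zero_le _
  · exact le_rfl

lemma mass_eq_zero {P : κ → Prop} {d : κ →₀ ℕ} (h : ∀ k ∈ d.support, ¬ P k) : mass P d = 0 :=
  Finset.sum_eq_zero fun k hk => if_neg (h k hk)

lemma mass_or {P Q : κ → Prop} {d : κ →₀ ℕ} (h : ∀ k ∈ d.support, ¬ (P k ∧ Q k)) :
    mass (fun k => P k ∨ Q k) d = mass P d + mass Q d := by
  rw [mass, mass, mass, ← Finset.sum_add_distrib]
  refine Finset.sum_congr rfl fun k hk => ?_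
  have := h k hk
  by_cases h1 : P k <;> by_cases h2 : Q k <;> simp_all

lemma mass_eq (k : κ) (d : κ →₀ ℕ) : mass (fun k' => k' = k) d = d k := by
  classical
  rw [mass, Finset.sum_eq_single k]
  · simp
  · intro b _ hb
    rw [if_neg hb]
  · intro h
    rw [Finsupp.notMem_support_iff.1 h]
    simp

open Classical in
lemma mass_eq_sum (P : κ → Prop) (d : κ →₀ ℕ) :
    mass P d = d.sum fun k n => if P k then n else 0 := rfl

lemma mass_mapDomain (P : κ' → Prop) (h : κ → κ') (d : κ →₀ ℕ) :
    mass P (d.mapDomain h) = mass (fun k => P (h k)) d := by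
  classical
  rw [mass_eq_sum, mass_eq_sum, Finsupp.sum_mapDomain_index]
  · simp
  · intro b m n
    split_ifs <;> rfl

open Classical in
lemma mass_content (P : κ → Prop) (l : YoungDiagram) (g : ℕ × ℕ → κ) :
    mass P (content l g) = (l.cells.filter fun c => P (g c)).card := by
  rw [mass_eq_sum, content, Finset.card_filter, ← Finsupp.sum_finsetSum_index]
  · refine Finset.sum_congr rfl fun c _ => ?_
    rw [Finsupp.sum_single_index]
    simp
  · simp
  · intro b m n
    split_ifs <;> rfl

end Mass

/-- The sum of the first `a` entries of column `b` of a matrix. -/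
def cumul (d : ℕ →₀ ℕ) (a b : ℕ) : ℕ := mass (fun k => k.unpair.1 < a ∧ k.unpair.2 = b) d

lemma cumul_zero (d : ℕ →₀ ℕ) (b : ℕ) : cumul d 0 b = 0 :=
  mass_eq_zero fun _ _ h => absurd h.1 (Nat.not_lt_zero _)

lemma cumul_succ (d : ℕ →₀ ℕ) (a b : ℕ) : cumul d (a + 1) b = cumul d a b + d (Nat.pair a b) := by
  rw [cumul, cumul, ← mass_eq (Nat.pair a b) d, ← mass_or]
  · refine mass_congr fun k _ => ?_
    have : k = Nat.pair a b ↔ k.unpair.1 = a ∧ k.unpair.2 = b := by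
      constructor
      · rintro rfl; simp
      · rintro ⟨rfl, rfl⟩; simp
    rw [this]
    omega
  · rintro k - ⟨h1, rfl⟩
    simp at h1

lemma cumul_mono (d : ℕ →₀ ℕ) {a a' : ℕ} (h : a ≤ a') (b : ℕ) : cumul d a b ≤ cumul d a' b :=
  mass_mono fun _ _ hk => ⟨hk.1.trans_le h, hk.2⟩

lemma eq_of_cumul_eq {d d' : ℕ →₀ ℕ} (h : ∀ a b, cumul d a b = cumul d' a b) : d = d' := by
  ext k
  have h1 := h (k.unpair.1 + 1) k.unpair.2
  rw [cumul_succ, cumul_succ, h, Nat.pair_unpair] at h1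
  omega

lemma mass_col (d : ℕ →₀ ℕ) (b : ℕ) : mass (fun k => k.unpair.2 = b) d = colSums d b := by
  rw [← mass_eq b (colSums d), colSums, mass_mapDomain]

lemma cumul_le (d : ℕ →₀ ℕ) (a b : ℕ) : cumul d a b ≤ colSums d b := by
  rw [← mass_col]
  exact mass_mono fun k _ hk => hk.2

lemma cumul_eq_of_forall_lt {d : ℕ →₀ ℕ} {a : ℕ} (h : ∀ k ∈ d.support, k.unpair.1 < a) (b : ℕ) :
    cumul d a b = colSums d b := by
  rw [← mass_col]
  exact mass_congr fun k hk => and_iff_right (h k hk)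

lemma exists_forall_unpair_lt (d : ℕ →₀ ℕ) : ∃ M, ∀ k ∈ d.support, k.unpair.1 < M := by
  obtain ⟨M, hM⟩ := d.exists_forall_le_eq_zero
  refine ⟨M, fun k hk => (Nat.unpair_left_le k).trans_lt ?_⟩
  by_contra! h
  exact Finsupp.mem_support_iff.1 hk (hM k h)

/-- The condition on a matrix under which the fillings of row `b` by the entries of column `b`
form a semistandard tableau. -/
def IsGelfandTsetlin (d : ℕ →₀ ℕ) : Prop := ∀ a b, cumul d (a + 1) (b + 1) ≤ cumul d a b

section Tableau

variable {ν : YoungDiagram}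

/-- The matrix that counts how often each letter occurs in each row of a tableau. -/
def letterMatrix (S : SemistandardYoungTableau ν) : ℕ →₀ ℕ :=
  content ν fun c => Nat.pair (S c.1 c.2) c.1

lemma rowSums_letterMatrix (S : SemistandardYoungTableau ν) :
    rowSums (letterMatrix S) = content ν fun c => S c.1 c.2 := by
  rw [rowSums, letterMatrix, mapDomain_content]
  simp

lemma content_fst (ν : YoungDiagram) : content ν Prod.fst = rowExp ν := by
  ext k
  rw [content_apply, rowExp_apply, YoungDiagram.rowLen_eq_card]
  rfl

lemma colSums_letterMatrix (S : SemistandardYoungTableau ν) :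
    colSums (letterMatrix S) = rowExp ν := by
  rw [colSums, letterMatrix, mapDomain_content, ← content_fst]
  simp

lemma cumul_letterMatrix (S : SemistandardYoungTableau ν) (a b : ℕ) :
    cumul (letterMatrix S) a b = (ν.cells.filter fun c => S c.1 c.2 < a ∧ c.1 = b).card := by
  classical
  rw [cumul, letterMatrix, mass_content]
  simp

lemma lt_cumul_letterMatrix_iff (S : SemistandardYoungTableau ν) {a b j : ℕ} (h : (b, j) ∈ ν) :
    j < cumul (letterMatrix S) a b ↔ S b j < a := by
  rw [cumul_letterMatrix]
  constructor
  · intro hj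
    by_contra! hlt
    have h1 : (ν.cells.filter fun c => S c.1 c.2 < a ∧ c.1 = b) ⊆
        (Finset.range j).image fun j' => (b, j') := by
      rintro ⟨b', j'⟩ hc
      obtain ⟨h2, h3, rfl⟩ := Finset.mem_filter.1 hc
      refine Finset.mem_image.2 ⟨j', Finset.mem_range.2 ?_, rfl⟩
      by_contra! h4
      exact (hlt.trans (S.row_weak_of_le h4 h2)).not_gt h3
    have h2 := (Finset.card_le_card h1).trans Finset.card_image_le
    rw [Finset.card_range] at h2
    omega
  · intro hlt
    have h1 : ((Finset.range (j + 1)).image fun j' => (b, j')) ⊆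
        ν.cells.filter fun c => S c.1 c.2 < a ∧ c.1 = b := by
      rintro ⟨b', j'⟩ hc
      obtain ⟨j'', h2, h3⟩ := Finset.mem_image.1 hc
      rw [Prod.mk.injEq] at h3
      obtain ⟨rfl, rfl⟩ := h3
      have h4 : j'' ≤ j := Nat.lt_succ_iff.1 (Finset.mem_range.1 h2)
      exact Finset.mem_filter.2 ⟨ν.up_left_mem le_rfl h4 h,
        (S.row_weak_of_le h4 h).trans_lt hlt, rfl⟩
    have h2 := Finset.card_le_card h1
    rw [Finset.card_image_of_injective _ fun x y e => (Prod.mk.injEq _ _ _ _ ▸ e).2,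
      Finset.card_range] at h2
    omega

lemma isGelfandTsetlin_letterMatrix (S : SemistandardYoungTableau ν) :
    IsGelfandTsetlin (letterMatrix S) := by
  intro a b
  rw [cumul_letterMatrix, cumul_letterMatrix]
  refine Finset.card_le_card_of_injOn (fun c => (b, c.2)) ?_ ?_
  · rintro ⟨r, j⟩ hc
    obtain ⟨h1, h2, h3⟩ := Finset.mem_filter.1 hc
    dsimp only at h2 h3
    subst h3
    rw [YoungDiagram.mem_cells] at h1
    have := S.col_strict (Nat.lt_succ_self b) h1
    refine Finset.mem_filter.2 ⟨ν.up_left_mem (Nat.le_succ b) le_rfl h1, ?_, rfl⟩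
    dsimp only
    simp only [Nat.succ_eq_add_one] at this
    omega
  · rintro ⟨r, j⟩ hc ⟨r', j'⟩ hc' e
    obtain ⟨-, -, h3⟩ := Finset.mem_filter.1 hc
    obtain ⟨-, -, h3'⟩ := Finset.mem_filter.1 hc'
    simp only [Prod.mk.injEq] at *
    omega

lemma letterMatrix_injective : Function.Injective (letterMatrix (ν := ν)) := by
  intro S S' h
  ext b j
  by_cases hm : (b, j) ∈ ν
  · refine eq_of_forall_lt_iff fun a => ?_
    rw [← not_le, ← not_le, ← Nat.lt_succ_iff, ← Nat.lt_succ_iff, Nat.succ_eq_add_one,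
      ← lt_cumul_letterMatrix_iff S hm, ← lt_cumul_letterMatrix_iff S' hm, h]
  · rw [S.zeros hm, S'.zeros hm]

lemma exists_letterMatrix_eq {d : ℕ →₀ ℕ} (hd : colSums d = rowExp ν) (hgt : IsGelfandTsetlin d) :
    ∃ S : SemistandardYoungTableau ν, letterMatrix S = d := by
  classical
  obtain ⟨M, hM⟩ := exists_forall_unpair_lt d
  -- the entry in column `j` of row `b` is the least `a` for which `j < cumul d (a + 1) b`
  let t : ℕ → ℕ → ℕ := fun b j => sInf {a | j < cumul d (a + 1) b}
  have ht : ∀ {b j a}, (b, j) ∈ ν → (t b j < a ↔ j < cumul d a b) := by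
    intro b j a hm
    have hne : {a | j < cumul d (a + 1) b}.Nonempty := by
      refine ⟨M, ?_⟩
      change j < cumul d (M + 1) b
      rw [cumul_eq_of_forall_lt (fun k hk => (hM k hk).trans (Nat.lt_succ_self M)), hd, rowExp_apply]
      exact YoungDiagram.mem_iff_lt_rowLen.1 hm
    constructor
    · intro h
      have h1 : j < cumul d (t b j + 1) b := Nat.sInf_mem hne
      exact h1.trans_le (cumul_mono d h b)
    · intro h
      obtain _ | a := a
      · rw [cumul_zero] at h; omega
      · exact Nat.lt_succ_of_le (Nat.sInf_le h)
  have hrow : ∀ {b j j'}, j < j' → (b, j') ∈ ν → t b j ≤ t b j' := by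
    intro b j j' hj hm
    have hm' := ν.up_left_mem le_rfl hj.le hm
    have h1 := (ht hm).1 (Nat.lt_succ_self _)
    exact Nat.lt_succ_iff.1 ((ht hm').2 (hj.trans h1))
  have hcol1 : ∀ {b j}, (b + 1, j) ∈ ν → t b j < t (b + 1) j := by
    intro b j hm
    have hm' := ν.up_left_mem (Nat.le_succ b) le_rfl hm
    have h1 := (ht hm).1 (Nat.lt_succ_self _)
    exact (ht hm').2 (h1.trans_le (hgt _ _))
  have hcol : ∀ {b b' j}, b < b' → (b', j) ∈ ν → t b j < t b' j := by
    intro b b' j hb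
    induction b', hb using Nat.le_induction with
    | base => exact hcol1
    | succ b' hb ih =>
      intro hm
      exact (ih (ν.up_left_mem (Nat.le_succ b') le_rfl hm)).trans (hcol1 hm)
  let S : SemistandardYoungTableau ν :=
    { entry := fun b j => if (b, j) ∈ ν then t b j else 0
      row_weak' := fun {b j j'} hj hm => by
        rw [if_pos hm, if_pos (ν.up_left_mem le_rfl hj.le hm)]
        exact hrow hj hm
      col_strict' := fun {b b' j} hb hm => by
        rw [if_pos hm, if_pos (ν.up_left_mem hb.le le_rfl hm)]
        exact hcol hb hm
      zeros' := fun h => if_neg h }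
  have hS : ∀ {b j}, (b, j) ∈ ν → S b j = t b j := fun hm => if_pos hm
  refine ⟨S, eq_of_cumul_eq fun a b => ?_⟩
  rw [cumul_letterMatrix]
  have h1 : (ν.cells.filter fun c => S c.1 c.2 < a ∧ c.1 = b) =
      (Finset.range (cumul d a b)).image fun j => (b, j) := by
    ext ⟨b', j⟩
    simp only [Finset.mem_filter, YoungDiagram.mem_cells, Finset.mem_image, Finset.mem_range,
      Prod.mk.injEq]
    constructor
    · rintro ⟨hm, h2, rfl⟩
      rw [hS hm, ht hm] at h2
      exact ⟨j, h2, rfl, rfl⟩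
    · rintro ⟨j', h2, rfl, rfl⟩
      have hm : (b, j') ∈ ν := by
        rw [YoungDiagram.mem_iff_lt_rowLen, ← rowExp_apply, ← hd]
        exact h2.trans_le (cumul_le d a b)
      rw [hS hm, ht hm]
      exact ⟨hm, h2, rfl⟩
  rw [h1, Finset.card_image_of_injective _ fun x y e => (Prod.mk.injEq _ _ _ _ ▸ e).2,
    Finset.card_range]

/-- The coefficients of a Schur function count matrices. -/
lemma schur_eq_ncard (ν : YoungDiagram) (α : ℕ →₀ ℕ) :
    schur ν α = ({d | d ∈ margins α (rowExp ν) ∧ IsGelfandTsetlin d}.ncard : ℤ) := by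
  rw [schur_apply, Nat.cast_inj]
  refine Set.BijOn.ncard_eq (f := letterMatrix) ⟨?_, letterMatrix_injective.injOn, ?_⟩
  · intro S hS
    have hS' : (content ν fun c => S c.1 c.2) = α := hS
    exact ⟨mem_margins.2 ⟨(rowSums_letterMatrix S).trans hS', colSums_letterMatrix S⟩,
      isGelfandTsetlin_letterMatrix S⟩
  · rintro d ⟨hd, hgt⟩
    rw [mem_margins] at hd
    obtain ⟨S, rfl⟩ := exists_letterMatrix_eq hd.2 hgt
    exact ⟨S, (rowSums_letterMatrix S).symm.trans hd.1, rfl⟩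

end Tableau

/-! ### Bitableaux with a single row -/

/-- The Young diagram with a single row of length `n`. -/
def rowDiagram (n : ℕ) : YoungDiagram where
  cells := {0} ×ˢ Finset.range n
  isLowerSet := by
    rintro ⟨i, j⟩ ⟨i', j'⟩ h hm
    simp only [Finset.coe_product, Finset.coe_singleton, Finset.coe_range, Set.mem_prod,
      Set.mem_singleton_iff, Set.mem_Iio] at hm ⊢
    exact ⟨Nat.le_zero.1 (h.1.trans hm.1.le), h.2.trans_lt hm.2⟩

lemma mem_rowDiagram {n : ℕ} {c : ℕ × ℕ} : c ∈ rowDiagram n ↔ c.1 = 0 ∧ c.2 < n := by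
  rw [← YoungDiagram.mem_cells]
  simp only [rowDiagram, Finset.mem_product, Finset.mem_singleton, Finset.mem_range]

lemma rowExp_rowDiagram (n : ℕ) : rowExp (rowDiagram n) = Finsupp.single 0 n := by
  ext k
  rw [rowExp_apply, Finsupp.single_apply]
  have key : ∀ j, j < (rowDiagram n).rowLen k ↔ k = 0 ∧ j < n := fun j => by
    rw [← YoungDiagram.mem_iff_lt_rowLen, mem_rowDiagram]
  split_ifs with h
  · refine eq_of_forall_lt_iff fun j => ?_
    rw [key]
    simp [← h]
  · by_contra h0
    exact h ((key 0).1 (Nat.pos_of_ne_zero h0)).1.symm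

/-- The Schur function of a single row is the sum of all monomials of its degree. -/
lemma schur_rowDiagram (d : ℕ →₀ ℕ) : schur (rowDiagram d.degree) d = 1 := by
  rw [schur_eq_ncard, Nat.cast_eq_one, Set.ncard_eq_one, rowExp_rowDiagram]
  refine ⟨d.mapDomain fun a => Nat.pair a 0, Set.eq_singleton_iff_unique_mem.2 ⟨⟨?_, ?_⟩, ?_⟩⟩
  · rw [mem_margins, rowSums, colSums, ← Finsupp.mapDomain_comp, ← Finsupp.mapDomain_comp]
    constructor
    · rw [show ((fun k : ℕ => k.unpair.1) ∘ fun a => Nat.pair a 0) = id by funext; simp,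
        Finsupp.mapDomain_id]
    · rw [show ((fun k : ℕ => k.unpair.2) ∘ fun a => Nat.pair a 0) = fun _ => 0 by funext; simp]
      induction d using Finsupp.induction_linear with
      | zero => simp
      | add f g hf hg => rw [Finsupp.mapDomain_add, hf, hg, map_add, Finsupp.single_add]
      | single a n => simp [Finsupp.mapDomain_single]
  · intro a b
    rw [cumul, mass_mapDomain, mass_eq_zero]
    · exact Nat.zero_le _
    · rintro k - ⟨-, h⟩
      simp at h
  · rintro d' ⟨hd', -⟩
    obtain ⟨h1, h2⟩ := mem_margins.1 hd'
    have h3 : ∀ k ∈ d'.support, k.unpair.2 = 0 := by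
      intro k hk
      have := mem_support_mapDomain (fun k : ℕ => k.unpair.2) hk
      rw [show d'.mapDomain (fun k : ℕ => k.unpair.2) = _ from h2] at this
      simpa using Finsupp.support_single_subset this
    rw [← h1, rowSums, ← Finsupp.mapDomain_comp]
    conv_lhs => rw [← Finsupp.mapDomain_id (v := d')]
    refine Finsupp.mapDomain_congr fun k hk => ?_
    conv_lhs => rw [id, ← Nat.pair_unpair k, h3 k hk]
    rfl

/-- The Yamanouchi condition for a bitableau with a single row, in terms of its matrix. -/
def IsYamanouchiMatrix (d : ℕ →₀ ℕ) : Prop :=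
  ∀ a b, mass (fun k => a ≤ k.unpair.1 ∧ k.unpair.2 = b + 1) d ≤
    mass (fun k => a < k.unpair.1 ∧ k.unpair.2 = b) d

open Bitableau

lemma isYamanouchi_word_rowDiagram_iff {n : ℕ} (T : Bitableau (rowDiagram n)) :
    IsYamanouchi T.word ↔ IsYamanouchiMatrix (T.entryContent.mapDomain pairCode) := by
  classical
  have hmass : ∀ P : ℕ × ℕ → Prop, mass (fun k => P k.unpair) (T.entryContent.mapDomain pairCode) =
      ((rowDiagram n).cells.filter fun c => P (T.top c, T.bot c)).card := by
    intro P
    rw [mass_mapDomain, mass_content]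
    simp [pairCode, top, bot]
  have hR : ∀ {c c'}, c ∈ rowDiagram n → c' ∈ rowDiagram n → T.ReadBefore c c' →
      T.top c < T.top c' ∨ (T.top c = T.top c' ∧ T.bot c ≤ T.bot c') := by
    rintro ⟨r, j⟩ ⟨r', j'⟩ hc hc' h
    have e := (mem_rowDiagram.1 hc).1
    have e' := (mem_rowDiagram.1 hc').1
    dsimp only at e e'
    subst e e'
    rcases le_total j j' with hj | hj
    · exact T.row_le hj hc'
    · simp only [ReadBefore] at h
      omega
  rw [isYamanouchi_word_iff]
  constructor
  · intro h a b
    rw [hmass fun x => a ≤ x.1 ∧ x.2 = b + 1, hmass fun x => a < x.1 ∧ x.2 = b]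
    have h1 := h (fun c => T.top c < a ∨ (T.top c = a ∧ T.bot c ≤ b)) (by
      intro c hc c' hc' h2 h3
      have := hR hc hc' h2
      omega) b
    rw [cellHeight, sub_nonpos, Nat.cast_le] at h1
    refine le_trans (Finset.card_le_card ?_) (h1.trans (Finset.card_le_card ?_)) <;>
    · intro c hc
      simp only [Finset.mem_filter] at hc ⊢
      exact ⟨hc.1, by omega⟩
  · intro h P hP i
    rw [cellHeight, sub_nonpos, Nat.cast_le]
    by_cases h0 : ∃ a, ∃ c ∈ rowDiagram n, ¬ P c ∧ T.bot c = i + 1 ∧ T.top c = a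
    · obtain ⟨c₀, h2, h3, -, h4⟩ := Nat.find_spec h0
      have hmin : ∀ c ∈ rowDiagram n, ¬ P c → T.bot c = i + 1 → T.top c₀ ≤ T.top c :=
        fun c hc hP hb => h4 ▸ Nat.find_min' h0 ⟨c, hc, hP, hb, rfl⟩
      have h1 := h (T.top c₀) i
      rw [hmass fun x => T.top c₀ ≤ x.1 ∧ x.2 = i + 1, hmass fun x => T.top c₀ < x.1 ∧ x.2 = i] at h1
      refine le_trans (Finset.card_le_card ?_) (h1.trans (Finset.card_le_card ?_))
      · intro c hc
        simp only [Finset.mem_filter, YoungDiagram.mem_cells] at hc ⊢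
        exact ⟨hc.1, hmin c hc.1 hc.2.1 hc.2.2, hc.2.2⟩
      · intro c hc
        simp only [Finset.mem_filter, YoungDiagram.mem_cells] at hc ⊢
        exact ⟨hc.1, fun h7 => h3 (hP _ h2 _ hc.1 (Or.inl hc.2.1) h7), hc.2.2⟩
    · rw [Finset.card_eq_zero.2]
      · exact Nat.zero_le _
      · refine Finset.eq_empty_of_forall_notMem fun c hc => h0 ?_
        simp only [Finset.mem_filter] at hc
        exact ⟨_, c, hc.1, hc.2.1, hc.2.2, rfl⟩

lemma rowDiagram_bijOn (γ : ℕ →₀ ℕ) (ν : YoungDiagram) :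
    Set.BijOn (fun T : Bitableau (rowDiagram γ.degree) => T.entryContent.mapDomain pairCode)
      {T | T ∈ withAWeight _ γ ∧ IsYamanouchi T.word ∧ ∀ k, T.bWeight k = ν.rowLen k}
      {d | d ∈ margins γ (rowExp ν) ∧ IsYamanouchiMatrix d} := by
  have hone : ∀ d : ℕ →₀ ℕ, d.degree = γ.degree →
      ∃ T₀, {T : Bitableau (rowDiagram γ.degree) | T.entryContent.mapDomain pairCode = d} = {T₀} := by
    intro d hd
    have h := ncard_mapDomain_pairCode (rowDiagram γ.degree) d
    rw [← hd, schur_rowDiagram, Nat.cast_eq_one, Set.ncard_eq_one] at h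
    rwa [← hd]
  have hw : ∀ T : Bitableau (rowDiagram γ.degree), (T ∈ withAWeight _ γ ∧
      ∀ k, T.bWeight k = ν.rowLen k) ↔ T.entryContent.mapDomain pairCode ∈ margins γ (rowExp ν) := by
    intro T
    rw [mem_margins, rowSums_mapDomain_pairCode, colSums_mapDomain_pairCode, ← forall_aWeight_iff,
      ← forall_bWeight_iff]
    rfl
  refine ⟨?_, ?_, ?_⟩
  · rintro T ⟨h1, h2, h3⟩
    exact ⟨(hw T).1 ⟨h1, h3⟩, (isYamanouchi_word_rowDiagram_iff T).1 h2⟩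
  · rintro T ⟨h1, h2, h3⟩ S - e
    have hd := (degree_of_mem_margins ((hw T).1 ⟨h1, h3⟩)).1
    obtain ⟨T₀, hT₀⟩ := hone _ hd
    have e1 : T ∈ ({T₀} : Set (Bitableau (rowDiagram γ.degree))) := hT₀ ▸ rfl
    have e2 : S ∈ ({T₀} : Set (Bitableau (rowDiagram γ.degree))) := hT₀ ▸ e.symm
    exact e1.trans e2.symm
  · rintro d ⟨hd, hy⟩
    obtain ⟨T₀, hT₀⟩ := hone _ (degree_of_mem_margins hd).1
    have e : T₀.entryContent.mapDomain pairCode = d := by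
      have : T₀ ∈ {T : Bitableau (rowDiagram γ.degree) | T.entryContent.mapDomain pairCode = d} :=
        hT₀ ▸ rfl
      exact this
    subst e
    obtain ⟨h1, h2⟩ := (hw T₀).2 hd
    exact ⟨T₀, ⟨h1, (isYamanouchi_word_rowDiagram_iff T₀).2 hy, h2⟩, rfl⟩

/-- The permutation that reverses the order of the first `M` natural numbers. -/
def revPerm (M : ℕ) : Equiv.Perm ℕ :=
  Function.Involutive.toPerm (fun k => if k < M then M - 1 - k else k) fun k => by
    dsimp only
    split_ifs <;> omega

lemma revPerm_apply (M k : ℕ) : revPerm M k = if k < M then M - 1 - k else k := rfl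

/-- Reversing the order of the rows turns the Yamanouchi condition into the condition for
semistandard tableaux. -/
lemma isGelfandTsetlin_pairPerm_iff {M : ℕ} {d : ℕ →₀ ℕ} (hM : ∀ k ∈ d.support, k.unpair.1 < M) :
    IsGelfandTsetlin (d.mapDomain (pairPerm (revPerm M) 1)) ↔ IsYamanouchiMatrix d := by
  have h0 : ∀ a b, cumul (d.mapDomain (pairPerm (revPerm M) 1)) a b =
      mass (fun k => M ≤ k.unpair.1 + a ∧ k.unpair.2 = b) d := by
    intro a b
    rw [cumul, mass_mapDomain]
    refine mass_congr fun k hk => ?_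
    have := hM k hk
    rw [pairPerm_apply, Nat.unpair_pair, revPerm_apply, if_pos this]
    simp only [Equiv.Perm.coe_one, id]
    omega
  simp only [IsGelfandTsetlin, IsYamanouchiMatrix, h0]
  constructor
  · intro h a b
    rcases lt_or_ge a M with ha | ha
    · refine le_trans (mass_mono fun k _ hk => ?_) ((h (M - 1 - a) b).trans
        (mass_mono fun k _ hk => ?_)) <;> omega
    · rw [mass_eq_zero]
      · exact Nat.zero_le _
      · intro k hk
        have := hM k hk
        omega
  · intro h a b
    refine le_trans (mass_mono fun k _ hk => ?_) ((h (M - 1 - a) b).trans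
        (mass_mono fun k _ hk => ?_)) <;> omega

/-- The Yamanouchi bitableaux with a single row are counted by the coefficients of the Schur
functions. -/
lemma ncard_yamanouchi_rowDiagram (γ : ℕ →₀ ℕ) (ν : YoungDiagram) :
    ({T : Bitableau (rowDiagram γ.degree) | T ∈ withAWeight _ γ ∧ IsYamanouchi T.word ∧
      ∀ k, T.bWeight k = ν.rowLen k}.ncard : ℤ) = schur ν γ := by
  obtain ⟨M, hM⟩ := γ.exists_forall_le_eq_zero
  have hrev : schur ν γ = schur ν (γ.mapDomain (revPerm M)) :=
    ((schur_mem_symmetricFunctions ν).2 (revPerm M) γ).symm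
  have hM' : ∀ d ∈ margins γ (rowExp ν), ∀ k ∈ d.support, k.unpair.1 < M := by
    intro d hd k hk
    have h1 := mem_support_mapDomain (fun k : ℕ => k.unpair.1) hk
    rw [show d.mapDomain (fun k : ℕ => k.unpair.1) = γ from (mem_margins.1 hd).1] at h1
    by_contra! h2
    exact Finsupp.mem_support_iff.1 h1 (hM _ h2)
  rw [(rowDiagram_bijOn γ ν).ncard_eq, hrev, schur_eq_ncard, Nat.cast_inj]
  have hmem : ∀ d : ℕ →₀ ℕ, d.mapDomain (pairPerm (revPerm M) 1) ∈
      margins (γ.mapDomain (revPerm M)) (rowExp ν) ↔ d ∈ margins γ (rowExp ν) := by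
    intro d
    rw [mem_margins, mem_margins, rowSums_pairPerm, colSums_pairPerm,
      (mapDomain_equiv_injective _).eq_iff, Equiv.Perm.coe_one, Finsupp.mapDomain_id]
  refine Set.BijOn.ncard_eq (f := Finsupp.mapDomain (pairPerm (revPerm M) 1))
    ⟨?_, (mapDomain_equiv_injective _).injOn, ?_⟩
  · rintro d ⟨h1, h2⟩
    exact ⟨(hmem d).2 h1, (isGelfandTsetlin_pairPerm_iff (hM' d h1)).2 h2⟩
  · rintro d ⟨h1, h2⟩
    have hinv : (d.mapDomain (pairPerm (revPerm M) 1).symm).mapDomain (pairPerm (revPerm M) 1) =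
        d := by
      rw [← Finsupp.mapDomain_comp, Equiv.self_comp_symm, Finsupp.mapDomain_id]
    rw [← hinv] at h1 h2
    rw [hmem] at h1
    exact ⟨_, ⟨h1, (isGelfandTsetlin_pairPerm_iff (hM' _ h1)).1 h2⟩, hinv⟩

/-! ### Commutativity of the Kronecker product -/

lemma sum_smul_apply {ι : Type*} (s : Finset ι) (c : ι → ℤ) (f : ι → MvPowerSeries ℕ ℤ)
    (d : ℕ →₀ ℕ) : (∑ i ∈ s, c i • f i) d = ∑ i ∈ s, c i * f i d := by
  change MvPowerSeries.coeff d (∑ i ∈ s, c i • f i) = _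
  rw [map_sum]
  rfl

/-- The Cauchy identity: the generating function of the matrices with given margins is
`∑ s_ν(x) s_ν(y)`. -/
lemma card_margins (α β : ℕ →₀ ℕ) :
    ((margins α β).card : ℤ) = ∑ ν ∈ partitionsLE α.degree, schur ν α * schur ν β := by
  have hmem := xCoeff_kronCoproduct_mem (schur_mem_symmetricFunctions (rowDiagram α.degree)) α
  have h := congr_fun (eq_sum_schurExtract hmem (N := α.degree) fun β hβ => by
    rw [xCoeff_kronCoproduct]
    refine Finset.sum_eq_zero fun d hd => absurd (degree_of_mem_margins hd) ?_
    omega) β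
  rw [xCoeff_kronCoproduct, Finset.sum_congr rfl fun d hd => by
    rw [← (degree_of_mem_margins hd).1, schur_rowDiagram]] at h
  rw [Finset.sum_const, nsmul_one] at h
  rw [h, sum_smul_apply]
  refine Finset.sum_congr rfl fun ν _ => ?_
  rw [schurExtract_xCoeff, ncard_yamanouchi_rowDiagram]

/-- The number of three-dimensional arrays with given margins, as a power series in the variables
of the third margin. -/
def arrayCount (α β : ℕ →₀ ℕ) : MvPowerSeries ℕ ℤ := fun γ =>
  ∑ d ∈ margins α β, ((margins d γ).card : ℤ)

lemma arrayCount_eq_sum (α β : ℕ →₀ ℕ) :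
    arrayCount α β =
      ∑ ν ∈ partitionsLE α.degree, xCoeff α (kronCoproduct (schur ν)) β • schur ν := by
  funext γ
  rw [arrayCount, sum_smul_apply, Finset.sum_congr rfl fun d hd => by
    rw [card_margins, (degree_of_mem_margins hd).1], Finset.sum_comm]
  refine Finset.sum_congr rfl fun ν _ => ?_
  rw [xCoeff_kronCoproduct]
  exact (Finset.sum_mul _ _ _).symm

lemma schurExtract_arrayCount (μ : YoungDiagram) (α β : ℕ →₀ ℕ) :
    schurExtract μ (arrayCount α β) = xCoeff α (kronCoproduct (schur μ)) β := by
  classical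
  rw [arrayCount_eq_sum, map_sum]
  simp only [map_smul, schurExtract_schur, smul_eq_mul, mul_ite, mul_one, mul_zero]
  rw [Finset.sum_ite_eq']
  split_ifs with h
  · rfl
  · rw [mem_partitionsLE, not_le] at h
    rw [xCoeff_kronCoproduct]
    refine (Finset.sum_eq_zero fun d hd => schur_eq_zero ?_).symm
    have := (degree_of_mem_margins hd).1
    omega

lemma sum_card_margins_le (α β γ : ℕ →₀ ℕ) :
    ∑ d ∈ margins α β, (margins d γ).card ≤ ∑ d ∈ margins α γ, (margins d β).card := by
  -- an array with the entry `F (pair (pair i j) k)` at `(i, j, k)` is sent to the array in which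
  -- the last two coordinates are interchanged
  let s : ℕ → ℕ := fun k => Nat.pair (Nat.pair k.unpair.1.unpair.1 k.unpair.2) k.unpair.1.unpair.2
  have hs : Function.Injective s := Function.Involutive.injective fun k => by simp [s]
  have h1 : ∀ F : ℕ →₀ ℕ, rowSums (rowSums (F.mapDomain s)) = rowSums (rowSums F) := fun F => by
    rw [rowSums, rowSums, rowSums, rowSums, ← Finsupp.mapDomain_comp, ← Finsupp.mapDomain_comp,
      ← Finsupp.mapDomain_comp]
    exact congrArg (fun p => F.mapDomain p) (funext fun k => by simp [s])
  have h2 : ∀ F : ℕ →₀ ℕ, colSums (rowSums (F.mapDomain s)) = colSums F := fun F => by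
    rw [rowSums, colSums, colSums, ← Finsupp.mapDomain_comp, ← Finsupp.mapDomain_comp]
    exact congrArg (fun p => F.mapDomain p) (funext fun k => by simp [s])
  have h3 : ∀ F : ℕ →₀ ℕ, colSums (F.mapDomain s) = colSums (rowSums F) := fun F => by
    rw [rowSums, colSums, colSums, ← Finsupp.mapDomain_comp, ← Finsupp.mapDomain_comp]
    exact congrArg (fun p => F.mapDomain p) (funext fun k => by simp [s])
  rw [← Finset.card_sigma, ← Finset.card_sigma]
  refine Finset.card_le_card_of_injOn
    (fun x => ⟨rowSums (x.2.mapDomain s), x.2.mapDomain s⟩) ?_ ?_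
  · rintro ⟨d, F⟩ hx
    simp only [Finset.coe_sigma, Set.mem_sigma_iff, Finset.mem_coe, mem_margins] at hx ⊢
    obtain ⟨⟨ha, hb⟩, rfl, hc⟩ := hx
    exact ⟨⟨(h1 F).trans ha, (h2 F).trans hc⟩, trivial, (h3 F).trans hb⟩
  · rintro ⟨d, F⟩ hx ⟨d', F'⟩ hx' e
    simp only [Finset.coe_sigma, Set.mem_sigma_iff, Finset.mem_coe, mem_margins] at hx hx'
    obtain ⟨-, rfl, -⟩ := hx
    obtain ⟨-, rfl, -⟩ := hx'
    have e2 : F.mapDomain s = F'.mapDomain s := by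
      simp only [Sigma.mk.injEq, heq_eq_eq] at e
      exact e.2
    rw [Finsupp.mapDomain_injective hs e2]

lemma arrayCount_comm (α β γ : ℕ →₀ ℕ) : arrayCount α β γ = arrayCount α γ β := by
  rw [arrayCount, arrayCount, ← Nat.cast_sum, ← Nat.cast_sum, Nat.cast_inj]
  exact (sum_card_margins_le α β γ).antisymm (sum_card_margins_le α γ β)

/-- The symmetry of the Kronecker coefficients: `⟨s_λ, s_μ[xy]⟩ = ⟨s_μ, s_λ[xy]⟩`. Both sides are
obtained from the numbers of three-dimensional arrays by extracting the coefficient of `s_λ` in one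
set of variables and that of `s_μ` in another one. -/
lemma schurExtract_xCoeff_comm (l μ : YoungDiagram) (α : ℕ →₀ ℕ) :
    schurExtract l (xCoeff α (kronCoproduct (schur μ))) =
      schurExtract μ (xCoeff α (kronCoproduct (schur l))) := by
  rw [schurExtract_apply, schurExtract_apply]
  simp only [← schurExtract_arrayCount, schurExtract_apply, ← Finset.sum_filter, Finset.mul_sum]
  rw [Finset.sum_comm]
  refine Finset.sum_congr rfl fun _ _ => Finset.sum_congr rfl fun _ _ => ?_
  rw [arrayCount_comm, mul_left_comm]

/-! ### The monomial expansion -/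

open Bitableau

lemma finite_yamanouchiBitableaux (l μ ν : YoungDiagram) : (yamanouchiBitableaux l μ ν).Finite :=
  (finite_aWeight_bWeight l (rowExp μ) (rowExp ν)).subset fun _ hT => ⟨hT.1, hT.2.1⟩

lemma card_eq_of_dCoeff_ne_zero {l μ ν : YoungDiagram} (h : dCoeff l μ ν ≠ 0) :
    μ.card = l.card := by
  obtain ⟨T, hT⟩ := Set.nonempty_of_ncard_ne_zero h
  have h1 : content l T.top = rowExp μ := forall_aWeight_iff.1 hT.1
  rw [← degree_rowExp, ← h1, degree_content]

/-- The coefficients of the Kronecker product. -/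
lemma kronProduct_schur_apply (l ν : YoungDiagram) (α : ℕ →₀ ℕ) :
    kronProduct (schur l) (schur ν) α = schurExtract ν (xCoeff α (kronCoproduct (schur l))) := by
  rw [kronProduct, hall_schur (xCoeff_kronCoproduct_mem (schur_mem_symmetricFunctions ν) α),
    schurExtract_xCoeff_comm]

lemma kronProduct_schur_rowExp (l μ ν : YoungDiagram) :
    kronProduct (schur l) (schur ν) (rowExp μ) = dCoeff l μ ν := by
  rw [kronProduct_schur_apply, schurExtract_xCoeff, dCoeff, Nat.cast_inj]
  congr 1
  ext T
  exact and_congr_right' and_comm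

lemma kronProduct_schur_congr (l ν : YoungDiagram) {α α' : ℕ →₀ ℕ}
    (h : α.support.val.map α = α'.support.val.map α') :
    kronProduct (schur l) (schur ν) α = kronProduct (schur l) (schur ν) α' := by
  refine eq_of_map_eq (fun i d => ?_) h
  rw [kronProduct_schur_apply, kronProduct_schur_apply]
  congr 1
  funext β
  have := xCoeff_kronCoproduct_perm (schur_mem_symmetricFunctions l) (Equiv.swap i (i + 1)) 1 d β
  rwa [Equiv.Perm.coe_one, Finsupp.mapDomain_id] at this

lemma eq_of_rowLens_eq {μ μ' : YoungDiagram}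
    (h : (μ.rowLens : Multiset ℕ) = (μ'.rowLens : Multiset ℕ)) : μ = μ' := by
  have h1 : μ.rowLens = μ'.rowLens :=
    (Multiset.coe_eq_coe.1 h).eq_of_pairwise' μ.rowLens_sorted.pairwise μ'.rowLens_sorted.pairwise
  rw [← μ.ofRowLens_to_rowLens_eq_self, ← μ'.ofRowLens_to_rowLens_eq_self]
  congr 1

theorem kronProduct_schur_eq_finsum (l ν : YoungDiagram) :
    kronProduct (schur l) (schur ν) = ∑ᶠ μ : YoungDiagram, (dCoeff l μ ν : ℤ) • msym μ := by
  classical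
  rw [finsum_eq_sum_of_support_subset (s := partitionsLE l.card)]
  · funext α
    obtain ⟨μ, hμ⟩ := exists_rowLens_eq α
    have hm : ∀ μ', msym μ' α = if μ' = μ then 1 else 0 := fun μ' => by
      rw [msym, hμ]
      exact if_congr ⟨fun e => (eq_of_rowLens_eq e).symm, fun e => by rw [e]⟩ rfl rfl
    have hs : (∑ μ' ∈ partitionsLE l.card, (dCoeff l μ' ν : ℤ) • msym μ') α =
        ∑ μ' ∈ partitionsLE l.card, if μ' = μ then (dCoeff l μ' ν : ℤ) else 0 := by
      rw [sum_smul_apply]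
      refine Finset.sum_congr rfl fun μ' _ => ?_
      rw [hm, mul_ite, mul_one, mul_zero]
    rw [hs, Finset.sum_ite_eq', kronProduct_schur_congr l ν (hμ.trans (map_rowExp μ).symm),
      kronProduct_schur_rowExp]
    split_ifs with h
    · rfl
    · by_contra h0
      exact h (mem_partitionsLE.2 (card_eq_of_dCoeff_ne_zero (by exact_mod_cast h0)).le)
  · intro μ hμ
    rw [Finset.mem_coe, mem_partitionsLE]
    refine (card_eq_of_dCoeff_ne_zero (ν := ν) fun h0 => hμ ?_).le
    dsimp only
    rw [h0, Nat.cast_zero, zero_smul]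

end Kron

end

open Kron

theorem theorem1 :
    -- the Schur functions are a basis of the symmetric functions, and the coefficients of `f[xy]`
    -- are symmetric, so that the Hall inner product and the Kronecker product are meaningful
    (LinearIndependent ℤ schur ∧ Submodule.span ℤ (Set.range schur) = symmetricFunctions ∧
      ∀ f ∈ symmetricFunctions, ∀ α : ℕ →₀ ℕ, xCoeff α (kronCoproduct f) ∈ symmetricFunctions) ∧
    -- the crystal structure on bitableaux
    (∀ (l : YoungDiagram) (n m : ℕ), Finite (BoundedBitableau l n m) ∧
      ∃ C : GLCrystal m (BoundedBitableau l n m), IsSortByTopCrystal C ∧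
        (∀ i T S, C.e i T = some S ∨ C.f i T = some S → S.1.aWeight = T.1.aWeight) ∧
        (∀ T, (∀ i, C.e i T = none) ↔ IsYamanouchi T.1.word)) ∧
    -- the monomial expansion of the Kronecker product
    (∀ l ν : YoungDiagram,
      (∀ μ : YoungDiagram, (yamanouchiBitableaux l μ ν).Finite) ∧
      {μ : YoungDiagram | dCoeff l μ ν ≠ 0}.Finite ∧
      kronProduct (schur l) (schur ν) = ∑ᶠ μ : YoungDiagram, (dCoeff l μ ν : ℤ) • msym μ) := by
  refine ⟨⟨linearIndependent_schur, span_schur, fun f hf α => xCoeff_kronCoproduct_mem hf α⟩,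
    fun l n m => ⟨(Bitableau.finite_bounded l n m).to_subtype, bitableauCrystal l n m,
      isSortByTopCrystal_bitableauCrystal l n m, fun i T S h => ?_,
      forall_crystalE_eq_none_iff⟩,
    fun l ν => ⟨fun μ => finite_yamanouchiBitableaux l μ ν, ?_, kronProduct_schur_eq_finsum l ν⟩⟩
  · rcases h with h | h
    · exact Bitableau.aWeight_congr (crystalE_eq_some.1 h).1
    · exact Bitableau.aWeight_congr (crystalF_eq_some.1 h).1
  · exact (finite_card_le l.card).subset fun μ hμ => (card_eq_of_dCoeff_ne_zero hμ).le
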